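/- **Setting.** Let $\mathsf N\ge 1$, $\mathsf x,\mathsf y\in\{0,1\}$, $\omega,\eta\in\mathbb C$ with $\Im\omega>0$, $\xi_1,\dots,\xi_{\mathsf N}\in\mathbb C$, $\kappa\in\mathbb C\setminus\{0\}$, $\Gamma=\pi\mathbb Z+\pi\omega\mathbb Z$, and $$\theta(z)=-i\sum_{k\in\mathbb Z}(-1)^k e^{i\pi\omega(k+\frac12)^2}e^{2i(k+\frac12)z},\qquad t_0=-\tfrac{\eta}{2}\mathsf N+\mathsf x\tfrac{\pi}{2}+\mathsf y\tfrac{\pi}{2}\omega .$$ Assume that $\eta\notin\Gamma$, that $t_0+k\eta\notin\Gamma$ for all $k\in\mathbb Z$ (so that the $R$-matrix has no pole on the heights), and that $\xi_a-\xi_b+\epsilon\eta\notin\Gamma$ for all $a\ne b$ and $\epsilon\in\{-1,0,1\}$. Let $a(\lambda)=\theta(\lambda+\eta)$, $b(\lambda|t)=\theta(\lambda)\theta(t+\eta)/\theta(t)$, $c(\lambda|t)=\theta(\eta)\theta(t+\lambda)/\theta(t)$, and let $$R(\lambda|t)=\begin{pmatrix}a(\lambda)&0&0&0\\0&e^{i\mathsf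 y\eta}b(\lambda|t)&e^{i\mathsf y\lambda}c(\lambda|t)&0\\0&e^{-i\mathsf y\lambda}c(\lambda|-t)&e^{-i\mathsf y\eta}b(\lambda|-t)&0\\0&0&0&a(\lambda)\end{pmatrix}\in\mathrm{End}(\mathbb C^2\otimes\mathbb C^2).$$ The space of kets has the basis $|\mathbf h\rangle\otimes|t(a)\rangle$, $\mathbf h\in\{0,1\}^{\mathsf N}$, $a\in\mathbb Z$, where $t(a)=t_0-\eta a$; the space of bras is its restricted dual, with the dual basis $\langle\mathbf h|\otimes\langle t(a)|$. On it act $\sigma_n^z=1-2h_n$, $\mathsf S=\sum_n\sigma^z_n$, $\tau|t(a)\rangle=t(a)|t(a)\rangle$ and $\mathsf T_\tau^{\pm}|t(a)\rangle=|t(a\pm1)\rangle$. The monodromy matrix is $$\mathsf M_0(\lambda|t)=R_{0\mathsf N}\Big(\lambda-\xi_{\mathsf N}\Big|t+\eta\sum_{k<\mathsf N}\sigma_k^z\Big)\cdots R_{01}(\lambda-\xi_1|t)=\begin{pmatrix}\mathsf A(\lambda|t)&\mathsf B(\lambda|t)\\\mathsf C(\lambda|t)&\mathsf D(\lambda|t)\end{pmatrix},$$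 and $\mathcal B(\lambda)=\mathsf B(\lambda|\tau)\mathsf T_\tau^-$, $\mathcal C(\lambda)=\mathsf C(\lambda|\tau)\mathsf T_\tau^+$. The $\kappa$-twisted antiperiodic transfer matrix is $\overline{\mathcal T}^{(\kappa)}(\lambda)=\kappa^{-1}\mathcal B(\lambda)+\kappa\,\mathcal C(\lambda)$. The right and left spaces of states are the eigenspaces of $\mathsf S_\tau=\eta\mathsf S+2\tau$, acting on kets and on bras, for the eigenvalue $\mathsf x\pi+\mathsf y\pi\omega$. A left or right eigenstate with eigenvalue function $\bar{\mathsf t}:\mathbb C\to\mathbb C$ is a nonzero element of the left or right space of states which is an eigenvector of $\overline{\mathcal T}^{(\kappa)}(\lambda)$ with eigenvalue $\bar{\mathsf t}(\lambda)$ for every $\lambda\in\mathbb C$. The local height operator at site $n$ is $\widehat\delta^{(n)}_s=\delta_s\big(\tau+\eta\sum_{k<n}\sigma^z_k\big)$, where $\delta_s(u)=1$ if $u=s$ and $0$ otherwise. **Separate states.** Let $\mathsf a(\lambda)=\prod_n a(\lambda-\xi_n)$, $\mathsf d(\lambda)=\mathsf a(\lambda-\eta)$, $\mathsf a_{\mathsf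 x,\mathsf y}(\lambda)=(-1)^{\mathsf x+\mathsf y+\mathsf x\mathsf y}\mathsf a(\lambda)$, $\xi_a^{(h)}=\xi_a-\eta h$, $\bar\xi_0=\frac1{\mathsf N}\big(\sum_k\xi_k+t_0\big)$, $$\vartheta_j(\lambda)=\sum_{n\in\mathbb Z}e^{i\pi\mathsf N\omega(n+\frac12-\frac j{\mathsf N})^2+2i\mathsf N(n+\frac12-\frac j{\mathsf N})(\lambda-\frac\pi2)}\quad(0\le j\le\mathsf N-1),\qquad \big[\Theta^{(\mathbf h)}\big]_{ij}=\vartheta_{j-1}(\xi_i^{(h_i)}-\bar\xi_0).$$ For $\mathsf n\in\mathbb C\setminus\{0\}$ put $$\langle 0,\mathbf h|=\frac1{\mathsf n}\,\big(\langle 0,\dots,0|\otimes\langle t_0|\big)\prod_{n=1}^{\mathsf N}\Big(\frac{\mathcal C(\xi_n)}{\mathsf d(\xi_n-\eta)}\Big)^{h_n},\qquad |\mathbf h,0\rangle=\prod_{n=1}^{\mathsf N}\Big(\frac{\mathcal C(\xi_n-\eta)}{\mathsf d(\xi_n-\eta)}\Big)^{1-h_n}\frac1{\mathsf n}\,\big(|1,\dots,1\rangle\otimes|t_0+\mathsf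 N\eta\rangle\big),$$ and call $\mathsf n$ a normalization if $\langle0,\mathbf 0|\mathbf 0,0\rangle=1/\det\Theta^{(\mathbf 0)}$. Coefficients for a function $\bar{\mathsf t}$ are numbers $\mathsf q_{\bar{\mathsf t},a}^{(h)}$ ($1\le a\le\mathsf N$, $h\in\{0,1\}$) with $$\mathsf q_{\bar{\mathsf t},a}^{(0)}\neq0,\qquad \frac{\mathsf q_{\bar{\mathsf t},a}^{(1)}}{\mathsf q_{\bar{\mathsf t},a}^{(0)}}=\frac{\mathsf d(\xi_a-\eta)}{\bar{\mathsf t}(\xi_a-\eta)}=\frac{\bar{\mathsf t}(\xi_a)}{\mathsf a_{\mathsf x,\mathsf y}(\xi_a)} .$$ The associated left and right separate states are $$\langle\Psi_{\bar{\mathsf t}}^{(\kappa)}|=\sum_{\mathbf h}\prod_{a}\Big[(\kappa e^{i\mathsf y\eta})^{h_a}\mathsf q_{\bar{\mathsf t},a}^{(h_a)}\Big]\det\Theta^{(\mathbf h)}\,\langle0,\mathbf h|,\qquad |\Psi_{\bar{\mathsf t}}^{(\kappa)}\rangle=\sum_{\mathbf h}\prod_{a}\Big[\Big(\kappa^{-1}e^{i\mathsf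 y\eta}\frac{\mathsf a_{\mathsf x,\mathsf y}(\xi_a)}{\mathsf d(\xi_a-\eta)}\Big)^{h_a}\mathsf q_{\bar{\mathsf t},a}^{(h_a)}\Big]\det\Theta^{(\mathbf h)}\,|\mathbf h,0\rangle .$$ **Theorem.** A normalization $\mathsf n$ exists. Fix any one. Every left eigenstate of $\overline{\mathcal T}^{(\kappa)}$ with eigenvalue function $\bar{\mathsf t}$ and every right eigenstate with eigenvalue function $\bar{\mathsf t}'$ is a separate state $\langle\Psi_{\bar{\mathsf t}}^{(\kappa)}|$, respectively $|\Psi_{\bar{\mathsf t}'}^{(\kappa)}\rangle$, for suitable coefficients $\mathsf q_{\bar{\mathsf t}}$, $\mathsf q_{\bar{\mathsf t}'}$. For all coefficients that represent the two eigenstates in this way, all $n\in\{1,\dots,\mathsf N\}$ and all $s\in\{t_0+\eta\tilde s:\tilde s=0,1,\dots,\mathsf N\}$, $$\langle\Psi_{\bar{\mathsf t}}^{(\kappa)}|\,\widehat\delta_s^{(n)}\,|\Psi_{\bar{\mathsf t}'}^{(\kappa)}\rangle=\prod_{b=1}^{n-1}\frac{\bar{\mathsf t}(\xi_b)}{\bar{\mathsf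 t}'(\xi_b)}\;\frac1{\mathsf N+1}\sum_{j=0}^{\mathsf N}e^{-2\pi i\frac{j(s-t_0)}{\eta(\mathsf N+1)}}\det_{\mathsf N}\big[\widetilde{\mathcal F}^{(j)}_{\bar{\mathsf t},\bar{\mathsf t}'}\big],$$ where $\widetilde{\mathcal F}^{(j)}_{\bar{\mathsf t},\bar{\mathsf t}'}$ is the $\mathsf N\times\mathsf N$ matrix with elements $$\big[\widetilde{\mathcal F}^{(j)}_{\bar{\mathsf t},\bar{\mathsf t}'}\big]_{a,b}=\sum_{h=0}^1e^{2\pi i\frac{jh}{\mathsf N+1}}\Big(e^{i\mathsf y\eta}\frac{\mathsf a_{\mathsf x,\mathsf y}(\xi_a)}{\mathsf d(\xi_a-\eta)}\Big)^{h}\mathsf q_{\bar{\mathsf t},a}^{(h)}\,\mathsf q_{\bar{\mathsf t}',a}^{(h)}\,\vartheta_{b-1}(\xi_a^{(h)}-\bar\xi_0).$$ -/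

import Mathlib

/-- The data of the dynamical 6-vertex model with `N` sites: the modulus `ω` of the theta functions
(quasi-periods `π` and `πω`), the crossing parameter `η`, the inhomogeneity parameters `ξ₁, …, ξ_N`
and the two parameters `x, y ∈ {0, 1}` of the global shift of the dynamical parameter. -/
structure SOSModel (N : ℕ) where
  ω : ℂ
  η : ℂ
  ξ : Fin N → ℂ
  x : Fin 2
  y : Fin 2

namespace SOSModel

noncomputable section

variable {N : ℕ} (P : SOSModel N)

/-! ### Theta functions -/

/-- `x ∈ {0, 1}` as a complex number. -/
def xc : ℂ := ((P.x : ℕ) : ℂ)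

/-- `y ∈ {0, 1}` as a complex number. -/
def yc : ℂ := ((P.y : ℕ) : ℂ)

/-- The lattice `Γ = πℤ + πωℤ`. -/
def Γ : Set ℂ :=
  {z | ∃ m n : ℤ, z = Real.pi * m + Real.pi * P.ω * n}

/-- The theta function `θ(z) = θ₁(z | ω)`. -/
def θ (z : ℂ) : ℂ :=
  -Complex.I * ∑' k : ℤ, (-1 : ℂ) ^ k
    * Complex.exp (Complex.I * Real.pi * P.ω * ((k : ℂ) + 1 / 2) ^ 2)
    * Complex.exp (2 * Complex.I * ((k : ℂ) + 1 / 2) * z)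

/-- The theta functions `ϑ_j`, `0 ≤ j ≤ N - 1`, of order `N` and norm `0`. -/
def vartheta (j : Fin N) (z : ℂ) : ℂ :=
  ∑' n : ℤ, Complex.exp
    (Complex.I * Real.pi * N * P.ω * ((n : ℂ) + 1 / 2 - ((j : ℕ) : ℂ) / N) ^ 2
      + 2 * Complex.I * N * ((n : ℂ) + 1 / 2 - ((j : ℕ) : ℂ) / N) * (z - Real.pi / 2))

/-! ### The dynamical `R`-matrix and the monodromy matrix

A spin is an element of `Fin 2`: `0` is the spin `+` (eigenvalue `1` of `σ^z`) and `1` is the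
spin `-` (eigenvalue `-1`); in general `σ^z = 1 - 2h`. -/

/-- `a(λ) = θ(λ + η)` -/
def wa (l : ℂ) : ℂ := P.θ (l + P.η)

/-- `b(λ|t) = θ(λ) θ(t + η) / θ(t)` -/
def wb (l t : ℂ) : ℂ := P.θ l * P.θ (t + P.η) / P.θ t

/-- `c(λ|t) = θ(η) θ(t + λ) / θ(t)` -/
def wc (l t : ℂ) : ℂ := P.θ P.η * P.θ (t + l) / P.θ t

/-- The entry of `R(λ|t)` in row `(i, i')` and column `(k, k')`; the first component is the spin in
`V₁`, the second one the spin in `V₂`. -/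
def R (l t : ℂ) : Matrix (Fin 2 × Fin 2) (Fin 2 × Fin 2) ℂ := fun r c =>
  match r, c with
  | (0, 0), (0, 0) => P.wa l
  | (0, 1), (0, 1) => Complex.exp (Complex.I * P.yc * P.η) * P.wb l t
  | (0, 1), (1, 0) => Complex.exp (Complex.I * P.yc * l) * P.wc l t
  | (1, 0), (0, 1) => Complex.exp (-(Complex.I * P.yc * l)) * P.wc l (-t)
  | (1, 0), (1, 0) => Complex.exp (-(Complex.I * P.yc * P.η)) * P.wb l (-t)
  | (1, 1), (1, 1) => P.wa l
  | _, _ => 0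

/-- The eigenvalue `1 - 2h` of `σ^z`. -/
def sz (h : Fin 2) : ℂ := 1 - 2 * ((h : ℕ) : ℂ)

/-- `R_{0,n}(λ - ξ_n | t + η ∑_{a < n} σ_a^z)`, acting on `V₀ ⊗ (V₁ ⊗ ⋯ ⊗ V_N)`. -/
def R0 (l t : ℂ) (n : Fin N) :
    Matrix (Fin 2 × (Fin N → Fin 2)) (Fin 2 × (Fin N → Fin 2)) ℂ := fun r c =>
  if ∀ m, m ≠ n → r.2 m = c.2 m then
    P.R (l - P.ξ n) (t + P.η * ∑ a ∈ Finset.univ.filter (· < n), sz (c.2 a))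
      (r.1, r.2 n) (c.1, c.2 n)
  else 0

/-- The monodromy matrix `M₀(λ|t) = R_{0,N}(…) ⋯ R_{0,1}(…)`. -/
def mono (l t : ℂ) : Matrix (Fin 2 × (Fin N → Fin 2)) (Fin 2 × (Fin N → Fin 2)) ℂ :=
  (List.ofFn fun n : Fin N => P.R0 l t n).reverse.prod

/-- The entry `(i, j)`, with respect to the auxiliary space, of the monodromy matrix: the entries
`(0, 0)`, `(0, 1)`, `(1, 0)`, `(1, 1)` are `A(λ|t)`, `B(λ|t)`, `C(λ|t)`, `D(λ|t)`. -/
def monoEntry (i j : Fin 2) (l t : ℂ) : Matrix (Fin N → Fin 2) (Fin N → Fin 2) ℂ :=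
  fun h h' => P.mono l t (i, h) (j, h')

/-! ### The representation space and the dynamical operators -/

/-- The space of kets: it has the dynamical-spin basis `|h₁, …, h_N⟩ ⊗ |t(a)⟩`, with
`h ∈ {0, 1}^N` and `a ∈ ℤ`. -/
abbrev Ket (N : ℕ) : Type := ((Fin N → Fin 2) × ℤ) →₀ ℂ

/-- Linear functionals on the space of kets. An operator `O` acts on a bra `Φ` from the right by
`Φ O = Φ ∘ O`; the scalar product of a bra and a ket is the evaluation `Φ v`. -/
abbrev Bra (N : ℕ) : Type := Module.Dual ℂ (Ket N)

/-- The basis bra `⟨h₁, …, h_N| ⊗ ⟨t(a)|`. -/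
def basisBra (h : Fin N → Fin 2) (a : ℤ) : Bra N := Finsupp.lapply (h, a)

/-- The basis ket `|h₁, …, h_N⟩ ⊗ |t(a)⟩`. -/
def basisKet (h : Fin N → Fin 2) (a : ℤ) : Ket N := Finsupp.single (h, a) 1

/-- The restricted dual, spanned by the basis bras. -/
def restrictedDual (N : ℕ) : Submodule ℂ (Bra N) :=
  Submodule.span ℂ (Set.range fun p : (Fin N → Fin 2) × ℤ => basisBra p.1 p.2)

/-- `t₀ = -(η/2) N + x π/2 + y (π/2) ω` -/
def t₀ : ℂ := -(P.η / 2) * N + P.xc * (Real.pi / 2) + P.yc * (Real.pi / 2) * P.ω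

/-- `t(a) = t₀ - η a` -/
def tval (a : ℤ) : ℂ := P.t₀ - P.η * a

/-- The operator that is diagonal in the dynamical-spin basis with the given eigenvalues. -/
def diagOp (f : (Fin N → Fin 2) → ℤ → ℂ) : Ket N →ₗ[ℂ] Ket N :=
  Finsupp.linearCombination ℂ fun p => f p.1 p.2 • basisKet p.1 p.2

/-- The dynamical operator `T_τ^k`, with `T_τ^k |t(a)⟩ = |t(a + k)⟩`. -/
def shift (k : ℤ) : Ket N →ₗ[ℂ] Ket N :=
  Finsupp.linearCombination ℂ fun p => basisKet p.1 (p.2 + k)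

/-- The operator `F(τ)` for a family `F(t)` of endomorphisms of the spin space. -/
def atTau (F : ℂ → Matrix (Fin N → Fin 2) (Fin N → Fin 2) ℂ) : Ket N →ₗ[ℂ] Ket N :=
  Finsupp.linearCombination ℂ fun p => ∑ h : Fin N → Fin 2, F (P.tval p.2) h p.1 • basisKet h p.2

/-- The operator `ℬ(λ) = B(λ|τ) T_τ^-`. -/
def opB (l : ℂ) : Ket N →ₗ[ℂ] Ket N := P.atTau (P.monoEntry 0 1 l) ∘ₗ shift (-1)

/-- The operator `𝒞(λ) = C(λ|τ) T_τ^+`. -/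
def opC (l : ℂ) : Ket N →ₗ[ℂ] Ket N := P.atTau (P.monoEntry 1 0 l) ∘ₗ shift 1

/-- The `κ`-twisted antiperiodic transfer matrix `κ⁻¹ ℬ(λ) + κ 𝒞(λ)`. -/
def transfer (κ l : ℂ) : Ket N →ₗ[ℂ] Ket N := κ⁻¹ • P.opB l + κ • P.opC l

/-- `S_τ = η S + 2 τ`, with `S = ∑ σ_n^z`. -/
def opStau : Ket N →ₗ[ℂ] Ket N :=
  diagOp fun h a => P.η * ∑ n, sz (h n) + 2 * P.tval a

/-- The right space of states: the eigenspace of `S_τ` for the eigenvalue `x π + y π ω`. -/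
def spaceR : Submodule ℂ (Ket N) :=
  Module.End.eigenspace P.opStau (P.xc * Real.pi + P.yc * Real.pi * P.ω)

/-- The left space of states: the covectors in the restricted dual that are eigenvectors of
`S_τ`, acting from the right, for the same eigenvalue. -/
def spaceL : Submodule ℂ (Bra N) :=
  restrictedDual N ⊓
    Module.End.eigenspace P.opStau.dualMap (P.xc * Real.pi + P.yc * Real.pi * P.ω)

/-- `Ψ` is a right eigenstate of the family of transfer matrices on the right space of states, with
eigenvalue function `t`. -/
def IsRightEigenstate (κ : ℂ) (t : ℂ → ℂ) (Ψ : Ket N) : Prop :=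
  Ψ ∈ P.spaceR ∧ Ψ ≠ 0 ∧ ∀ l, P.transfer κ l Ψ = t l • Ψ

/-- `Φ` is a left eigenstate of the family of transfer matrices on the left space of states, with
eigenvalue function `t`. -/
def IsLeftEigenstate (κ : ℂ) (t : ℂ → ℂ) (Φ : Bra N) : Prop :=
  Φ ∈ P.spaceL ∧ Φ ≠ 0 ∧ ∀ l, Φ ∘ₗ P.transfer κ l = t l • Φ

/-- The local height operator at site `n`: the projector on the basis states whose height
`t(a) + η ∑_{k < n} σ_k^z` at site `n` is equal to `s`. -/
def localHeight (n : Fin N) (s : ℂ) : Ket N →ₗ[ℂ] Ket N :=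
  diagOp fun h a =>
    if P.tval a + P.η * ∑ k ∈ Finset.univ.filter (· < n), sz (h k) = s then 1 else 0

/-! ### The basis of separate variables and the separate states -/

/-- `𝖺(λ) = ∏ a(λ - ξ_n)` -/
def aProd (l : ℂ) : ℂ := ∏ n, P.wa (l - P.ξ n)

/-- `𝖽(λ) = 𝖺(λ - η)` -/
def dProd (l : ℂ) : ℂ := P.aProd (l - P.η)

/-- `𝖺_{x,y}(λ) = (-1)^{x + y + x y} 𝖺(λ)` -/
def axy (l : ℂ) : ℂ :=
  (-1 : ℂ) ^ ((P.x : ℕ) + (P.y : ℕ) + (P.x : ℕ) * (P.y : ℕ)) * P.aProd l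

/-- `ξ_a^{(h)} = ξ_a - η h` -/
def ξh (a : Fin N) (h : Fin 2) : ℂ := P.ξ a - P.η * ((h : ℕ) : ℂ)

/-- `ξ̄₀ = (∑ ξ_k + t₀) / N` -/
def ξbar : ℂ := (∑ k, P.ξ k + P.t₀) / N

/-- The matrix `Θ^{(0,h)}` with elements `ϑ_{j-1}(ξ_i^{(h_i)} - ξ̄₀)`. -/
def Θ (h : Fin N → Fin 2) : Matrix (Fin N) (Fin N) ℂ :=
  Matrix.of fun i j => P.vartheta j (P.ξh i (h i) - P.ξbar)

/-- The left state `⟨0, h| = ⟨0, 𝟎| ∏ (𝒞(ξ_n) / 𝖽(ξ_n - η))^{h_n}`, with the reference state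
`⟨0, 𝟎| = 𝗇⁻¹ ⟨h = 𝟎| ⊗ ⟨t₀|`, where `t₀ = t(0)`. -/
def sovBra (nrm : ℂ) (h : Fin N → Fin 2) : Bra N :=
  (nrm⁻¹ • basisBra (fun _ => 0) 0) ∘ₗ
    (List.ofFn fun n : Fin N =>
      ((P.dProd (P.ξ n - P.η))⁻¹ • P.opC (P.ξ n) : Module.End ℂ (Ket N)) ^ (h n : ℕ)).prod

/-- The right state `|h, 0⟩ = ∏ (𝒞(ξ_n - η) / 𝖽(ξ_n - η))^{1 - h_n} |𝟏, 0⟩`, with the reference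
state `|𝟏, 0⟩ = 𝗇⁻¹ |h = 𝟏⟩ ⊗ |t₀ + N η⟩`, where `t₀ + N η = t(-N)`. -/
def sovKet (nrm : ℂ) (h : Fin N → Fin 2) : Ket N :=
  (List.ofFn fun n : Fin N =>
    ((P.dProd (P.ξ n - P.η))⁻¹ • P.opC (P.ξ n - P.η) : Module.End ℂ (Ket N))
      ^ (1 - (h n : ℕ))).prod
    (nrm⁻¹ • basisKet (fun _ => 1) (-(N : ℤ)))

/-- The choice of the normalization constant `𝗇` of the two reference states: it is fixed, up to its
sign, by `⟨0, 𝟎 | 𝟎, 0⟩ = 1 / det Θ^{(0,𝟎)}`. -/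
def IsNormalization (nrm : ℂ) : Prop :=
  nrm ≠ 0 ∧
    P.sovBra nrm (fun _ => 0) (P.sovKet nrm (fun _ => 0)) = 1 / (P.Θ fun _ => 0).det

/-- The coefficients `q_{t,a}^{(h)}` associated with an eigenvalue function `t`. -/
def IsCoeff (t : ℂ → ℂ) (q : Fin N → Fin 2 → ℂ) : Prop :=
  ∀ a, q a 0 ≠ 0 ∧
    q a 1 / q a 0 = P.dProd (P.ξ a - P.η) / t (P.ξ a - P.η) ∧
    q a 1 / q a 0 = t (P.ξ a) / P.axy (P.ξ a)

/-- The left separate state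
`∑_h ∏_a [(κ e^{iyη})^{h_a} q_a^{(h_a)}] det Θ^{(0,h)} ⟨0, h|`. -/
def sepBra (nrm κ : ℂ) (q : Fin N → Fin 2 → ℂ) : Bra N :=
  ∑ h : Fin N → Fin 2,
    ((∏ a, ((κ * Complex.exp (Complex.I * P.yc * P.η)) ^ (h a : ℕ) * q a (h a)))
      * (P.Θ h).det) • P.sovBra nrm h

/-- The right separate state
`∑_h ∏_a [(κ⁻¹ e^{iyη} 𝖺_{x,y}(ξ_a) / 𝖽(ξ_a - η))^{h_a} q_a^{(h_a)}] det Θ^{(0,h)} |h, 0⟩`. -/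
def sepKet (nrm κ : ℂ) (q : Fin N → Fin 2 → ℂ) : Ket N :=
  ∑ h : Fin N → Fin 2,
    ((∏ a, ((κ⁻¹ * Complex.exp (Complex.I * P.yc * P.η)
        * (P.axy (P.ξ a) / P.dProd (P.ξ a - P.η))) ^ (h a : ℕ) * q a (h a)))
      * (P.Θ h).det) • P.sovKet nrm h

/-- The `N × N` matrix with elements
`∑_{h = 0,1} e^{2πi j h / (N+1)} (e^{iyη} 𝖺_{x,y}(ξ_a) / 𝖽(ξ_a - η))^h q_a^{(h)} q'_a^{(h)}
  ϑ_{b-1}(ξ_a^{(h)} - ξ̄₀)`. -/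
def Ftilde (q q' : Fin N → Fin 2 → ℂ) (j : ℕ) : Matrix (Fin N) (Fin N) ℂ :=
  Matrix.of fun a b => ∑ h : Fin 2,
    Complex.exp (2 * Real.pi * Complex.I * j * ((h : ℕ) : ℂ) / (N + 1))
      * (Complex.exp (Complex.I * P.yc * P.η)
          * (P.axy (P.ξ a) / P.dProd (P.ξ a - P.η))) ^ (h : ℕ)
      * q a h * q' a h * P.vartheta b (P.ξh a h - P.ξbar)

end

end SOSModel

/-! On the space of states the label of the height is fixed by the spins (`a = -numDown h`), so `ℬ`,
`𝒞` and the transfer matrix become matrices `gr`, `tm` indexed by spin configurations. The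
three-term relation for `θ` gives the dynamical Yang–Baxter equation, hence the exchange relation of
two monodromy matrices (`exchange_relation`). At the parameters `ξ_a` and `ξ_a - η` the product of
two monodromy matrices is antisymmetric in the left auxiliary indices (`twoRow_fusion`). Thus
`𝒞(ξ_a) 𝒞(ξ_a - η)` and `ℬ(ξ_a) ℬ(ξ_a - η)` vanish, and the transfer matrices at these two points
multiply to the quantum determinant, a scalar on the space of states (`tm_mul_tm`).

Separation of variables: `ℬ(ξ_a)` kills `⟨0,h|` if `h_a = 0`, and `ℬ(ξ_a - η)` kills `|h,0⟩` if `h_a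
= 1` (`vecMul_sb_eq_zero`, `mulVec_sk_eq_zero`). There the transfer matrix only flips `h_a`, so the
components of an eigenvector factorise over the sites. The two families are orthogonal. If `k`
arises from `h` by flipping site `a`, then `⟨0,h| 𝒞(λ) |k,0⟩` is, up to an exponential, a theta
function of order `N` with `N - 1` known zeros, hence proportional to a determinant of the `ϑ_j`
(`mul_det_vartheta_eq`). Its values at `ξ_a` and `ξ_a - η` are multiples of the pairings at `k` and
at `h`, so `⟨0,h|h,0⟩` is `1 / det Θ^{(h)}` up to a power of `exp(-iyη)`. Both families are
therefore bases, and eigenstates are separate states.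

Local heights: at `λ = ξ_n` the `R`-matrix of site `n` is a permutation up to weights, so the
transfer matrix at `ξ_n` intertwines the height projectors of sites `n` and `n + 1`
(`siteHeight_of_tm_ne_zero`). Between eigenstates, moving the projector back to the first site
produces the quotients of eigenvalues. The height at the first site is `t₀ + η |h|`, and `|h,0⟩`
lives on configurations with `|h|` down spins, so the projector selects one value of `|h|`. A sum
over `(N+1)`-th roots of unity makes this selection, and for each root the sum over `h` is one
determinant by multilinearity (`det_Ftilde`). -/

/-! ### Jacobi theta functions -/

open Complex in
theorem neg_cexp (z : ℂ) : -cexp z = cexp (z - Real.pi * I) := by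
  rw [Complex.exp_sub, Complex.exp_pi_mul_I, div_neg, div_one]

open Complex in
/-- Product formula for the two-variable theta function, with the modulus doubled on the right. -/
theorem jacobiTheta₂_mul_jacobiTheta₂ (u v : ℂ) {τ : ℂ} (hτ : 0 < τ.im) :
    jacobiTheta₂ u τ * jacobiTheta₂ v τ =
      jacobiTheta₂ (u + v) (2 * τ) * jacobiTheta₂ (u - v) (2 * τ)
        + cexp (Real.pi * I * τ + 2 * Real.pi * I * u)
          * (jacobiTheta₂ (u + v + τ) (2 * τ) * jacobiTheta₂ (u - v + τ) (2 * τ)) := by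
  have hτ2 : 0 < (2 * τ).im := by simpa using hτ
  have hs : ∀ w {σ : ℂ}, 0 < σ.im → Summable fun n => ‖jacobiTheta₂_term n w σ‖ :=
    fun w σ h => ((summable_jacobiTheta₂_term_iff w σ).2 h).norm
  -- Pairs of integers are split by the parity of their difference. In the coordinates of half-sum
  -- and half-difference the form `m² + n²` becomes `2(a² + b²)` plus linear terms, which is why the
  -- modulus doubles.
  let e : (ℤ × ℤ) ⊕ (ℤ × ℤ) ≃ ℤ × ℤ :=
    { toFun := Sum.elim (fun p => (p.1 + p.2, p.1 - p.2)) (fun p => (p.1 + p.2 + 1, p.1 - p.2))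
      invFun := fun p => if (p.1 - p.2) % 2 = 0 then Sum.inl ((p.1 + p.2) / 2, (p.1 - p.2) / 2)
        else Sum.inr ((p.1 + p.2 - 1) / 2, (p.1 - p.2 - 1) / 2)
      left_inv := by
        rintro (⟨a, b⟩ | ⟨a, b⟩)
        · have : (a + b - (a - b)) % 2 = 0 := by omega
          simp only [Sum.elim_inl, this, if_true, Sum.inl.injEq, Prod.mk.injEq]
          omega
        · have : ¬ (a + b + 1 - (a - b)) % 2 = 0 := by omega
          simp only [Sum.elim_inr, this, if_false, Sum.inr.injEq, Prod.mk.injEq]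
          omega
      right_inv := by
        rintro ⟨m, n⟩
        by_cases h : (m - n) % 2 = 0
        · simp only [h, if_true, Sum.elim_inl, Prod.mk.injEq]
          omega
        · simp only [h, if_false, Sum.elim_inr, Prod.mk.injEq]
          omega }
  have h1 := (summable_mul_of_summable_norm (hs (u + v) hτ2) (hs (u - v) hτ2)).hasSum
  have h2 := ((summable_mul_of_summable_norm (hs (u + v + τ) hτ2) (hs (u - v + τ) hτ2)).hasSum).mul_left
    (cexp (Real.pi * I * τ + 2 * Real.pi * I * u))
  rw [← tsum_mul_tsum_of_summable_norm (hs _ hτ2) (hs _ hτ2)] at h1 h2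
  have h3 := (summable_mul_of_summable_norm (hs u hτ) (hs v hτ)).hasSum
  rw [← tsum_mul_tsum_of_summable_norm (hs _ hτ) (hs _ hτ), ← e.hasSum_iff] at h3
  unfold jacobiTheta₂
  refine h3.unique (HasSum.sum ?_ ?_)
  · refine (congrArg (fun g => HasSum g _) (funext fun p => ?_)).mpr h1
    simp only [e, Function.comp, Equiv.coe_fn_mk, Sum.elim_inl, jacobiTheta₂_term, ← Complex.exp_add]
    push_cast
    ring_nf
  · refine (congrArg (fun g => HasSum g _) (funext fun p => ?_)).mpr h2
    simp only [e, Function.comp, Equiv.coe_fn_mk, Sum.elim_inr, jacobiTheta₂_term, ← Complex.exp_add]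
    push_cast
    ring_nf

open Complex in
-- Only the constant Fourier mode survives the integration over a period. The purpose is that the
-- theta function does not vanish identically.
theorem integral_jacobiTheta₂ {τ : ℂ} (hτ : 0 < τ.im) :
    ∫ x in (0 : ℝ)..1, jacobiTheta₂ x τ = 1 := by
  let f : ℤ → C(ℝ, ℂ) := fun n => ⟨fun x : ℝ => jacobiTheta₂_term n x τ, by
    unfold jacobiTheta₂_term; fun_prop⟩
  have hn : ∀ (n : ℤ) (x : ℝ), ‖jacobiTheta₂_term n x τ‖ = ‖jacobiTheta₂_term n 0 τ‖ := by
    intro n x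
    simp [norm_jacobiTheta₂_term]
  have hs : Summable fun n : ℤ => ‖jacobiTheta₂_term n 0 τ‖ :=
    ((summable_jacobiTheta₂_term_iff 0 τ).2 hτ).norm
  have h := intervalIntegral.hasSum_intervalIntegral_of_summable_norm (a := 0) (b := 1) (f := f) (by
    refine Summable.of_nonneg_of_le (fun _ => norm_nonneg _) (fun n => ?_) hs
    refine (ContinuousMap.norm_le _ (norm_nonneg _)).2 fun x => ?_
    exact (hn n x).le)
  refine h.unique ?_
  have hz : ∀ n : ℤ, n ≠ 0 → ∫ x in (0 : ℝ)..1, f n x = 0 := by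
    intro n hn0
    have hc : (2 * Real.pi * I * n : ℂ) ≠ 0 := by
      simp [Real.pi_ne_zero, hn0]
    have : ∀ x : ℝ, f n x = cexp (2 * Real.pi * I * n * x) * cexp (Real.pi * I * n ^ 2 * τ) := by
      intro x
      simp [f, jacobiTheta₂_term, Complex.exp_add]
    simp_rw [this]
    rw [intervalIntegral.integral_mul_const, integral_exp_mul_complex hc]
    have : cexp (2 * Real.pi * I * n) = 1 := by
      rw [mul_comm, Complex.exp_int_mul_two_pi_mul_I]
    simp [this]
  have h0 : ∫ x in (0 : ℝ)..1, f 0 x = 1 := by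
    simp [f, jacobiTheta₂_term]
  have := hasSum_single (f := fun n => ∫ x in (0 : ℝ)..1, f n x) 0 hz
  simpa [h0] using this

theorem exists_jacobiTheta₂_ne_zero {τ : ℂ} (hτ : 0 < τ.im) : ∃ z, jacobiTheta₂ z τ ≠ 0 := by
  by_contra! h
  have := integral_jacobiTheta₂ hτ
  simp [h] at this

theorem differentiable_jacobiTheta₂ {τ : ℂ} (hτ : 0 < τ.im) :
    Differentiable ℂ fun z => jacobiTheta₂ z τ :=
  fun z => differentiableAt_jacobiTheta₂_fst z hτ

namespace SOSModel

open Complex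

variable {N : ℕ} (P : SOSModel N)

/-! ### The theta function of the model -/

/-- The sign `(-1)^k` is absorbed by the shift `1/2` of the argument, and the half-integer
characteristic by the shift `ω/2`. -/
theorem θ_eq (z : ℂ) : P.θ z = -I * cexp (Real.pi * I * P.ω / 4 + I * z)
    * jacobiTheta₂ (z / Real.pi + P.ω / 2 + 1 / 2) P.ω := by
  have hp : (Real.pi : ℂ) ≠ 0 := by simp [Real.pi_ne_zero]
  rw [θ, jacobiTheta₂, mul_assoc (-I)]
  congr 1
  rw [← tsum_mul_left]
  refine tsum_congr fun k => ?_
  have h1 : (-1 : ℂ) ^ k = cexp (Real.pi * I * k) := by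
    rw [mul_comm, Complex.exp_int_mul, Complex.exp_pi_mul_I]
  rw [h1, jacobiTheta₂_term, ← Complex.exp_add, ← Complex.exp_add, ← Complex.exp_add]
  congr 1
  field_simp
  ring

theorem vartheta_eq (hN : N ≠ 0) (j : Fin N) (z : ℂ) : P.vartheta j z =
    cexp (I * Real.pi * N * P.ω * (1 / 2 - ((j : ℕ) : ℂ) / N) ^ 2
      + 2 * I * N * (1 / 2 - ((j : ℕ) : ℂ) / N) * (z - Real.pi / 2))
    * jacobiTheta₂ (N * (P.ω * (1 / 2 - ((j : ℕ) : ℂ) / N) + z / Real.pi - 1 / 2)) (N * P.ω) := by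
  have hp : (Real.pi : ℂ) ≠ 0 := by simp [Real.pi_ne_zero]
  have hN' : (N : ℂ) ≠ 0 := by exact_mod_cast hN
  rw [vartheta, jacobiTheta₂, ← tsum_mul_left]
  refine tsum_congr fun k => ?_
  rw [jacobiTheta₂_term, ← Complex.exp_add]
  congr 1
  field_simp
  ring

variable {P}

theorem differentiable_θ (hω : 0 < P.ω.im) : Differentiable ℂ P.θ := by
  have h := differentiable_jacobiTheta₂ hω
  have : P.θ = fun z => -I * cexp (Real.pi * I * P.ω / 4 + I * z)
    * jacobiTheta₂ (z / Real.pi + P.ω / 2 + 1 / 2) P.ω := funext P.θ_eq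
  rw [this]
  refine Differentiable.mul (by fun_prop) ?_
  exact h.comp (f := fun z : ℂ => z / Real.pi + P.ω / 2 + 1 / 2) (by fun_prop)

theorem im_natCast_mul_pos (hω : 0 < P.ω.im) (hN : N ≠ 0) : 0 < ((N : ℂ) * P.ω).im := by
  rw [← Complex.ofReal_natCast, Complex.im_ofReal_mul]
  positivity

theorem differentiable_vartheta (hω : 0 < P.ω.im) (j : Fin N) :
    Differentiable ℂ (P.vartheta j) := by
  have hN : N ≠ 0 := by rintro rfl; exact j.elim0
  have h := differentiable_jacobiTheta₂ (im_natCast_mul_pos hω hN)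
  rw [funext (P.vartheta_eq hN j)]
  refine Differentiable.mul (by fun_prop) ?_
  exact h.comp (f := fun z : ℂ => (N : ℂ) * (P.ω * (1 / 2 - ((j : ℕ) : ℂ) / N) + z / Real.pi - 1 / 2))
    (by fun_prop)

theorem exists_θ_ne_zero (hω : 0 < P.ω.im) : ∃ z, P.θ z ≠ 0 := by
  obtain ⟨z, hz⟩ := exists_jacobiTheta₂_ne_zero hω
  have hp : (Real.pi : ℂ) ≠ 0 := by simp [Real.pi_ne_zero]
  refine ⟨Real.pi * (z - P.ω / 2 - 1 / 2), ?_⟩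
  rw [θ_eq, show (Real.pi : ℂ) * (z - P.ω / 2 - 1 / 2) / Real.pi + P.ω / 2 + 1 / 2 = z by
    field_simp; ring]
  exact mul_ne_zero (mul_ne_zero (by simp) (Complex.exp_ne_zero _)) hz

theorem exists_vartheta_ne_zero (hω : 0 < P.ω.im) (j : Fin N) : ∃ z, P.vartheta j z ≠ 0 := by
  have hN : N ≠ 0 := by rintro rfl; exact j.elim0
  have hN' : (N : ℂ) ≠ 0 := by exact_mod_cast hN
  obtain ⟨z, hz⟩ := exists_jacobiTheta₂_ne_zero (im_natCast_mul_pos hω hN)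
  have hp : (Real.pi : ℂ) ≠ 0 := by simp [Real.pi_ne_zero]
  refine ⟨Real.pi * (z / N - P.ω * (1 / 2 - ((j : ℕ) : ℂ) / N) + 1 / 2), ?_⟩
  rw [vartheta_eq _ hN, show (N : ℂ) * (P.ω * (1 / 2 - ((j : ℕ) : ℂ) / N)
    + Real.pi * (z / N - P.ω * (1 / 2 - ((j : ℕ) : ℂ) / N) + 1 / 2) / Real.pi - 1 / 2) = z by
    field_simp; ring]
  exact mul_ne_zero (Complex.exp_ne_zero _) hz

theorem θ_add_pi (z : ℂ) : P.θ (z + Real.pi) = -P.θ z := by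
  have hp : (Real.pi : ℂ) ≠ 0 := by simp [Real.pi_ne_zero]
  rw [θ_eq, θ_eq, show (z + Real.pi) / (Real.pi : ℂ) + P.ω / 2 + 1 / 2
    = z / Real.pi + P.ω / 2 + 1 / 2 + 1 by field_simp; ring, jacobiTheta₂_add_left,
    show Real.pi * I * P.ω / 4 + I * (z + Real.pi) = Real.pi * I * P.ω / 4 + I * z + Real.pi * I by ring,
    Complex.exp_add _ (Real.pi * I : ℂ), Complex.exp_pi_mul_I]
  ring

theorem θ_add_pi_mul (z : ℂ) :
    P.θ (z + Real.pi * P.ω) = -cexp (-2 * I * z - I * Real.pi * P.ω) * P.θ z := by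
  have hp : (Real.pi : ℂ) ≠ 0 := by simp [Real.pi_ne_zero]
  rw [θ_eq, θ_eq, show (z + Real.pi * P.ω) / (Real.pi : ℂ) + P.ω / 2 + 1 / 2
    = z / Real.pi + P.ω / 2 + 1 / 2 + P.ω by field_simp; ring, jacobiTheta₂_add_left']
  have : cexp (Real.pi * I * P.ω / 4 + I * (z + Real.pi * P.ω))
      * cexp (-Real.pi * I * (P.ω + 2 * (z / Real.pi + P.ω / 2 + 1 / 2)))
      = -cexp (-2 * I * z - I * Real.pi * P.ω) * cexp (Real.pi * I * P.ω / 4 + I * z) := by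
    rw [neg_cexp, ← Complex.exp_add, ← Complex.exp_add]
    congr 1
    field_simp
    ring
  linear_combination (-I * jacobiTheta₂ (z / Real.pi + P.ω / 2 + 1 / 2) P.ω) * this

theorem θ_neg (z : ℂ) : P.θ (-z) = -P.θ z := by
  rw [θ_eq, θ_eq, ← jacobiTheta₂_neg_left, show -(-z / Real.pi + P.ω / 2 + 1 / 2)
    = z / Real.pi - P.ω / 2 - 1 / 2 by ring,
    ← jacobiTheta₂_add_left, show z / Real.pi + P.ω / 2 + 1 / 2
      = z / Real.pi - P.ω / 2 - 1 / 2 + 1 + P.ω by ring, jacobiTheta₂_add_left' _ P.ω]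
  have hp : (Real.pi : ℂ) ≠ 0 := by simp [Real.pi_ne_zero]
  have : cexp (Real.pi * I * P.ω / 4 + I * z)
      * cexp (-Real.pi * I * (P.ω + 2 * (z / Real.pi - P.ω / 2 - 1 / 2 + 1)))
      = -cexp (Real.pi * I * P.ω / 4 + I * -z) := by
    rw [neg_cexp, ← Complex.exp_add]
    congr 1
    field_simp
    ring
  linear_combination (-I * jacobiTheta₂ (z / Real.pi - P.ω / 2 - 1 / 2 + 1) P.ω) * this

theorem θ_zero : P.θ 0 = 0 := by
  have h := θ_neg (P := P) 0
  rw [neg_zero] at h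
  exact self_eq_neg.1 h

theorem vartheta_add_pi (j : Fin N) (z : ℂ) :
    P.vartheta j (z + Real.pi) = (-1) ^ N * P.vartheta j z := by
  have hN : N ≠ 0 := by rintro rfl; exact j.elim0
  have hN' : (N : ℂ) ≠ 0 := by exact_mod_cast hN
  have hp : (Real.pi : ℂ) ≠ 0 := by simp [Real.pi_ne_zero]
  rw [vartheta, vartheta, ← tsum_mul_left]
  refine tsum_congr fun n => ?_
  have : (-1 : ℂ) ^ N = cexp (2 * I * N * ((n : ℂ) + 1 / 2 - ((j : ℕ) : ℂ) / N) * Real.pi) := by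
    rw [← Complex.exp_pi_mul_I, ← Complex.exp_nat_mul, Complex.exp_eq_exp_iff_exists_int]
    refine ⟨-(N * n - j), ?_⟩
    push_cast
    field_simp
    ring
  rw [this, ← Complex.exp_add]
  congr 1
  ring

theorem vartheta_add_pi_mul (j : Fin N) (z : ℂ) :
    P.vartheta j (z + Real.pi * P.ω)
      = (-1) ^ N * cexp (-2 * I * N * z - I * Real.pi * N * P.ω) * P.vartheta j z := by
  rw [vartheta, vartheta, ← tsum_mul_left, ← (Equiv.addRight (1 : ℤ)).tsum_eq (fun n : ℤ =>
    (-1) ^ N * cexp (-2 * I * N * z - I * Real.pi * N * P.ω) * cexp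
    (Complex.I * Real.pi * N * P.ω * ((n : ℂ) + 1 / 2 - ((j : ℕ) : ℂ) / N) ^ 2
      + 2 * Complex.I * N * ((n : ℂ) + 1 / 2 - ((j : ℕ) : ℂ) / N) * (z - Real.pi / 2)))]
  refine tsum_congr fun n => ?_
  rw [← Complex.exp_pi_mul_I, ← Complex.exp_nat_mul, ← Complex.exp_add, ← Complex.exp_add]
  congr 1
  simp only [Equiv.coe_addRight]
  push_cast
  ring

/-- The functions `ϑ_j` are eigenfunctions of the translation by `π / N`. -/
theorem vartheta_add_pi_div (j : Fin N) (z : ℂ) :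
    P.vartheta j (z + Real.pi / N) = -cexp (-(2 * Real.pi * I * ((j : ℕ) : ℂ) / N)) * P.vartheta j z := by
  have hN : N ≠ 0 := by rintro rfl; exact j.elim0
  have hN' : (N : ℂ) ≠ 0 := by exact_mod_cast hN
  rw [vartheta, vartheta, ← tsum_mul_left]
  refine tsum_congr fun n => ?_
  have : -cexp (-(2 * Real.pi * I * ((j : ℕ) : ℂ) / N))
      = cexp (2 * I * N * ((n : ℂ) + 1 / 2 - ((j : ℕ) : ℂ) / N) * (Real.pi / N)) := by
    rw [← mul_neg_one, ← Complex.exp_pi_mul_I, ← Complex.exp_add, Complex.exp_eq_exp_iff_exists_int]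
    refine ⟨-n, ?_⟩
    push_cast
    field_simp
    ring
  rw [this, ← Complex.exp_add]
  congr 1
  ring

/-- `θ(x + y) θ(x - y)` as an alternating expression in two theta functions of modulus `2ω`. -/
theorem exists_θ_add_mul_θ_sub (hω : 0 < P.ω.im) : ∃ f g : ℂ → ℂ,
    Differentiable ℂ f ∧ Differentiable ℂ g ∧
      ∀ x y, P.θ (x + y) * P.θ (x - y) = f x * g y - g x * f y := by
  have hp : (Real.pi : ℂ) ≠ 0 := by simp [Real.pi_ne_zero]
  have hω2 : 0 < (2 * P.ω).im := by simpa using hω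
  have hJ := differentiable_jacobiTheta₂ hω2
  -- The two functions are the even and odd halves in the product formula, whose arguments `u + v`
  -- and `u - v` separate `x` from `y`.
  refine ⟨fun x => jacobiTheta₂ (2 * x / Real.pi) (2 * P.ω),
    fun x => cexp (Real.pi * I * P.ω / 2 + 2 * I * x) * jacobiTheta₂ (2 * x / Real.pi + P.ω) (2 * P.ω),
    hJ.comp (f := fun x : ℂ => 2 * x / Real.pi) (by fun_prop),
    Differentiable.mul (by fun_prop) (hJ.comp (f := fun x : ℂ => 2 * x / Real.pi + P.ω) (by fun_prop)),
    fun x y => ?_⟩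
  have h := jacobiTheta₂_mul_jacobiTheta₂ ((x + y) / Real.pi + P.ω / 2 + 1 / 2)
    ((x - y) / Real.pi + P.ω / 2 + 1 / 2) hω
  rw [show (x + y) / Real.pi + P.ω / 2 + 1 / 2 + ((x - y) / Real.pi + P.ω / 2 + 1 / 2)
      = 2 * x / Real.pi + P.ω + 1 by ring,
    show (x + y) / Real.pi + P.ω / 2 + 1 / 2 - ((x - y) / Real.pi + P.ω / 2 + 1 / 2)
      = 2 * y / Real.pi by ring,
    show 2 * x / Real.pi + P.ω + 1 + P.ω = 2 * x / Real.pi + 1 + 2 * P.ω by ring,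
    jacobiTheta₂_add_left' _ (2 * P.ω), jacobiTheta₂_add_left, jacobiTheta₂_add_left] at h
  rw [θ_eq, θ_eq]
  simp only
  have e1 : cexp (Real.pi * I * P.ω / 4 + I * (x + y)) * cexp (Real.pi * I * P.ω / 4 + I * (x - y))
      = cexp (Real.pi * I * P.ω / 2 + 2 * I * x) := by
    rw [← Complex.exp_add]; congr 1; ring
  have e2 : cexp (Real.pi * I * P.ω / 4 + I * (x + y)) * cexp (Real.pi * I * P.ω / 4 + I * (x - y))
      * (cexp (Real.pi * I * P.ω + 2 * Real.pi * I * ((x + y) / Real.pi + P.ω / 2 + 1 / 2))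
      * cexp (-Real.pi * I * (2 * P.ω + 2 * (2 * x / Real.pi + 1))))
      = -cexp (Real.pi * I * P.ω / 2 + 2 * I * y) := by
    rw [neg_cexp, ← Complex.exp_add, ← Complex.exp_add, ← Complex.exp_add]
    congr 1
    field_simp
    ring
  generalize cexp (Real.pi * I * P.ω / 4 + I * (x + y)) = E1 at *
  generalize cexp (Real.pi * I * P.ω / 4 + I * (x - y)) = E2 at *
  linear_combination (exp := 1) (E1 * E2 * I ^ 2) * h
    + (I ^ 2 * jacobiTheta₂ (2 * x / Real.pi) (2 * P.ω) * jacobiTheta₂ (2 * y / Real.pi + P.ω) (2 * P.ω)) * e2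
    + (I ^ 2 * jacobiTheta₂ (2 * x / Real.pi + P.ω) (2 * P.ω) * jacobiTheta₂ (2 * y / Real.pi) (2 * P.ω)) * e1
    + (jacobiTheta₂ (2 * y / Real.pi) (2 * P.ω) * jacobiTheta₂ (2 * x / Real.pi + P.ω) (2 * P.ω)
        * cexp (Real.pi * I * P.ω / 2 + 2 * I * x)
      - jacobiTheta₂ (2 * x / Real.pi) (2 * P.ω) * jacobiTheta₂ (2 * y / Real.pi + P.ω) (2 * P.ω)
        * cexp (Real.pi * I * P.ω / 2 + 2 * I * y)) * Complex.I_sq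

/-- The three-term relation. -/
theorem θ_three_term (hω : 0 < P.ω.im) (x y z w : ℂ) :
    P.θ (x + y) * P.θ (x - y) * (P.θ (z + w) * P.θ (z - w))
      + P.θ (x + z) * P.θ (x - z) * (P.θ (w + y) * P.θ (w - y))
      + P.θ (x + w) * P.θ (x - w) * (P.θ (y + z) * P.θ (y - z)) = 0 := by
  -- Each product is now a 2×2 determinant, so the claim is the Plücker relation for four vectors in
  -- the plane.
  obtain ⟨f, g, -, -, h⟩ := exists_θ_add_mul_θ_sub hω
  simp only [h]
  ring

end SOSModel


/-! ### Entire functions -/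

theorem Differentiable.exists_mul_ne_zero {f g : ℂ → ℂ} (hf : Differentiable ℂ f)
    (hg : Differentiable ℂ g) (hf0 : ∃ z, f z ≠ 0) (hg0 : ∃ z, g z ≠ 0) : ∃ z, f z * g z ≠ 0 := by
  by_contra! h
  have := AnalyticOnNhd.eq_zero_or_eq_zero_of_mul_eq_zero (U := Set.univ)
    (fun z _ => hf.analyticAt z) (fun z _ => hg.analyticAt z) (fun z _ => h z) isPreconnected_univ
  obtain ⟨a, ha⟩ := hf0
  obtain ⟨b, hb⟩ := hg0
  rcases this with h | h
  · exact ha (h a trivial)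
  · exact hb (h b trivial)

theorem Differentiable.eq_zero_of_mul_eq_zero {f g : ℂ → ℂ} (hf : Differentiable ℂ f)
    (hg : Differentiable ℂ g) (hg0 : ∃ z, g z ≠ 0) (h : ∀ z, f z * g z = 0) (z : ℂ) : f z = 0 := by
  by_contra hz
  obtain ⟨w, hw⟩ := hf.exists_mul_ne_zero hg ⟨z, hz⟩ hg0
  exact hw (h w)

/-- Two entire functions with vanishing Wronskian are proportional. -/
theorem Differentiable.mul_eq_mul_of_wronskian_eq_zero {f g : ℂ → ℂ} (hf : Differentiable ℂ f)
    (hg : Differentiable ℂ g) (h : ∀ z, _root_.deriv f z * g z = f z * _root_.deriv g z) {z₀ : ℂ} (h0 : g z₀ ≠ 0)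
    (z : ℂ) : f z * g z₀ = f z₀ * g z := by
  obtain ⟨r, hr, hrg⟩ := Metric.mem_nhds_iff.1 ((hg.continuous.continuousAt).eventually_ne h0)
  have hd : ∀ w ∈ Metric.ball z₀ r, HasDerivAt (fun z => f z / g z) 0 w := by
    intro w hw
    have := (hf w).hasDerivAt.div (hg w).hasDerivAt (hrg hw)
    rwa [h, sub_self, zero_div] at this
  have hc : ∀ w ∈ Metric.ball z₀ r, f w / g w = f z₀ / g z₀ := fun w hw =>
    Metric.isOpen_ball.is_const_of_deriv_eq_zero (convex_ball z₀ r).isPreconnected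
      (fun w hw => (hd w hw).differentiableAt.differentiableWithinAt) (fun w hw => (hd w hw).deriv)
      hw (Metric.mem_ball_self hr)
  have := AnalyticOnNhd.eq_of_eventuallyEq (z₀ := z₀) (f := fun z => f z * g z₀)
    (g := fun z => f z₀ * g z) (fun z _ => (hf.mul_const _).analyticAt z)
    (fun z _ => (hg.const_mul _).analyticAt z) (by
      filter_upwards [Metric.ball_mem_nhds z₀ hr] with w hw
      have h1 := hc w hw
      rwa [div_eq_div_iff (hrg hw) h0] at h1)
  exact congrFun this z

/-- Division by an entire function with simple zeros. -/
theorem Differentiable.exists_eq_mul_of_simple_zeros {f g : ℂ → ℂ} (hf : Differentiable ℂ f)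
    (hg : Differentiable ℂ g) (h : ∀ z, f z = 0 → _root_.deriv f z ≠ 0 ∧ g z = 0) :
    ∃ q : ℂ → ℂ, Differentiable ℂ q ∧ ∀ z, g z = q z * f z := by
  have hslope : ∀ {k : ℂ → ℂ}, Differentiable ℂ k → ∀ p, Differentiable ℂ (dslope k p) :=
    fun hk p => differentiableOn_univ.1
      ((Complex.differentiableOn_dslope Filter.univ_mem).2 hk.differentiableOn)
  -- At a zero of `f` the quotient takes its limit, the ratio of derivatives. Near such a point both
  -- functions are replaced by their `dslope`, which turns the quotient into one with nonzero
  -- denominator.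
  refine ⟨fun z => if f z = 0 then _root_.deriv g z / _root_.deriv f z else g z / f z, fun p => ?_, fun z => ?_⟩
  · by_cases hp : f p = 0
    · have h1 : dslope f p p ≠ 0 := by rw [dslope_same]; exact (h p hp).1
      have h2 : ∀ᶠ z in nhds p, dslope f p z ≠ 0 :=
        (hslope hf p).continuous.continuousAt.eventually_ne h1
      refine DifferentiableAt.congr_of_eventuallyEq
        (f := fun z => dslope g p z / dslope f p z) ((hslope hg p p).div (hslope hf p p) h1) ?_
      filter_upwards [h2] with z hz
      by_cases hzp : z = p
      · subst hzp
        simp [hp]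
      · have e1 := sub_smul_dslope f p z
        have e2 := sub_smul_dslope g p z
        rw [hp, sub_zero, smul_eq_mul] at e1
        rw [(h p hp).2, sub_zero, smul_eq_mul] at e2
        have hzp' : z - p ≠ 0 := sub_ne_zero.2 hzp
        rw [if_neg (by rw [← e1]; exact mul_ne_zero hzp' hz), ← e1, ← e2,
          mul_div_mul_left _ _ hzp']
    · refine DifferentiableAt.congr_of_eventuallyEq
        (f := fun z => g z / f z) ((hg p).div (hf p) hp) ?_
      filter_upwards [hf.continuous.continuousAt.eventually_ne hp] with z hz
      rw [if_neg hz]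
  · by_cases hz : f z = 0
    · simp [hz, (h z hz).2]
    · simp [hz]

namespace SOSModel

open Complex

variable {N : ℕ} {P : SOSModel N}

/-! ### The lattice -/

theorem Γ_subset {P : SOSModel N} (H : AddSubgroup ℂ) (h1 : (Real.pi : ℂ) ∈ H)
    (h2 : (Real.pi * P.ω : ℂ) ∈ H) {z : ℂ} (hz : z ∈ P.Γ) : z ∈ H := by
  obtain ⟨m, n, rfl⟩ := hz
  have := H.add_mem (H.zsmul_mem h1 m) (H.zsmul_mem h2 n)
  simpa [mul_comm] using this

theorem add_mem_Γ {z w : ℂ} (hz : z ∈ P.Γ) (hw : w ∈ P.Γ) : z + w ∈ P.Γ := by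
  obtain ⟨m, n, rfl⟩ := hz
  obtain ⟨m', n', rfl⟩ := hw
  exact ⟨m + m', n + n', by push_cast; ring⟩

theorem neg_mem_Γ {z : ℂ} (hz : z ∈ P.Γ) : -z ∈ P.Γ := by
  obtain ⟨m, n, rfl⟩ := hz
  exact ⟨-m, -n, by push_cast; ring⟩

theorem neg_mem_Γ_iff {z : ℂ} : -z ∈ P.Γ ↔ z ∈ P.Γ :=
  ⟨fun h => neg_neg z ▸ neg_mem_Γ h, neg_mem_Γ⟩

theorem zero_mem_Γ : (0 : ℂ) ∈ P.Γ := ⟨0, 0, by simp⟩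

/-- The quasi-periods of a function, with an exponential multiplier. -/
def quasiPeriods (f : ℂ → ℂ) : AddSubgroup ℂ where
  carrier := {p | ∃ c α : ℂ, c ≠ 0 ∧ ∀ z, f (z + p) = c * cexp (α * z) * f z}
  zero_mem' := ⟨1, 0, one_ne_zero, by simp⟩
  add_mem' := by
    rintro p q ⟨c, α, hc, h⟩ ⟨d, β, hd, h'⟩
    refine ⟨d * (c * cexp (β * p)), β + α, by simp [hc, hd], fun z => ?_⟩
    rw [← add_assoc, h', h, add_mul, Complex.exp_add, mul_add, Complex.exp_add]
    ring
  neg_mem' := by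
    rintro p ⟨c, α, hc, h⟩
    refine ⟨c⁻¹ * cexp (α * p), -α, by simp [hc], fun z => ?_⟩
    have := h (z + -p)
    rw [neg_add_cancel_right] at this
    rw [this, mul_add, Complex.exp_add, neg_mul, mul_neg]
    have e1 : cexp (α * p) * cexp (-(α * p)) = 1 := by rw [← Complex.exp_add]; simp
    have e2 : cexp (α * z) * cexp (-(α * z)) = 1 := by rw [← Complex.exp_add]; simp
    have e3 : c⁻¹ * c = 1 := inv_mul_cancel₀ hc
    linear_combination -f (z + -p) * e3 - f (z + -p) * (c⁻¹ * c) * e1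
      - f (z + -p) * (c⁻¹ * c) * (cexp (α * p) * cexp (-(α * p))) * e2

theorem mem_quasiPeriods_θ {γ : ℂ} (hγ : γ ∈ P.Γ) : γ ∈ quasiPeriods P.θ := by
  refine Γ_subset (quasiPeriods P.θ) ?_ ?_ hγ
  · exact ⟨-1, 0, by simp, fun z => by simp [θ_add_pi]⟩
  · refine ⟨-cexp (-(I * Real.pi * P.ω)), -2 * I, by simp, fun z => ?_⟩
    rw [θ_add_pi_mul, sub_eq_add_neg, Complex.exp_add]
    ring

/-- Differentiating `θ(x+y) θ(x-y) = f(x)g(y) - g(x)f(y)` at `x = y` shows that the Wronskian of `f`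
and `g` is `θ'(0) θ(2y)`. If `θ'(0) = 0`, then `f` and `g` are proportional and `θ(x+y) θ(x-y)`
vanishes for all `x` at some fixed `y`, which is impossible. -/
theorem deriv_θ_zero_ne_zero (hω : 0 < P.ω.im) : deriv P.θ 0 ≠ 0 := by
  obtain ⟨f, g, hf, hg, h⟩ := exists_θ_add_mul_θ_sub hω
  intro h0
  have hθ := differentiable_θ hω
  have hW : ∀ y, deriv f y * g y = f y * deriv g y := by
    intro y
    have h1 : HasDerivAt (fun x => f x * g y - g x * f y) (deriv f y * g y - deriv g y * f y) y :=
      ((hf y).hasDerivAt.mul_const _).sub ((hg y).hasDerivAt.mul_const _)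
    have h2 : HasDerivAt (fun x => P.θ (x + y) * P.θ (x - y))
        (deriv P.θ (y + y) * P.θ (y - y) + P.θ (y + y) * deriv P.θ (y - y)) y :=
      ((hθ _).hasDerivAt.comp_add_const y y).mul ((hθ _).hasDerivAt.comp_sub_const y y)
    simp only [h] at h2
    have := h1.unique h2
    rw [sub_self, h0, θ_zero] at this
    linear_combination this
  obtain ⟨a, ha⟩ := exists_θ_ne_zero hω
  by_cases hg0 : ∃ y, g y ≠ 0
  · obtain ⟨y, hy⟩ := hg0
    have := hf.mul_eq_mul_of_wronskian_eq_zero hg hW hy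
    obtain ⟨x, hx⟩ := Differentiable.exists_mul_ne_zero (f := fun x => P.θ (x + y))
      (g := fun x => P.θ (x - y)) (hθ.comp (by fun_prop)) (hθ.comp (by fun_prop))
      ⟨a - y, by simpa using ha⟩ ⟨a + y, by simpa using ha⟩
    refine hx ?_
    simp only [h]
    linear_combination this x
  · push Not at hg0
    obtain ⟨x, hx⟩ := Differentiable.exists_mul_ne_zero (f := fun x => P.θ (x + 0))
      (g := fun x => P.θ (x - 0)) (hθ.comp (by fun_prop)) (hθ.comp (by fun_prop))
      ⟨a, by simpa using ha⟩ ⟨a, by simpa using ha⟩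
    refine hx ?_
    simp only [h, hg0]
    ring

theorem deriv_θ_ne_zero (hω : 0 < P.ω.im) {γ : ℂ} (hγ : γ ∈ P.Γ) : deriv P.θ γ ≠ 0 := by
  obtain ⟨c, α, hc, h⟩ := mem_quasiPeriods_θ hγ
  have hθ := differentiable_θ hω
  have h1 : HasDerivAt (fun z => P.θ (z + γ)) (deriv P.θ (0 + γ)) 0 :=
    (hθ _).hasDerivAt.comp_add_const 0 γ
  have h2 : HasDerivAt (fun z => c * cexp (α * z) * P.θ z)
      ((c * (cexp (α * 0) * (α * 1))) * P.θ 0 + c * cexp (α * 0) * deriv P.θ 0) 0 :=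
    ((((hasDerivAt_id (0 : ℂ)).const_mul α).cexp).const_mul c).mul (hθ 0).hasDerivAt
  simp only [h] at h1
  have := h1.unique h2
  rw [zero_add, θ_zero] at this
  rw [this]
  simp [hc, deriv_θ_zero_ne_zero hω]

/-- The zeros of `θ` are the points of the lattice. -/
theorem mem_Γ_of_θ_eq_zero (hω : 0 < P.ω.im) {p : ℂ} (hp : P.θ p = 0) : p ∈ P.Γ := by
  have hθ := differentiable_θ hω
  obtain ⟨a, ha⟩ := exists_θ_ne_zero hω
  -- a relation between values of `θ` and of its translate by `p`
  have key : ∀ s r h, P.θ s * P.θ r * (P.θ (s + h + p) * P.θ (r + h - p))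
      = P.θ (s + p) * P.θ (r - p) * (P.θ (s + h) * P.θ (r + h)) := by
    intro s r h
    -- The arguments are chosen so that one of the three terms contains the factor `θ(p) = 0`.
    have := θ_three_term hω ((s + r) / 2) ((s - r) / 2) ((s + r) / 2 + h) ((s - r) / 2 + p)
    rw [show (s - r) / 2 + p - (s - r) / 2 = p by ring, hp,
      show (s + r) / 2 + (s - r) / 2 = s by ring, show (s + r) / 2 - (s - r) / 2 = r by ring,
      show (s + r) / 2 + h + ((s - r) / 2 + p) = s + h + p by ring,
      show (s + r) / 2 + h - ((s - r) / 2 + p) = r + h - p by ring,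
      show (s + r) / 2 + ((s - r) / 2 + p) = s + p by ring,
      show (s + r) / 2 - ((s - r) / 2 + p) = r - p by ring,
      show (s - r) / 2 + ((s + r) / 2 + h) = s + h by ring,
      show (s - r) / 2 - ((s + r) / 2 + h) = -(r + h) by ring, θ_neg] at this
    linear_combination this
  -- The derivative of `key` in `h` at `0` separates the variables: the difference of the
  -- logarithmic derivatives of `θ` at `s + p` and at `s` is a constant `α`.
  have hd : ∀ s r, P.θ s * P.θ r * (deriv P.θ (s + p) * P.θ (r - p) + P.θ (s + p) * deriv P.θ (r - p))
      = P.θ (s + p) * P.θ (r - p) * (deriv P.θ s * P.θ r + P.θ s * deriv P.θ r) := by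
    intro s r
    have hsh : ∀ u v, HasDerivAt (fun h => P.θ (u + h + v)) (deriv P.θ (u + v)) 0 := by
      intro u v
      have : HasDerivAt (fun h => P.θ (h + (u + v))) (deriv P.θ (0 + (u + v))) 0 :=
        (hθ _).hasDerivAt.comp_add_const 0 (u + v)
      rw [zero_add] at this
      convert this using 3
      ring
    have h1 := ((hsh s p).mul (hsh r (-p))).const_mul (P.θ s * P.θ r)
    have h2 := ((hsh s 0).mul (hsh r 0)).const_mul (P.θ (s + p) * P.θ (r - p))
    have h12 : (fun y => P.θ s * P.θ r * ((fun h => P.θ (s + h + p)) * fun h => P.θ (r + h + -p)) y)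
        = fun y => P.θ (s + p) * P.θ (r - p)
          * ((fun h => P.θ (s + h + 0)) * fun h => P.θ (r + h + 0)) y := by
      funext h
      simpa [sub_eq_add_neg] using key s r h
    rw [h12] at h1
    have := h1.unique h2
    simpa [sub_eq_add_neg] using this
  obtain ⟨r, hr⟩ := Differentiable.exists_mul_ne_zero (f := P.θ) (g := fun x => P.θ (x - p)) hθ
    (hθ.comp (by fun_prop)) ⟨a, ha⟩ ⟨a + p, by simpa using ha⟩
  -- hence `θ(s + p) = C exp(α s) θ(s)`
  obtain ⟨α, hα⟩ : ∃ α : ℂ, ∀ s, deriv P.θ (s + p) * P.θ s - P.θ (s + p) * deriv P.θ s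
      = α * (P.θ (s + p) * P.θ s) := by
    refine ⟨(P.θ (r - p) * deriv P.θ r - P.θ r * deriv P.θ (r - p)) / (P.θ r * P.θ (r - p)),
      fun s => ?_⟩
    rw [div_mul_eq_mul_div, eq_div_iff hr]
    linear_combination hd s r
  have hsh : ∀ s, HasDerivAt (fun z => P.θ (z + p)) (deriv P.θ (s + p)) s :=
    fun s => (hθ _).hasDerivAt.comp_add_const s p
  have hk : ∀ s, HasDerivAt (fun z => P.θ (z + p) * cexp (-α * z))
      (deriv P.θ (s + p) * cexp (-α * s) + P.θ (s + p) * (cexp (-α * s) * (-α * 1))) s :=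
    fun s => (hsh s).mul ((hasDerivAt_id s).const_mul (-α)).cexp
  have hprop := Differentiable.mul_eq_mul_of_wronskian_eq_zero
    (f := fun z => P.θ (z + p) * cexp (-α * z)) (fun s => (hk s).differentiableAt) hθ
    (fun s => by
      rw [(hk s).deriv]
      linear_combination cexp (-α * s) * hα s) ha
  set c := P.θ (a + p) * cexp (-α * a) / P.θ a with hc
  have hexp : ∀ s, P.θ (s + p) = c * cexp (α * s) * P.θ s := by
    intro s
    have e : cexp (-α * s) * cexp (α * s) = 1 := by rw [← Complex.exp_add]; simp
    have := hprop s
    rw [hc, div_mul_eq_mul_div, div_mul_eq_mul_div, eq_div_iff ha]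
    linear_combination cexp (α * s) * this - P.θ (s + p) * P.θ a * e
  have hc0 : c ≠ 0 := by
    rintro h
    have := hexp (a - p)
    rw [h, sub_add_cancel] at this
    exact ha (by simpa using this)
  -- compatibility with the two quasi-periods
  have hca : c * cexp (α * a) * P.θ a ≠ 0 := mul_ne_zero (mul_ne_zero hc0 (Complex.exp_ne_zero _)) ha
  have h1 : cexp (α * Real.pi) = 1 := by
    have := hexp (a + Real.pi)
    rw [add_right_comm, θ_add_pi, θ_add_pi, hexp a, mul_add, Complex.exp_add] at this
    exact mul_left_cancel₀ hca (by linear_combination this)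
  have h2 : cexp (α * (Real.pi * P.ω) + 2 * I * p) = 1 := by
    have := hexp (a + Real.pi * P.ω)
    rw [add_right_comm, θ_add_pi_mul, θ_add_pi_mul, hexp a, mul_add α, Complex.exp_add (α * a),
      show -2 * I * (a + p) - I * Real.pi * P.ω = -2 * I * a - I * Real.pi * P.ω + -(2 * I * p) by ring,
      Complex.exp_add _ (-(2 * I * p))] at this
    have h3 : cexp (α * (Real.pi * P.ω)) = cexp (-(2 * I * p)) := by
      refine mul_left_cancel₀ (mul_ne_zero hca (Complex.exp_ne_zero (-2 * I * a - I * Real.pi * P.ω))) ?_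
      linear_combination this
    rw [Complex.exp_add, h3, ← Complex.exp_add, neg_add_cancel, Complex.exp_zero]
  -- The period `π` forces `α = 2ik`. The quasi-period `πω` then forces `p = πl - πωk`.
  obtain ⟨k, hk⟩ := Complex.exp_eq_one_iff.1 h1
  obtain ⟨l, hl⟩ := Complex.exp_eq_one_iff.1 h2
  have hπ : (Real.pi : ℂ) ≠ 0 := by simp [Real.pi_ne_zero]
  have hα2 : α = 2 * I * k := mul_right_cancel₀ hπ (by linear_combination hk)
  refine ⟨l, -k, mul_left_cancel₀ (mul_ne_zero two_ne_zero I_ne_zero) ?_⟩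
  push_cast
  rw [hα2] at hl
  linear_combination hl

theorem θ_ne_zero (hω : 0 < P.ω.im) {z : ℂ} (hz : z ∉ P.Γ) : P.θ z ≠ 0 :=
  fun h => hz (mem_Γ_of_θ_eq_zero hω h)

end SOSModel


/-! ### Interpolation by theta functions of order `N` -/

namespace SOSModel

open Complex

variable {N : ℕ} {P : SOSModel N}

/-- The translations that preserve a relation between the values of a function. -/
def translationsOf {α : Type*} (f : ℂ → α) : AddSubgroup ℂ where
  carrier := {p | ∀ z, f (z + p) = f z}
  zero_mem' := by simp
  add_mem' := by
    intro p q hp hq z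
    rw [← add_assoc, hq, hp]
  neg_mem' := by
    intro p hp z
    rw [← hp (z + -p), neg_add_cancel_right]

/-- Quasi-periodic entire functions without zeros vanish, if the character is not trivial. -/
theorem eq_zero_of_quasiPeriodic (hω : 0 < P.ω.im) {G : ℂ → ℂ} (hG : Differentiable ℂ G) {σ : ℂ}
    (h1 : ∀ z, G (z + Real.pi) = G z) (h2 : ∀ z, G (z + Real.pi * P.ω) = cexp (2 * I * σ) * G z)
    (hσ : σ ∉ P.Γ) (z : ℂ) : G z = 0 := by
  have hπ : (Real.pi : ℂ) ≠ 0 := by simp [Real.pi_ne_zero]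
  -- With this real `c`, the factor `exp(icz)` has modulus one along `π` and compensates the modulus
  -- of `exp(2iσ)` along `πω`. Thus `‖H‖` is doubly periodic, hence bounded, and `H` is constant by
  -- Liouville; a nonzero constant would put `σ` in the lattice.
  obtain ⟨c, hc⟩ : ∃ c : ℝ, c * (Real.pi * P.ω.im) = -(2 * σ.im) :=
    ⟨-(2 * σ.im) / (Real.pi * P.ω.im), div_mul_cancel₀ _ (by positivity)⟩
  set H : ℂ → ℂ := fun z => cexp (I * c * z) * G z with hH
  have hHd : Differentiable ℂ H := Differentiable.mul (by fun_prop) hG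
  have hn1 : ∀ z, ‖H (z + Real.pi)‖ = ‖H z‖ := by
    intro z
    simp only [hH, h1, norm_mul, Complex.norm_exp]
    simp
  have hn2 : ∀ z, ‖H (z + Real.pi * P.ω)‖ = ‖H z‖ := by
    intro z
    simp only [hH, h2, norm_mul, Complex.norm_exp]
    rw [← mul_assoc, ← Real.exp_add]
    congr 2
    simp
    linarith
  have hnΓ : ∀ γ ∈ P.Γ, ∀ z, ‖H (z + γ)‖ = ‖H z‖ :=
    fun γ hγ => Γ_subset (translationsOf fun z => ‖H z‖) hn1 hn2 hγ
  -- boundedness on the fundamental domain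
  obtain ⟨M, hM⟩ : ∃ M, ∀ p ∈ Set.Icc (0 : ℝ) 1 ×ˢ Set.Icc (0 : ℝ) 1,
      ‖H (Real.pi * p.1 + Real.pi * P.ω * p.2)‖ ≤ M := by
    refine (isCompact_Icc.prod isCompact_Icc).exists_bound_of_continuousOn
      (f := fun p : ℝ × ℝ => H (Real.pi * p.1 + Real.pi * P.ω * p.2)) ?_
    exact (hHd.continuous.comp (by fun_prop)).continuousOn
  have hb : ∀ z, ‖H z‖ ≤ M := by
    intro z
    obtain ⟨s, hs⟩ : ∃ s : ℝ, s * (Real.pi * P.ω.im) = z.im :=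
      ⟨z.im / (Real.pi * P.ω.im), div_mul_cancel₀ _ (by positivity)⟩
    obtain ⟨r, hr⟩ : ∃ r : ℝ, r * Real.pi = z.re - Real.pi * P.ω.re * s :=
      ⟨_, div_mul_cancel₀ _ Real.pi_ne_zero⟩
    have hz : z = Real.pi * (r : ℂ) + Real.pi * P.ω * (s : ℂ) := by
      apply Complex.ext
      · simp
        linarith
      · simp
        linarith
    have hγ : (Real.pi * (⌊r⌋ : ℤ) + Real.pi * P.ω * (⌊s⌋ : ℤ) : ℂ) ∈ P.Γ := ⟨_, _, rfl⟩
    have h := hM (Int.fract r, Int.fract s)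
      ⟨⟨Int.fract_nonneg _, (Int.fract_lt_one _).le⟩, ⟨Int.fract_nonneg _, (Int.fract_lt_one _).le⟩⟩
    rw [← hnΓ _ hγ] at h
    convert h using 3
    rw [hz]
    simp only [Int.fract]
    push_cast
    ring
  have hconst : ∀ z, H z = H 0 := fun z => hHd.apply_eq_apply_of_bounded
    (isBounded_iff_forall_norm_le.2 ⟨M, by rintro _ ⟨w, rfl⟩; exact hb w⟩) z 0
  by_contra hGz
  have h0 : H 0 ≠ 0 := by
    rw [← hconst z]
    exact mul_ne_zero (Complex.exp_ne_zero _) hGz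
  have e1 : cexp (I * c * Real.pi) = 1 := by
    have := hconst Real.pi
    have h3 := h1 0
    rw [zero_add] at h3
    simp only [hH, h3, mul_zero, Complex.exp_zero, one_mul] at this h0
    exact mul_right_cancel₀ h0 (by rw [this, one_mul])
  have e2 : cexp (I * c * (Real.pi * P.ω) + 2 * I * σ) = 1 := by
    have := hconst (Real.pi * P.ω)
    have h3 := h2 0
    rw [zero_add] at h3
    simp only [hH, h3, mul_zero, Complex.exp_zero, one_mul] at this h0
    rw [Complex.exp_add]
    exact mul_right_cancel₀ h0 (by rw [mul_assoc, this, one_mul])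
  obtain ⟨k, hk⟩ := Complex.exp_eq_one_iff.1 e1
  obtain ⟨l, hl⟩ := Complex.exp_eq_one_iff.1 e2
  have hc2 : I * c = 2 * I * k := mul_right_cancel₀ hπ (by linear_combination hk)
  refine hσ ⟨l, -k, mul_left_cancel₀ (mul_ne_zero two_ne_zero I_ne_zero) ?_⟩
  push_cast
  rw [hc2] at hl
  linear_combination hl

/-- An entire function with the quasi-periodicity of a product of `N` theta functions that vanishes
at `N` given points is zero, unless the points satisfy a linear relation modulo the lattice. -/
theorem eq_zero_of_zeros (hω : 0 < P.ω.im) {g : ℂ → ℂ} (hg : Differentiable ℂ g)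
    (h1 : ∀ z, g (z + Real.pi) = (-1) ^ N * g z)
    (h2 : ∀ z, g (z + Real.pi * P.ω)
      = (-1) ^ N * cexp (-2 * I * N * z - I * Real.pi * N * P.ω) * g z)
    {x : Fin N → ℂ} (hx : ∀ a b, a ≠ b → x a - x b ∉ P.Γ) (hs : ∑ a, x a ∉ P.Γ)
    (hz : ∀ a, g (x a) = 0) (z : ℂ) : g z = 0 := by
  have hθ := differentiable_θ hω
  have hgΓ : ∀ γ ∈ P.Γ, ∀ z, (g (z + γ) = 0) = (g z = 0) := by
    refine fun γ hγ => Γ_subset (translationsOf fun z => g z = 0) ?_ ?_ hγ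
    · intro z
      simp [h1]
    · intro z
      simp [h2]
  have hprod : ∀ S : Finset (Fin N), Differentiable ℂ fun z => ∏ a ∈ S, P.θ (z - x a) := by
    intro S
    simp only [← Finset.prod_fn]
    fun_prop
  -- The factors `θ(z - x a)` are divided out one at a time. Each has simple zeros, exactly on `x a
  -- + Γ`; there `g` vanishes and the factors already removed do not, because the points are
  -- distinct modulo `Γ`.
  have hdiv : ∀ S : Finset (Fin N), ∃ G : ℂ → ℂ, Differentiable ℂ G ∧
      ∀ z, g z = G z * ∏ a ∈ S, P.θ (z - x a) := by
    intro S
    induction S using Finset.induction_on with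
    | empty => exact ⟨g, hg, by simp⟩
    | insert a S ha ih =>
      obtain ⟨G, hG, hGg⟩ := ih
      obtain ⟨q, hq, hqG⟩ := Differentiable.exists_eq_mul_of_simple_zeros
        (f := fun z => P.θ (z - x a)) (hθ.comp (by fun_prop)) hG (by
          intro z hz0
          have hzΓ := mem_Γ_of_θ_eq_zero hω hz0
          refine ⟨?_, ?_⟩
          · have : HasDerivAt (fun z => P.θ (z - x a)) (deriv P.θ (z - x a)) z :=
              (hθ _).hasDerivAt.comp_sub_const z (x a)
            rw [this.deriv]
            exact deriv_θ_ne_zero hω hzΓ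
          · have hgz : g z = 0 := by
              have := hgΓ _ hzΓ (x a)
              rw [add_sub_cancel] at this
              rw [this]
              exact hz a
            rw [hGg, mul_eq_zero] at hgz
            refine hgz.resolve_right (Finset.prod_ne_zero_iff.2 fun b hb h0 => ?_)
            refine hx a b (fun hab => ha (hab ▸ hb)) ?_
            have := add_mem_Γ (neg_mem_Γ hzΓ) (mem_Γ_of_θ_eq_zero hω h0)
            convert this using 1
            ring)
      exact ⟨q, hq, fun z => by rw [hGg, hqG, Finset.prod_insert ha, mul_assoc]⟩
  -- The full quotient has period `π` and the constant multiplier `exp(-2i ∑ x a)` along `πω`. This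
  -- character is nontrivial by `hs`, so the quotient is zero.
  obtain ⟨G, hG, hGg⟩ := hdiv Finset.univ
  have hp0 : ∃ z, ∏ a, P.θ (z - x a) ≠ 0 := by
    have : ∀ S : Finset (Fin N), ∃ z, ∏ a ∈ S, P.θ (z - x a) ≠ 0 := by
      intro S
      induction S using Finset.induction_on with
      | empty => simp
      | insert a S ha ih =>
        obtain ⟨w, hw⟩ := exists_θ_ne_zero hω
        simp only [Finset.prod_insert ha]
        exact Differentiable.exists_mul_ne_zero (f := fun z => P.θ (z - x a))
          (hθ.comp (by fun_prop)) (hprod S) ⟨w + x a, by simpa using hw⟩ ih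
    exact this _
  have hG1 : ∀ z, G (z + Real.pi) = G z := by
    intro z
    refine sub_eq_zero.1 (Differentiable.eq_zero_of_mul_eq_zero
      (f := fun z => G (z + Real.pi) - G z) ((hG.comp (by fun_prop)).sub hG) (hprod Finset.univ) hp0
      (fun z => ?_) z)
    have h3 := h1 z
    rw [hGg, hGg] at h3
    simp only [add_sub_right_comm, θ_add_pi, Finset.prod_neg, Finset.card_univ, Fintype.card_fin] at h3
    have h4 : ((-1 : ℂ) ^ N) * (-1) ^ N = 1 := by rw [← mul_pow]; simp
    linear_combination (-1) ^ N * h3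
      - (G (z + Real.pi) - G z) * (∏ a, P.θ (z - x a)) * h4
  have hG2 : ∀ z, G (z + Real.pi * P.ω) = cexp (2 * I * (-∑ a, x a)) * G z := by
    intro z
    refine sub_eq_zero.1 (Differentiable.eq_zero_of_mul_eq_zero
      (f := fun z => G (z + Real.pi * P.ω) - cexp (2 * I * (-∑ a, x a)) * G z)
      ((hG.comp (by fun_prop)).sub (hG.const_mul _)) (hprod Finset.univ) hp0 (fun z => ?_) z)
    have h3 := h2 z
    rw [hGg, hGg] at h3
    simp only [add_sub_right_comm, θ_add_pi_mul, Finset.prod_mul_distrib, Finset.prod_neg,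
      Finset.card_univ, Fintype.card_fin, ← Complex.exp_sum] at h3
    have h4 : ((-1 : ℂ) ^ N) * (-1) ^ N = 1 := by rw [← mul_pow]; simp
    have h5 : ∑ a, (-2 * I * (z - x a) - I * Real.pi * P.ω)
        = -2 * I * N * z - I * Real.pi * N * P.ω + 2 * I * ∑ a, x a := by
      simp only [Finset.sum_sub_distrib, ← Finset.mul_sum, Finset.sum_const, Finset.card_univ,
        Fintype.card_fin, nsmul_eq_mul]
      ring
    rw [h5, Complex.exp_add _ (2 * I * ∑ a, x a)] at h3
    have h6 : cexp (2 * I * (-∑ a, x a)) * cexp (2 * I * ∑ a, x a) = 1 := by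
      rw [← Complex.exp_add, ← Complex.exp_zero]
      ring_nf
    have h7 : (-1) ^ N * cexp (-2 * I * N * z - I * Real.pi * N * P.ω) ≠ 0 :=
      mul_ne_zero (pow_ne_zero N (neg_ne_zero.2 one_ne_zero)) (Complex.exp_ne_zero _)
    refine mul_left_cancel₀ h7 ?_
    linear_combination cexp (2 * I * (-∑ a, x a)) * h3
      - (-1) ^ N * cexp (-2 * I * N * z - I * Real.pi * N * P.ω) * G (z + Real.pi * P.ω)
        * (∏ a, P.θ (z - x a)) * h6
  rw [hGg, eq_zero_of_quasiPeriodic hω hG hG1 hG2 (fun h => hs (neg_mem_Γ_iff.1 h)), zero_mul]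

/-- Translation by `π/N` has the `ϑ_j` as eigenfunctions, and its eigenvalues are distinct for `0 ≤
j < N`. -/
theorem linearIndependent_vartheta (hω : 0 < P.ω.im) : LinearIndependent ℂ P.vartheta := by
  refine Module.End.eigenvectors_linearIndependent'
    (LinearMap.funLeft ℂ ℂ fun z : ℂ => z + Real.pi / N)
    (fun j : Fin N => -cexp (-(2 * Real.pi * I * ((j : ℕ) : ℂ) / N))) ?_ _ fun j => ?_
  · intro j k hjk
    have hN : N ≠ 0 := by rintro rfl; exact j.elim0
    have hN' : (N : ℂ) ≠ 0 := by exact_mod_cast hN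
    have hjk := neg_injective hjk
    obtain ⟨n, hn⟩ := Complex.exp_eq_exp_iff_exists_int.1 hjk
    have h2 : (((j : ℕ) : ℂ)) = ((k : ℕ) : ℂ) - n * N := by
      field_simp at hn
      linear_combination -hn
    have h3 : ((j : ℕ) : ℤ) = ((k : ℕ) : ℤ) - n * N := by exact_mod_cast h2
    have h4 : (j : ℕ) ≡ (k : ℕ) [MOD N] := by
      rw [← Int.natCast_modEq_iff, Int.modEq_iff_dvd]
      exact ⟨n, by rw [h3]; ring⟩
    exact Fin.ext (h4.eq_of_lt_of_lt j.2 k.2)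
  · rw [Module.End.hasEigenvector_iff, Module.End.mem_eigenspace_iff]
    refine ⟨?_, ?_⟩
    · funext z
      simp [LinearMap.funLeft_apply, vartheta_add_pi_div]
    · obtain ⟨z, hz⟩ := exists_vartheta_ne_zero hω j
      exact fun h => hz (congrFun h z)

/-- The matrix of the values of the functions `ϑ_j` at `N` points is invertible. -/
theorem det_vartheta_ne_zero (hω : 0 < P.ω.im) {x : Fin N → ℂ}
    (hx : ∀ a b, a ≠ b → x a - x b ∉ P.Γ) (hs : ∑ a, x a ∉ P.Γ) :
    (Matrix.of fun i j => P.vartheta j (x i)).det ≠ 0 := by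
  intro h
  obtain ⟨c, hc, hc0⟩ := Matrix.exists_mulVec_eq_zero_iff.2 h
  have hd : Differentiable ℂ fun z => ∑ j, P.vartheta j z * c j :=
    Differentiable.fun_sum fun j _ => (differentiable_vartheta hω j).mul_const _
  have := eq_zero_of_zeros hω hd (fun z => ?_) (fun z => ?_) hx hs fun a => ?_
  · refine hc (funext fun j => ?_)
    refine Fintype.linearIndependent_iff.1 (linearIndependent_vartheta hω) c (funext fun z => ?_) j
    rw [Finset.sum_apply, Pi.zero_apply, ← this z]
    exact Finset.sum_congr rfl fun j _ => by rw [Pi.smul_apply, smul_eq_mul, mul_comm]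
  · simp only [vartheta_add_pi, Finset.mul_sum, mul_assoc]
  · simp only [vartheta_add_pi_mul, Finset.mul_sum, mul_assoc]
  · exact congrFun hc0 a

/-- An entire function with the quasi-periodicity of a product of `N` theta functions that vanishes
at `N - 1` given points is proportional to a determinant of the functions `ϑ_j`. -/
theorem mul_det_vartheta_eq (hω : 0 < P.ω.im) {g : ℂ → ℂ} (hg : Differentiable ℂ g)
    (h1 : ∀ z, g (z + Real.pi) = (-1) ^ N * g z)
    (h2 : ∀ z, g (z + Real.pi * P.ω)
      = (-1) ^ N * cexp (-2 * I * N * z - I * Real.pi * N * P.ω) * g z)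
    {x : Fin N → ℂ} (hx : ∀ a b, a ≠ b → x a - x b ∉ P.Γ) (hs : ∑ a, x a ∉ P.Γ)
    (a : Fin N) (hz : ∀ b, b ≠ a → g (x b) = 0) (z : ℂ) :
    g z * (Matrix.of fun i j => P.vartheta j (x i)).det
      = g (x a) * (Matrix.of fun i j => P.vartheta j (Function.update x a z i)).det := by
  set M : Matrix (Fin N) (Fin N) ℂ := Matrix.of fun i j => P.vartheta j (x i) with hM
  -- Expansion in the row that depends on `z`: the determinant is a combination of the `ϑ_j`, so it
  -- has their quasi-periods.
  obtain ⟨L, hL⟩ : ∃ L : Fin N → ℂ, ∀ z,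
      (Matrix.of fun i j => P.vartheta j (Function.update x a z i)).det = ∑ j, P.vartheta j z * L j := by
    refine ⟨fun j => (M.updateRow a fun k => if j = k then 1 else 0).det, fun z => ?_⟩
    have h := ((Matrix.detRowAlternating (R := ℂ)).toMultilinearMap.toLinearMap M a).pi_apply_eq_sum_univ
      (fun j => P.vartheta j z)
    have e : (Matrix.of fun i j => P.vartheta j (Function.update x a z i))
        = M.updateRow a fun j => P.vartheta j z := by
      ext i j
      by_cases hi : i = a
      · subst hi
        simp
      · simp [hM, Function.update_of_ne hi, Matrix.updateRow_ne hi]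
    rw [e]
    refine h.trans (Finset.sum_congr rfl fun j _ => ?_)
    rfl
  have hd : Differentiable ℂ fun z => ∑ j, P.vartheta j z * L j :=
    Differentiable.fun_sum fun j _ => (differentiable_vartheta hω j).mul_const _
  have hself : Function.update x a (x a) = x := Function.update_eq_self a x
  -- The difference of the two sides vanishes at all `N` points: at `x a` the update is trivial, and
  -- at any other `x b` the determinant has two equal rows.
  refine sub_eq_zero.1 (eq_zero_of_zeros hω (g := fun z => g z * M.det
    - g (x a) * (Matrix.of fun i j => P.vartheta j (Function.update x a z i)).det) ?_
    (fun z => ?_) (fun z => ?_) hx hs (fun b => ?_) z)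
  · simp only [hL]
    exact (hg.mul_const _).sub (hd.const_mul _)
  · simp only [hL, h1, vartheta_add_pi, Finset.mul_sum, mul_sub]
    congr 1
    · ring
    · exact Finset.sum_congr rfl fun j _ => by ring
  · simp only [hL, h2, vartheta_add_pi_mul, Finset.mul_sum, mul_sub]
    congr 1
    · ring
    · exact Finset.sum_congr rfl fun j _ => by ring
  · by_cases hb : b = a
    · subst hb
      simp only [hself, ← hM, sub_self]
    · simp only [hz b hb, zero_mul, zero_sub, neg_eq_zero]
      refine mul_eq_zero_of_right _ (Matrix.det_zero_of_row_eq hb ?_)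
      funext j
      simp [Function.update_of_ne hb]

end SOSModel


namespace SOSModel

variable {N : ℕ} {P : SOSModel N}

/-! ### Entries of the `R`-matrix -/

section entries

variable (P) (l t : ℂ)

@[simp] theorem R_00_00 : P.R l t (0, 0) (0, 0) = P.θ (l + P.η) := rfl
@[simp] theorem R_00_01 : P.R l t (0, 0) (0, 1) = 0 := rfl
@[simp] theorem R_00_10 : P.R l t (0, 0) (1, 0) = 0 := rfl
@[simp] theorem R_00_11 : P.R l t (0, 0) (1, 1) = 0 := rfl
@[simp] theorem R_01_00 : P.R l t (0, 1) (0, 0) = 0 := rfl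
@[simp] theorem R_01_01 : P.R l t (0, 1) (0, 1) =
    Complex.exp (Complex.I * P.yc * P.η) * (P.θ l * P.θ (t + P.η) / P.θ t) := rfl
@[simp] theorem R_01_10 : P.R l t (0, 1) (1, 0) =
    Complex.exp (Complex.I * P.yc * l) * (P.θ P.η * P.θ (t + l) / P.θ t) := rfl
@[simp] theorem R_01_11 : P.R l t (0, 1) (1, 1) = 0 := rfl
@[simp] theorem R_10_00 : P.R l t (1, 0) (0, 0) = 0 := rfl
-- Oddness of `θ` removes the sign of `-t`, so that all height-dependent entries share the
-- denominator `θ(t)`.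
@[simp] theorem R_10_01 : P.R l t (1, 0) (0, 1) =
    (Complex.exp (Complex.I * P.yc * l))⁻¹ * (P.θ P.η * P.θ (t - l) / P.θ t) := by
  rw [← Complex.exp_neg, ← neg_neg (P.θ (t - l)), ← θ_neg, neg_sub, sub_eq_neg_add, mul_neg, neg_div,
    ← div_neg, ← θ_neg]
  rfl
@[simp] theorem R_10_10 : P.R l t (1, 0) (1, 0) =
    (Complex.exp (Complex.I * P.yc * P.η))⁻¹ * (P.θ l * P.θ (t - P.η) / P.θ t) := by
  rw [← Complex.exp_neg, ← neg_neg (P.θ (t - P.η)), ← θ_neg, neg_sub, sub_eq_neg_add, mul_neg, neg_div,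
    ← div_neg, ← θ_neg]
  rfl
@[simp] theorem R_10_11 : P.R l t (1, 0) (1, 1) = 0 := rfl
@[simp] theorem R_11_00 : P.R l t (1, 1) (0, 0) = 0 := rfl
@[simp] theorem R_11_01 : P.R l t (1, 1) (0, 1) = 0 := rfl
@[simp] theorem R_11_10 : P.R l t (1, 1) (1, 0) = 0 := rfl
@[simp] theorem R_11_11 : P.R l t (1, 1) (1, 1) = P.θ (l + P.η) := rfl

end entries

@[simp] theorem sz_zero : sz 0 = 1 := by simp [sz]
@[simp] theorem sz_one : sz 1 = -1 := by norm_num [sz]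

/-- Conservation of the spin by the `R`-matrix. -/
theorem R_eq_zero {l t : ℂ} {i h j k : Fin 2} (hne : (i : ℕ) + (h : ℕ) ≠ (j : ℕ) + (k : ℕ)) :
    P.R l t (i, h) (j, k) = 0 := by
  revert i h j k
  simp [Fin.forall_fin_two]

/-! ### The dynamical Yang–Baxter equation -/

/-- The three-term relation in a form without halves. -/
theorem θ_relation (hω : 0 < P.ω.im) (a b c d : ℂ) :
    P.θ a * P.θ b * (P.θ d * P.θ (2 * c - a + b - d))
      + P.θ (b + c) * P.θ (a - c) * (P.θ (d + a - b - c) * P.θ (d - c))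
      = P.θ (a + d - c) * P.θ (b + c - d) * (P.θ c * P.θ (b + c - a)) := by
  have h := θ_three_term hω ((a + b) / 2) ((a - b) / 2) (c - (a - b) / 2) (d - c + (a - b) / 2)
  have e : P.θ ((a - b) / 2 - (c - (a - b) / 2)) = -P.θ (b + c - a) := by
    rw [← θ_neg]
    ring_nf
  rw [e] at h
  linear_combination (norm := ring_nf) h

/-- Two `R`-matrices acting on the same site. -/
noncomputable def rTwo (P : SOSModel N) (l m u : ℂ) (i i' q q' h k : Fin 2) : ℂ :=
  ∑ c : Fin 2, P.R l u (i, h) (q, c) * P.R m (u + P.η * sz q) (i', c) (q', k)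

/-- Spin conservation leaves finitely many scalar identities. After the denominators are cleared,
the ones that are not immediate are multiples of the three-term relation, except two that each need
a combination of two instances. -/
theorem dynamical_yangBaxter (hω : 0 < P.ω.im) {u : ℂ} (hu : ∀ k : ℤ, P.θ (u + P.η * k) ≠ 0)
    (l m : ℂ) (i i' q q' h k : Fin 2) :
    ∑ p, ∑ p', P.R (l - m) (u + P.η * sz h) (i, i') (p, p') * P.rTwo l m u p p' q q' h k
      = ∑ s, ∑ s', P.rTwo m l u i' i s' s h k * P.R (l - m) u (s, s') (q, q') := by
  have h0 : P.θ u ≠ 0 := by simpa using hu 0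
  have h1 : P.θ (u + P.η) ≠ 0 := by simpa using hu 1
  have h2 : P.θ (u - P.η) ≠ 0 := by simpa [sub_eq_add_neg] using hu (-1)
  revert i i' q q' h k
  simp only [Fin.forall_fin_two, rTwo, Fin.sum_univ_two, R_00_00, R_00_01, R_00_10, R_00_11,
    R_01_00, R_01_01, R_01_10, R_01_11, R_10_00, R_10_01, R_10_10, R_10_11, R_11_00, R_11_01,
    R_11_10, R_11_11, sz_zero, sz_one, mul_zero, zero_mul, add_zero, zero_add, and_true, true_and]
  simp only [mul_one, mul_neg, ← sub_eq_add_neg, mul_sub, Complex.exp_sub, add_sub_cancel_right, sub_add_cancel]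
  generalize hE : Complex.exp (Complex.I * P.yc * P.η) = E
  generalize hL : Complex.exp (Complex.I * P.yc * l) = L
  generalize hM : Complex.exp (Complex.I * P.yc * m) = M
  have hE0 : E ≠ 0 := hE ▸ Complex.exp_ne_zero _
  have hL0 : L ≠ 0 := hL ▸ Complex.exp_ne_zero _
  have hM0 : M ≠ 0 := hM ▸ Complex.exp_ne_zero _
  clear hE hL hM
  and_intros
  all_goals field_simp
  · linear_combination (norm := ring_nf) -P.θ P.η * θ_relation hω (P.η + u) (m + u) (l - m + P.η) (l + P.η)
  · linear_combination (norm := ring_nf) -P.θ P.η * θ_relation hω (m + u) (l + P.η) (u) (l - m + u)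
  · linear_combination (norm := ring_nf) (P.θ P.η * P.θ (u + P.η * 2)) * θ_relation hω (P.η + l) (u + P.η - m) (l) (u)
  · have h1 := θ_relation hω (u) (u + P.η + l - m) (u - l + m) (u + P.η + m)
    have h2 := θ_relation hω (u + P.η) (u + P.η) u (u + P.η)
    linear_combination (norm := ring_nf) P.θ P.η ^ 3 * h1 - (P.θ (l - m) * P.θ (P.η + l) * P.θ m) * h2
  · linear_combination (norm := ring_nf) -P.θ P.η * θ_relation hω (P.η + l) (u + P.η) (l) (u + l - m)
  · linear_combination (norm := ring_nf) P.θ P.η * θ_relation hω (P.η + l) (u) (l) (u - P.η + l - m)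
  · linear_combination (norm := ring_nf) P.θ P.η * θ_relation hω (P.η + l) (u - P.η + l - m) (P.η + m) (u - P.η + m)
  · linear_combination (norm := ring_nf) P.θ P.η * θ_relation hω (u + P.η - l + m) (P.η + l) (u + P.η - l) (u + P.η - m)
  · linear_combination (norm := ring_nf) P.θ P.η * θ_relation hω (u + P.η - l + m) (P.η + l) (u - l + m) (u)
  · linear_combination (norm := ring_nf) -P.θ P.η * θ_relation hω (u - P.η) (P.η + l) (u - P.η - l + m) (u - l + m)
  · have h1 := θ_relation hω (u - P.η) (u + m) (u - P.η - m) (u + l - m)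
    have h2 := θ_relation hω u u (u - P.η) u
    linear_combination (norm := ring_nf) -P.θ P.η ^ 3 * h1 + (P.θ (l - m) * P.θ (P.η + l) * P.θ m) * h2
  · linear_combination (norm := ring_nf) (P.θ P.η * P.θ (u - P.η * 2)) * θ_relation hω (u) (P.η + l) (u - P.η) (u - P.η + m)
  · linear_combination (norm := ring_nf) -P.θ P.η * θ_relation hω (u - m) (l + P.η) (u - l) (u - l + m)
  · linear_combination (norm := ring_nf) -P.θ P.η * θ_relation hω (-P.η + u) (-m + u) (l) (l + P.η)

end SOSModel


namespace SOSModel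

open Complex

variable {N : ℕ}

/-! ### Recursion over the sites -/

/-- The model without its first site. -/
def tail (P : SOSModel (N + 1)) : SOSModel N where
  ω := P.ω
  η := P.η
  ξ := fun n => P.ξ n.succ
  x := P.x
  y := P.y

@[simp] theorem tail_R (P : SOSModel (N + 1)) : P.tail.R = P.R := rfl
@[simp] theorem tail_θ (P : SOSModel (N + 1)) : P.tail.θ = P.θ := rfl
@[simp] theorem tail_η (P : SOSModel (N + 1)) : P.tail.η = P.η := rfl
@[simp] theorem tail_ω (P : SOSModel (N + 1)) : P.tail.ω = P.ω := rfl
@[simp] theorem tail_yc (P : SOSModel (N + 1)) : P.tail.yc = P.yc := rfl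
@[simp] theorem tail_rTwo (P : SOSModel (N + 1)) : P.tail.rTwo = P.rTwo := rfl
@[simp] theorem tail_ξ (P : SOSModel (N + 1)) (n : Fin N) : P.tail.ξ n = P.ξ n.succ := rfl

theorem sum_fun_fin_succ {M : Type*} [AddCommMonoid M] (f : (Fin (N + 1) → Fin 2) → M) :
    ∑ g, f g = ∑ a : Fin 2, ∑ g : Fin N → Fin 2, f (Fin.cons a g) := by
  rw [← (Fin.consEquiv fun _ => Fin 2).sum_comp, Fintype.sum_prod_type]
  rfl

theorem R0_zero (P : SOSModel (N + 1)) (l t : ℂ) (i j : Fin 2) (h k : Fin (N + 1) → Fin 2) :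
    P.R0 l t 0 (i, h) (j, k)
      = if Fin.tail h = Fin.tail k then P.R (l - P.ξ 0) t (i, h 0) (j, k 0) else 0 := by
  have : (∀ m, m ≠ (0 : Fin (N + 1)) → h m = k m) ↔ Fin.tail h = Fin.tail k := by
    constructor
    · intro H
      funext n
      exact H n.succ (Fin.succ_ne_zero n)
    · intro H m hm
      obtain ⟨n, rfl⟩ := Fin.exists_succ_eq.2 hm
      exact congrFun H n
  simp [R0, this]

/-- The block-diagonal matrix that acts on the first site as the identity. -/
def consDiag (F : Fin 2 → Matrix (Fin 2 × (Fin N → Fin 2)) (Fin 2 × (Fin N → Fin 2)) ℂ) :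
    Matrix (Fin 2 × (Fin (N + 1) → Fin 2)) (Fin 2 × (Fin (N + 1) → Fin 2)) ℂ := fun r c =>
  if r.2 0 = c.2 0 then F (c.2 0) (r.1, Fin.tail r.2) (c.1, Fin.tail c.2) else 0

theorem consDiag_one : consDiag (1 : Fin 2 → Matrix (Fin 2 × (Fin N → Fin 2)) _ ℂ) = 1 := by
  ext ⟨i, h⟩ ⟨j, k⟩
  obtain ⟨h0, h, rfl⟩ : ∃ a g, h = Fin.cons a g := ⟨_, _, (Fin.cons_self_tail h).symm⟩
  obtain ⟨k0, k, rfl⟩ : ∃ a g, k = Fin.cons a g := ⟨_, _, (Fin.cons_self_tail k).symm⟩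
  by_cases h1 : h0 = k0 <;> by_cases h2 : i = j <;> by_cases h3 : h = k <;>
    simp [consDiag, Matrix.one_apply, h1, h2, h3]

theorem consDiag_mul
    (F G : Fin 2 → Matrix (Fin 2 × (Fin N → Fin 2)) (Fin 2 × (Fin N → Fin 2)) ℂ) :
    consDiag F * consDiag G = consDiag (F * G) := by
  ext ⟨i, h⟩ ⟨j, k⟩
  simp only [Matrix.mul_apply, Fintype.sum_prod_type, sum_fun_fin_succ, consDiag, Fin.cons_zero,
    Fin.tail_cons, Pi.mul_apply]
  by_cases hk : h 0 = k 0
  · simp [hk, Finset.sum_ite_irrel]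
  · have : ∀ a, ¬ (h 0 = a ∧ a = k 0) := by
      rintro a ⟨rfl, h2⟩
      exact hk h2
    simp only [ite_mul, mul_ite, zero_mul, mul_zero, ← ite_and, if_neg hk]
    refine Finset.sum_eq_zero fun _ _ => Finset.sum_eq_zero fun a _ => Finset.sum_eq_zero fun _ _ => ?_
    rw [if_neg]
    tauto

/-- The later sites do not change the first spin and feel it only through the height. -/
theorem R0_succ (P : SOSModel (N + 1)) (l t : ℂ) (n : Fin N) :
    P.R0 l t n.succ = consDiag fun a => P.tail.R0 l (t + P.η * sz a) n := by
  ext ⟨i, h⟩ ⟨j, k⟩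
  have h1 : (∀ m, m ≠ n.succ → h m = k m) ↔ h 0 = k 0 ∧ ∀ m, m ≠ n → Fin.tail h m = Fin.tail k m := by
    rw [Fin.forall_fin_succ]
    simp [Fin.tail, (Fin.succ_ne_zero n).symm]
  have h2 : ∑ a ∈ Finset.univ.filter (· < n.succ), sz (k a)
      = sz (k 0) + ∑ a ∈ Finset.univ.filter (· < n), sz (Fin.tail k a) := by
    simp only [Finset.sum_filter, Fin.sum_univ_succ, Fin.succ_lt_succ_iff, Fin.succ_pos, if_true,
      Fin.tail]
  simp only [R0, consDiag, h1, h2, ite_and, tail_R, tail_η, tail_ξ, mul_add, ← add_assoc]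
  rfl

theorem mono_succ (P : SOSModel (N + 1)) (l t : ℂ) :
    P.mono l t = consDiag (fun a => P.tail.mono l (t + P.η * sz a)) * P.R0 l t 0 := by
  have : ∀ L : List (Fin N), (L.map fun n => P.R0 l t n.succ).reverse.prod
      = consDiag fun a => (L.map fun n => P.tail.R0 l (t + P.η * sz a) n).reverse.prod := by
    intro L
    induction L with
    | nil => exact consDiag_one.symm
    | cons n L ih =>
      simp only [List.map_cons, List.reverse_cons, List.prod_append, List.prod_singleton, ih]
      rw [R0_succ, consDiag_mul]
      rfl
  simp only [mono, List.ofFn_succ, List.reverse_cons, List.prod_append, List.prod_singleton]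
  have h2 := this (List.finRange N)
  simp only [← List.ofFn_eq_map] at h2
  rw [h2]

/-- This is the recursion behind the inductions on `N`. The first site is the rightmost factor, so
the others see its outgoing spin `h 0` in their height. -/
theorem monoEntry_succ (P : SOSModel (N + 1)) (i j : Fin 2) (l t : ℂ) (h k : Fin (N + 1) → Fin 2) :
    P.monoEntry i j l t h k = ∑ p, P.tail.monoEntry i p l (t + P.η * sz (h 0)) (Fin.tail h) (Fin.tail k)
      * P.R (l - P.ξ 0) t (p, h 0) (j, k 0) := by
  simp only [monoEntry, mono_succ, Matrix.mul_apply, Fintype.sum_prod_type, sum_fun_fin_succ, R0_zero,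
    consDiag, Fin.cons_zero, Fin.tail_cons]
  simp only [ite_mul, zero_mul, mul_ite, mul_zero, Finset.sum_ite_eq, Finset.sum_ite_eq', Finset.mem_univ, if_true]

theorem monoEntry_zero (P : SOSModel 0) (i j : Fin 2) (l t : ℂ) (h k : Fin 0 → Fin 2) :
    P.monoEntry i j l t h k = if i = j then 1 else 0 := by
  simp [monoEntry, mono, Matrix.one_apply, Subsingleton.elim h k]

/-- The number of down spins. -/
def numDown (h : Fin N → Fin 2) : ℕ := ∑ n, (h n : ℕ)

theorem numDown_succ (h : Fin (N + 1) → Fin 2) : numDown h = h 0 + numDown (Fin.tail h) :=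
  Fin.sum_univ_succ _

theorem sum_sz (h : Fin N → Fin 2) : ∑ n, sz (h n) = N - 2 * numDown h := by
  simp [sz, numDown, Finset.sum_sub_distrib, ← Finset.mul_sum]

/-- Conservation of the spin by the monodromy matrix. -/
theorem monoEntry_eq_zero {P : SOSModel N} {i j : Fin 2} {l t : ℂ} {h k : Fin N → Fin 2}
    (hne : (i : ℕ) + numDown h ≠ (j : ℕ) + numDown k) : P.monoEntry i j l t h k = 0 := by
  induction N generalizing i j t with
  | zero =>
    rw [monoEntry_zero, if_neg]
    rintro rfl
    simp [numDown] at hne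
  | succ N ih =>
    rw [monoEntry_succ]
    refine Finset.sum_eq_zero fun p _ => ?_
    by_cases h1 : (p : ℕ) + (h 0 : ℕ) = (j : ℕ) + (k 0 : ℕ)
    · rw [ih, zero_mul]
      rw [numDown_succ, numDown_succ] at hne
      omega
    · rw [R_eq_zero h1, mul_zero]

/-! ### Two rows -/

/-- The product of two monodromy matrices, with the shift of the height between them. -/
noncomputable def twoRow (P : SOSModel N) (l m u : ℂ) (i i' q q' : Fin 2) (h k : Fin N → Fin 2) : ℂ :=
  ∑ g : Fin N → Fin 2, P.monoEntry i q l u h g * P.monoEntry i' q' m (u + P.η * sz q) g k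

theorem twoRow_zero (P : SOSModel 0) (l m u : ℂ) (i i' q q' : Fin 2) (h k : Fin 0 → Fin 2) :
    P.twoRow l m u i i' q q' h k = (if i = q then 1 else 0) * if i' = q' then 1 else 0 := by
  simp [twoRow, monoEntry_zero]

theorem sz_add_sz {a b c d : Fin 2} (h : (a : ℕ) + (b : ℕ) = (c : ℕ) + (d : ℕ)) :
    sz a + sz b = sz c + sz d := by
  have : ((a : ℕ) : ℂ) + ((b : ℕ) : ℂ) = ((c : ℕ) : ℂ) + ((d : ℕ) : ℂ) := by exact_mod_cast h
  simp only [sz]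
  linear_combination -2 * this

/-- The two rows can be regrouped site by site because spin conservation at the first site makes the
height of the second row the same whether the shift is counted before or after that site. -/
theorem twoRow_succ (P : SOSModel (N + 1)) (l m u : ℂ) (i i' q q' : Fin 2)
    (h k : Fin (N + 1) → Fin 2) : P.twoRow l m u i i' q q' h k
      = ∑ p, ∑ p', P.tail.twoRow l m (u + P.η * sz (h 0)) i i' p p' (Fin.tail h) (Fin.tail k)
        * P.rTwo (l - P.ξ 0) (m - P.ξ 0) u p p' q q' (h 0) (k 0) := by
  have hcomm : ∀ f : Fin 2 → (Fin N → Fin 2) → Fin 2 → Fin 2 → ℂ,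
      ∑ c, ∑ g, ∑ p, ∑ p', f c g p p' = ∑ p, ∑ p', ∑ g, ∑ c, f c g p p' := by
    intro f
    simp only [Fin.sum_univ_two, Finset.sum_add_distrib]
    ring
  simp only [twoRow, sum_fun_fin_succ, monoEntry_succ, Fin.cons_zero, Fin.tail_cons, rTwo,
    Finset.sum_mul_sum, hcomm, tail_η]
  refine Finset.sum_congr rfl fun p _ => Finset.sum_congr rfl fun p' _ =>
    Finset.sum_congr rfl fun g _ => Finset.sum_congr rfl fun c _ => ?_
  by_cases h1 : (p : ℕ) + (h 0 : ℕ) = (q : ℕ) + (c : ℕ)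
  · rw [show u + P.η * sz q + P.η * sz c = u + P.η * sz (h 0) + P.η * sz p by
      linear_combination -P.η * sz_add_sz h1]
    ring
  · rw [R_eq_zero h1]
    ring

theorem regular_add_sz {P : SOSModel N} {u : ℂ} (hu : ∀ k : ℤ, P.θ (u + P.η * k) ≠ 0) (a : Fin 2)
    (k : ℤ) : P.θ (u + P.η * sz a + P.η * k) ≠ 0 := by
  have := hu (k + (1 - 2 * ((a : ℕ) : ℤ)))
  convert this using 2
  simp only [sz]
  push_cast
  ring

/-- The dynamical Yang–Baxter algebra: the exchange relation of two monodromy matrices. -/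
theorem exchange_relation {P : SOSModel N} (hω : 0 < P.ω.im) {u : ℂ}
    (hu : ∀ k : ℤ, P.θ (u + P.η * k) ≠ 0) (l m : ℂ) (i i' q q' : Fin 2) (h k : Fin N → Fin 2) :
    ∑ p, ∑ p', P.R (l - m) (u + P.η * ∑ n, sz (h n)) (i, i') (p, p') * P.twoRow l m u p p' q q' h k
      = ∑ s, ∑ s', P.twoRow m l u i' i s' s h k * P.R (l - m) u (s, s') (q, q') := by
  induction N generalizing u i i' q q' with
  | zero =>
    simp [twoRow_zero]
  | succ N ih =>
    have ih' := fun r r' => ih (P := P.tail) hω (regular_add_sz hu (h 0)) i i' r r' (Fin.tail h) (Fin.tail k)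
    have hs : u + P.η * ∑ n, sz (h n) = u + P.η * sz (h 0) + P.η * ∑ n, sz (Fin.tail h n) := by
      rw [Fin.sum_univ_succ]
      simp only [Fin.tail]
      ring
    have yb := fun s s' => dynamical_yangBaxter hω hu (l - P.ξ 0) (m - P.ξ 0) s s' q q' (h 0) (k 0)
    rw [sub_sub_sub_cancel_right] at yb
    simp only [twoRow_succ, hs]
    simp only [tail_R, tail_η, Fin.sum_univ_two] at ih' yb ⊢
    -- The induction hypothesis moves `R` through the remaining sites, and the Yang–Baxter equation
    -- then moves it through the first one.
    linear_combination
      ih' 0 0 * P.rTwo (l - P.ξ 0) (m - P.ξ 0) u 0 0 q q' (h 0) (k 0)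
      + ih' 0 1 * P.rTwo (l - P.ξ 0) (m - P.ξ 0) u 0 1 q q' (h 0) (k 0)
      + ih' 1 0 * P.rTwo (l - P.ξ 0) (m - P.ξ 0) u 1 0 q q' (h 0) (k 0)
      + ih' 1 1 * P.rTwo (l - P.ξ 0) (m - P.ξ 0) u 1 1 q q' (h 0) (k 0)
      + P.tail.twoRow m l (u + P.η * sz (h 0)) i' i 0 0 (Fin.tail h) (Fin.tail k) * yb 0 0
      + P.tail.twoRow m l (u + P.η * sz (h 0)) i' i 1 0 (Fin.tail h) (Fin.tail k) * yb 0 1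
      + P.tail.twoRow m l (u + P.η * sz (h 0)) i' i 0 1 (Fin.tail h) (Fin.tail k) * yb 1 0
      + P.tail.twoRow m l (u + P.η * sz (h 0)) i' i 1 1 (Fin.tail h) (Fin.tail k) * yb 1 1

end SOSModel


namespace SOSModel

open Complex

variable {N : ℕ}

/-! ### The quantum determinant -/

/-- The antisymmetric tensor. -/
def singlet (i i' : Fin 2) : ℂ := ((i' : ℕ) : ℂ) - ((i : ℕ) : ℂ)

/-- When the two spectral parameters differ by `η`, one site carries a singlet of the auxiliary pair
to a singlet. The scalar is the quantum determinant of that site. -/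
theorem rTwo_singlet {P : SOSModel N} (hω : 0 < P.ω.im) {u : ℂ} (hu : ∀ k : ℤ, P.θ (u + P.η * k) ≠ 0) (l : ℂ)
    (i i' h k : Fin 2) :
    P.rTwo l (l - P.η) u i i' 0 1 h k - P.rTwo l (l - P.η) u i i' 1 0 h k
      = singlet i i' * (if h = k then cexp (-(I * P.yc * P.η * sz h))
          * (P.θ (l + P.η) * P.θ (l - P.η)) * P.θ u / P.θ (u + P.η * sz h) else 0) := by
  have h0 : P.θ u ≠ 0 := by simpa using hu 0
  have h1 : P.θ (u + P.η) ≠ 0 := by simpa using hu 1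
  have h2 : P.θ (u - P.η) ≠ 0 := by simpa [sub_eq_add_neg] using hu (-1)
  revert i i' h k
  simp only [Fin.forall_fin_two, rTwo, Fin.sum_univ_two, R_00_00, R_00_01, R_00_10, R_00_11,
    R_01_00, R_01_01, R_01_10, R_01_11, R_10_00, R_10_01, R_10_10, R_10_11, R_11_00, R_11_01,
    R_11_10, R_11_11, sz_zero, sz_one, mul_zero, zero_mul, add_zero, zero_add, singlet]
  simp only [mul_one, mul_neg, ← sub_eq_add_neg, mul_sub, Complex.exp_sub, add_sub_cancel_right,
    sub_add_cancel, neg_neg, Complex.exp_neg, Fin.val_zero, Fin.val_one, Nat.cast_zero, Nat.cast_one,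
    sub_self, zero_mul, if_true, mul_zero, sub_zero, zero_sub, one_ne_zero, zero_ne_one, if_false,
    one_mul]
  generalize hE : Complex.exp (Complex.I * P.yc * P.η) = E
  generalize hL : Complex.exp (Complex.I * P.yc * l) = L
  have hE0 : E ≠ 0 := hE ▸ Complex.exp_ne_zero _
  have hL0 : L ≠ 0 := hL ▸ Complex.exp_ne_zero _
  clear hE hL
  and_intros
  all_goals try trivial
  all_goals try field_simp
  all_goals first
    | (ring_nf; done)
    | (linear_combination (norm := (ring_nf; done)) θ_relation hω u u l (l + P.η))
    | (linear_combination (norm := (ring_nf; done)) -θ_relation hω u u l (l + P.η))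

/-- The quantum determinant. -/
noncomputable def qdet (P : SOSModel N) (l u : ℂ) (h : Fin N → Fin 2) : ℂ :=
  cexp (-(I * P.yc * P.η * ∑ n, sz (h n))) * (∏ n, P.θ (l - P.ξ n + P.η) * P.θ (l - P.ξ n - P.η))
    * P.θ u / P.θ (u + P.η * ∑ n, sz (h n))

theorem regular_add_sum {P : SOSModel N} {u : ℂ} (hu : ∀ k : ℤ, P.θ (u + P.η * k) ≠ 0)
    (h : Fin N → Fin 2) : P.θ (u + P.η * ∑ n, sz (h n)) ≠ 0 := by
  have := hu (N - 2 * numDown h)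
  rw [sum_sz]
  exact_mod_cast this

/-- The singlet passes through the sites one after the other, and the height quotients of the
one-site determinants telescope to `θ(u) / θ(u + ηS)`. -/
theorem twoRow_singlet {P : SOSModel N} (hω : 0 < P.ω.im) {u : ℂ}
    (hu : ∀ k : ℤ, P.θ (u + P.η * k) ≠ 0) (l : ℂ) (i i' : Fin 2) (h k : Fin N → Fin 2) :
    P.twoRow l (l - P.η) u i i' 0 1 h k - P.twoRow l (l - P.η) u i i' 1 0 h k
      = singlet i i' * (if h = k then P.qdet l u h else 0) := by
  induction N generalizing u i i' with
  | zero =>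
    have h0 : P.θ u ≠ 0 := by simpa using hu 0
    revert i i'
    simp [Fin.forall_fin_two, twoRow_zero, singlet, qdet, Subsingleton.elim h k, h0]
  | succ N ih =>
    have h1 := fun p p' => rTwo_singlet hω hu (l - P.ξ 0) p p' (h 0) (k 0)
    rw [sub_right_comm] at h1
    have h2 := ih (P := P.tail) hω (regular_add_sz hu (h 0)) i i' (Fin.tail h) (Fin.tail k)
    have h3 : (if h = k then P.qdet l u h else 0)
        = (if Fin.tail h = Fin.tail k then P.tail.qdet l (u + P.η * sz (h 0)) (Fin.tail h) else 0)
          * (if h 0 = k 0 then cexp (-(I * P.yc * P.η * sz (h 0)))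
          * (P.θ (l - P.ξ 0 + P.η) * P.θ (l - P.ξ 0 - P.η)) * P.θ u / P.θ (u + P.η * sz (h 0)) else 0) := by
      by_cases h0 : h 0 = k 0
      · by_cases ht : Fin.tail h = Fin.tail k
        · have hhk : h = k := by rw [← Fin.cons_self_tail h, ← Fin.cons_self_tail k, h0, ht]
          rw [if_pos hhk, if_pos ht, if_pos h0]
          have e0 : P.θ (u + P.η * sz (h 0)) ≠ 0 := by simpa using regular_add_sz hu (h 0) 0
          have e1 := regular_add_sum (P := P.tail) (regular_add_sz hu (h 0)) (Fin.tail h)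
          simp only [qdet, Fin.sum_univ_succ, Fin.prod_univ_succ, tail_θ, tail_η, tail_ξ, tail_yc,
            mul_add, neg_add, Complex.exp_add, ← add_assoc] at e1 ⊢
          simp only [Fin.tail] at e1 ⊢
          field_simp
        · have hhk : h ≠ k := fun e => ht (e ▸ rfl)
          rw [if_neg hhk, if_neg ht, zero_mul]
      · have hhk : h ≠ k := fun e => h0 (e ▸ rfl)
        rw [if_neg hhk, if_neg h0, mul_zero]
    rw [h3, ← mul_assoc, ← h2]
    simp only [twoRow_succ]
    simp only [Fin.sum_univ_two, tail_η, sub_right_comm l P.η (P.ξ 0)] at h1 ⊢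
    have h00 := h1 0 0
    have h01 := h1 0 1
    have h10 := h1 1 0
    have h11 := h1 1 1
    simp only [singlet, Fin.val_zero, Fin.val_one, Nat.cast_zero, Nat.cast_one, sub_self, zero_mul,
      sub_zero, one_mul, zero_sub] at h00 h01 h10 h11
    linear_combination
      P.tail.twoRow l (l - P.η) (u + P.η * sz (h 0)) i i' 0 0 (Fin.tail h) (Fin.tail k) * h00
      + P.tail.twoRow l (l - P.η) (u + P.η * sz (h 0)) i i' 0 1 (Fin.tail h) (Fin.tail k) * h01
      + P.tail.twoRow l (l - P.η) (u + P.η * sz (h 0)) i i' 1 0 (Fin.tail h) (Fin.tail k) * h10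
      + P.tail.twoRow l (l - P.η) (u + P.η * sz (h 0)) i i' 1 1 (Fin.tail h) (Fin.tail k) * h11

/-- The weight `θ(λ)` vanishes for the first factor and `θ(λ + η)` for the second one. What is left
is antisymmetric in the left auxiliary indices. -/
theorem rTwo_fusion {P : SOSModel N} {u : ℂ} (hu : ∀ k : ℤ, P.θ (u + P.η * k) ≠ 0)
    (q q' h k : Fin 2) :
    P.rTwo 0 (-P.η) u 0 0 q q' h k = 0 ∧ P.rTwo 0 (-P.η) u 1 1 q q' h k = 0
      ∧ P.rTwo 0 (-P.η) u 1 0 q q' h k = -P.rTwo 0 (-P.η) u 0 1 q q' h k := by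
  have h0 : P.θ u ≠ 0 := by simpa using hu 0
  have h1 : P.θ (u + P.η) ≠ 0 := by simpa using hu 1
  have h2 : P.θ (u - P.η) ≠ 0 := by simpa [sub_eq_add_neg] using hu (-1)
  revert q q' h k
  simp only [Fin.forall_fin_two, rTwo, Fin.sum_univ_two, R_00_00, R_00_01, R_00_10, R_00_11,
    R_01_00, R_01_01, R_01_10, R_01_11, R_10_00, R_10_01, R_10_10, R_10_11, R_11_00, R_11_01,
    R_11_10, R_11_11, sz_zero, sz_one, mul_zero, zero_mul, add_zero, zero_add, neg_add_cancel,
    θ_zero, zero_div, θ_neg]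
  simp only [mul_one, mul_neg, ← sub_eq_add_neg, add_sub_cancel_right,
    sub_add_cancel, sub_neg_eq_add, Complex.exp_neg, Complex.exp_zero, inv_inv, neg_zero]
  generalize hE : Complex.exp (Complex.I * P.yc * P.η) = E
  have hE0 : E ≠ 0 := hE ▸ Complex.exp_ne_zero _
  clear hE
  and_intros
  all_goals try trivial
  all_goals try field_simp
  all_goals ring_nf

/-- At an inhomogeneity parameter, the product of two monodromy matrices is antisymmetric. -/
theorem twoRow_fusion {P : SOSModel N} (hω : 0 < P.ω.im) {u : ℂ}
    (hu : ∀ k : ℤ, P.θ (u + P.η * k) ≠ 0) (a : Fin N) (q q' : Fin 2) (h k : Fin N → Fin 2) :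
    P.twoRow (P.ξ a) (P.ξ a - P.η) u 0 0 q q' h k = 0
      ∧ P.twoRow (P.ξ a) (P.ξ a - P.η) u 1 1 q q' h k = 0
      ∧ P.twoRow (P.ξ a) (P.ξ a - P.η) u 1 0 q q' h k
        = -P.twoRow (P.ξ a) (P.ξ a - P.η) u 0 1 q q' h k := by
  induction N generalizing u q q' with
  | zero => exact a.elim0
  | succ N ih =>
    simp only [twoRow_succ]
    induction a using Fin.cases with
    | zero =>
      obtain ⟨e1, e2, e3⟩ := rTwo_fusion hu q q' (h 0) (k 0)
      rw [sub_right_comm, sub_self, zero_sub]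
      simp only [Fin.sum_univ_two, e1, e2, e3]
      -- The first site produces an auxiliary singlet, and the remaining sites carry it to the left.
      have h2 := fun i i' => twoRow_singlet (P := P.tail) hω (regular_add_sz hu (h 0)) (P.ξ 0) i i'
        (Fin.tail h) (Fin.tail k)
      have h00 := h2 0 0
      have h01 := h2 0 1
      have h10 := h2 1 0
      have h11 := h2 1 1
      simp only [singlet, Fin.val_zero, Fin.val_one, Nat.cast_zero, Nat.cast_one, sub_self, zero_mul,
        sub_zero, one_mul, zero_sub, tail_η] at h00 h01 h10 h11
      refine ⟨?_, ?_, ?_⟩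
      · linear_combination P.rTwo 0 (-P.η) u 0 1 q q' (h 0) (k 0) * h00
      · linear_combination P.rTwo 0 (-P.η) u 0 1 q q' (h 0) (k 0) * h11
      · linear_combination P.rTwo 0 (-P.η) u 0 1 q q' (h 0) (k 0) * (h01 + h10)
    | succ a =>
      have h2 := fun p p' => ih (P := P.tail) hω (regular_add_sz hu (h 0)) a p p' (Fin.tail h) (Fin.tail k)
      simp only [tail_ξ, tail_η] at h2
      have e1 := fun p p' => (h2 p p').1
      have e2 := fun p p' => (h2 p p').2.1
      have e3 := fun p p' => (h2 p p').2.2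
      exact ⟨by simp [e1], by simp [e2], by simp only [Fin.sum_univ_two, e3]; ring⟩

/-! ### Vanishing of the diagonal entry on the reference states -/

/-- Against outgoing spins that are all up, the auxiliary spin cannot change along the row, so site
`a` contributes a weight with the factor `θ(0)`. -/
theorem monoEntry_one_one_zero {P : SOSModel N} (a : Fin N) (u : ℂ) (k : Fin N → Fin 2) :
    P.monoEntry 1 1 (P.ξ a) u (fun _ => 0) k = 0 := by
  induction N generalizing u with
  | zero => exact a.elim0
  | succ N ih =>
    rw [monoEntry_succ, Fin.sum_univ_two]
    induction a using Fin.cases with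
    | zero =>
      generalize k 0 = k0
      revert k0
      simp [Fin.forall_fin_two, θ_zero]
    | succ a =>
      have : P.R (P.ξ a.succ - P.ξ 0) u (0, 0) (1, k 0) = 0 := by
        generalize k 0 = k0
        revert k0
        simp [Fin.forall_fin_two]
      rw [this, mul_zero, zero_add]
      have h2 := ih (P := P.tail) a (u + P.η * sz 0) (Fin.tail k)
      rw [tail_ξ] at h2
      exact mul_eq_zero_of_left h2 _

theorem monoEntry_one_one_one {P : SOSModel N} (a : Fin N) (u : ℂ) (h : Fin N → Fin 2) :
    P.monoEntry 1 1 (P.ξ a - P.η) u h (fun _ => 1) = 0 := by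
  induction N generalizing u with
  | zero => exact a.elim0
  | succ N ih =>
    rw [monoEntry_succ, Fin.sum_univ_two]
    induction a using Fin.cases with
    | zero =>
      generalize h 0 = h0
      revert h0
      simp [Fin.forall_fin_two, θ_zero]
    | succ a =>
      have : P.R (P.ξ a.succ - P.η - P.ξ 0) u (0, h 0) (1, 1) = 0 := by
        generalize h 0 = h0
        revert h0
        simp [Fin.forall_fin_two]
      rw [this, mul_zero, zero_add]
      have h2 := ih (P := P.tail) a (u + P.η * sz (h 0)) (Fin.tail h)
      rw [tail_ξ] at h2
      exact mul_eq_zero_of_left h2 _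

/-- At the inhomogeneity parameter of a site, the monodromy matrix transports the heights. -/
theorem heights_of_monoEntry_ne_zero {P : SOSModel N} (hη : P.θ P.η ≠ 0) {n : Fin N} {i j : Fin 2}
    {u : ℂ} (hu : ∀ k : ℤ, P.θ (u + P.η * k) ≠ 0)  {h k : Fin N → Fin 2}
    (hne : P.monoEntry i j (P.ξ n) u h k ≠ 0) :
    ∑ m ∈ Finset.univ.filter (· < n), (h m : ℕ) + (h n : ℕ)
      = ∑ m ∈ Finset.univ.filter (· < n), (k m : ℕ) + (j : ℕ) := by
  induction N generalizing u j with
  | zero => exact n.elim0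
  | succ N ih =>
    rw [monoEntry_succ] at hne
    obtain ⟨p, -, hp⟩ := Finset.exists_ne_zero_of_sum_ne_zero hne
    have hR := right_ne_zero_of_mul hp
    have hT := left_ne_zero_of_mul hp
    induction n using Fin.cases with
    | zero =>
      -- At parameter zero the weight `b` vanishes and `R` exchanges the two spins: the outgoing
      -- spin of the site is the incoming auxiliary one.
      have : h 0 = j := by
        generalize h 0 = h0, k 0 = k0 at hR
        clear hp hT hne
        revert p h0 k0 j
        simp [Fin.forall_fin_two, θ_zero]
      simp [this]
    | succ n =>
      have h1 := ih (P := P.tail) hη (regular_add_sz hu (h 0)) hT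
      have h2 : (p : ℕ) + (h 0 : ℕ) = (j : ℕ) + (k 0 : ℕ) := by
        by_contra hc
        exact hR (R_eq_zero hc)
      simp only [Finset.sum_filter, Fin.sum_univ_succ, Fin.succ_lt_succ_iff, Fin.succ_pos, if_true,
        Fin.tail] at h1 ⊢
      omega

end SOSModel


namespace SOSModel

open Complex

variable {N : ℕ}

/-! ### Quasi-periodicity of the entries of the monodromy matrix -/

theorem θ_sub_pi {P : SOSModel N} (z : ℂ) : P.θ (z - Real.pi) = -P.θ z := by
  rw [← neg_sub, θ_neg, sub_eq_neg_add, θ_add_pi, θ_neg, neg_neg]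

theorem θ_sub_pi_mul {P : SOSModel N} (z : ℂ) :
    P.θ (z - Real.pi * P.ω) = -cexp (2 * I * z - I * Real.pi * P.ω) * P.θ z := by
  rw [← neg_sub, θ_neg, sub_eq_neg_add, θ_add_pi_mul, θ_neg,
    show -2 * I * -z = 2 * I * z by ring]
  ring

theorem differentiable_R {P : SOSModel N} (hω : 0 < P.ω.im) (t : ℂ) (r c : Fin 2 × Fin 2) :
    Differentiable ℂ fun l => P.R l t r c := by
  have h1 := P.differentiable_θ hω
  obtain ⟨i, h⟩ := r
  obtain ⟨j, k⟩ := c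
  revert i h j k
  simp only [Fin.forall_fin_two, R_00_00, R_00_01, R_00_10, R_00_11,
    R_01_00, R_01_01, R_01_10, R_01_11, R_10_00, R_10_01, R_10_10, R_10_11, R_11_00, R_11_01,
    R_11_10, R_11_11, div_eq_mul_inv, ← Complex.exp_neg]
  and_intros <;> fun_prop

theorem R_add_pi {P : SOSModel N} (l t : ℂ) (i h j k : Fin 2) :
    P.R (l + Real.pi) t (i, h) (j, k)
      = -cexp (I * P.yc * Real.pi * ((j : ℕ) - (i : ℕ))) * P.R l t (i, h) (j, k) := by
  revert i h j k
  simp only [Fin.forall_fin_two, R_00_00, R_00_01, R_00_10, R_00_11,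
    R_01_00, R_01_01, R_01_10, R_01_11, R_10_00, R_10_01, R_10_10, R_10_11, R_11_00, R_11_01,
    R_11_10, R_11_11, mul_zero, and_true, true_and, ← add_assoc, add_right_comm l, ← sub_sub,
    θ_add_pi, θ_sub_pi, mul_add, Complex.exp_add, Fin.val_zero, Fin.val_one, Nat.cast_zero,
    Nat.cast_one, sub_self, zero_sub, sub_zero, mul_neg, mul_one, Complex.exp_neg,
    Complex.exp_zero, mul_inv]
  and_intros <;> ring

/-- The height part of the exponent is written as a difference of a value after the site and a value
before it, so that the product over the sites telescopes in `monoEntry_add_pi_mul`. -/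
theorem R_add_pi_mul {P : SOSModel N} (l t : ℂ) (i h j k : Fin 2) :
    P.R (l + Real.pi * P.ω) t (i, h) (j, k)
      = -cexp (I * P.yc * Real.pi * P.ω * ((j : ℕ) - (i : ℕ)) - 2 * I * l - I * Real.pi * P.ω
          - 2 * I * ((t + P.η * sz h) * (1 - (i : ℕ)) - t * (1 - (j : ℕ)) + P.η * (h : ℕ)))
        * P.R l t (i, h) (j, k) := by
  revert i h j k
  simp only [Fin.forall_fin_two, R_00_00, R_00_01, R_00_10, R_00_11,
    R_01_00, R_01_01, R_01_10, R_01_11, R_10_00, R_10_01, R_10_10, R_10_11, R_11_00, R_11_01,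
    R_11_10, R_11_11, mul_zero, and_true, true_and, ← add_assoc, add_right_comm l, ← sub_sub,
    θ_add_pi_mul, θ_sub_pi_mul, Fin.val_zero, Fin.val_one, Nat.cast_zero, Nat.cast_one,
    sz_zero, sz_one, ← Complex.exp_neg]
  and_intros
  · ring_nf
  · ring_nf
  · have h : cexp (I * P.yc * (l + Real.pi * P.ω)) * cexp (-2 * I * (t + l) - I * Real.pi * P.ω)
        = cexp (I * P.yc * Real.pi * P.ω * (1 - 0) - 2 * I * l - I * Real.pi * P.ω
          - 2 * I * ((t + P.η * -1) * (1 - 0) - t * (1 - 1) + P.η * 1)) * cexp (I * P.yc * l) := by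
      rw [← Complex.exp_add, ← Complex.exp_add]
      ring_nf
    linear_combination -P.θ P.η * P.θ (t + l) / P.θ t * h
  · have h : cexp (-(I * P.yc * (l + Real.pi * P.ω))) * cexp (2 * I * (t - l) - I * Real.pi * P.ω)
        = cexp (I * P.yc * Real.pi * P.ω * (0 - 1) - 2 * I * l - I * Real.pi * P.ω
          - 2 * I * ((t + P.η * 1) * (1 - 1) - t * (1 - 0) + P.η * 0)) * cexp (-(I * P.yc * l)) := by
      rw [← Complex.exp_add, ← Complex.exp_add]
      ring_nf
    linear_combination (norm := ring_nf) -P.θ P.η * P.θ (t - l) / P.θ t * h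
  all_goals ring_nf

theorem differentiable_monoEntry {P : SOSModel N} (hω : 0 < P.ω.im) (i j : Fin 2) (t : ℂ)
    (h k : Fin N → Fin 2) : Differentiable ℂ fun l => P.monoEntry i j l t h k := by
  induction N generalizing j t with
  | zero => simp [monoEntry_zero]
  | succ N ih =>
    simp only [monoEntry_succ]
    have h1 := fun p => ih (P := P.tail) hω p (t + P.η * sz (h 0)) (Fin.tail h) (Fin.tail k)
    have h2 := fun p => differentiable_R hω t (p, h 0) (j, k 0)
    refine Differentiable.fun_sum fun p _ => (h1 p).mul ((h2 p).comp (by fun_prop))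

theorem monoEntry_add_pi {P : SOSModel N} (i j : Fin 2) (l t : ℂ) (h k : Fin N → Fin 2) :
    P.monoEntry i j (l + Real.pi) t h k
      = (-1) ^ N * cexp (I * P.yc * Real.pi * ((j : ℕ) - (i : ℕ))) * P.monoEntry i j l t h k := by
  induction N generalizing j t with
  | zero =>
    rw [monoEntry_zero, monoEntry_zero]
    split_ifs with hij <;> simp [hij]
  | succ N ih =>
    have h1 := fun p => ih (P := P.tail) p (t + P.η * sz (h 0)) (Fin.tail h) (Fin.tail k)
    simp only [monoEntry_succ, Finset.mul_sum, add_sub_right_comm, R_add_pi, h1, tail_yc]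
    refine Finset.sum_congr rfl fun p _ => ?_
    rw [show I * P.yc * Real.pi * (((j : ℕ) : ℂ) - (i : ℕ)) = I * P.yc * Real.pi * ((p : ℕ) - (i : ℕ))
      + I * P.yc * Real.pi * ((j : ℕ) - (p : ℕ)) by ring, Complex.exp_add]
    ring

theorem monoEntry_add_pi_mul {P : SOSModel N} (i j : Fin 2) (l t : ℂ) (h k : Fin N → Fin 2) :
    P.monoEntry i j (l + Real.pi * P.ω) t h k
      = (-1) ^ N * cexp (I * P.yc * Real.pi * P.ω * ((j : ℕ) - (i : ℕ)) - 2 * I * (N * l - ∑ n, P.ξ n)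
          - I * Real.pi * N * P.ω - 2 * I * ((t + P.η * ∑ n, sz (h n)) * (1 - (i : ℕ))
            - t * (1 - (j : ℕ)) + P.η * numDown h)) * P.monoEntry i j l t h k := by
  induction N generalizing j t with
  | zero =>
    rw [monoEntry_zero, monoEntry_zero]
    split_ifs with hij <;> simp [hij, numDown]
  | succ N ih =>
    have h1 := fun p => ih (P := P.tail) p (t + P.η * sz (h 0)) (Fin.tail h) (Fin.tail k)
    simp only [tail_yc, tail_ω, tail_η, tail_ξ] at h1
    simp only [monoEntry_succ, Finset.mul_sum, add_sub_right_comm, R_add_pi_mul, h1]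
    refine Finset.sum_congr rfl fun p _ => ?_
    simp only [← Finset.mul_sum]
    rw [numDown_succ, Fin.sum_univ_succ, Fin.sum_univ_succ]
    have := Complex.exp_add (I * P.yc * Real.pi * P.ω * ((p : ℕ) - (i : ℕ))
          - 2 * I * (N * l - ∑ n : Fin N, P.ξ n.succ)
          - I * Real.pi * N * P.ω - 2 * I * ((t + P.η * sz (h 0) + P.η * ∑ n, sz (Fin.tail h n)) * (1 - (i : ℕ))
            - (t + P.η * sz (h 0)) * (1 - (p : ℕ)) + P.η * numDown (Fin.tail h)))
      (I * P.yc * Real.pi * P.ω * ((j : ℕ) - (p : ℕ)) - 2 * I * (l - P.ξ 0) - I * Real.pi * P.ω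
          - 2 * I * ((t + P.η * sz (h 0)) * (1 - (p : ℕ)) - t * (1 - (j : ℕ)) + P.η * (h 0 : ℕ)))
    have h3 : ∀ a b c d e : ℂ, a = b * c → (-1) ^ N * b * d * (-c * e) = (-1) ^ (N + 1) * a * (d * e) := by
      rintro a b c d e rfl
      ring
    refine h3 _ _ _ _ _ (Eq.trans ?_ this)
    congr 1
    simp only [Fin.tail]
    push_cast
    ring

end SOSModel


namespace SOSModel

open Matrix

variable {N : ℕ}

/-! ### The graded entries of the monodromy matrix

On the basis vectors `|h⟩ ⊗ |t(a)⟩` with `a = c - |h|`, the dynamical operators are given by matrices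
that are indexed by the spin configurations only. -/

/-- The height `t(a)` of a spin configuration of charge `c = a + |h|`. -/
noncomputable def ht (P : SOSModel N) (c : ℤ) (h : Fin N → Fin 2) : ℂ :=
  P.t₀ + P.η * (((numDown h : ℤ) - c : ℤ) : ℂ)

/-- The entry `(i, j)` of the monodromy matrix, at the heights of the configurations of charge `c`. -/
noncomputable def gr (P : SOSModel N) (c : ℤ) (i j : Fin 2) (l : ℂ) :
    Matrix (Fin N → Fin 2) (Fin N → Fin 2) ℂ :=
  fun h k => P.monoEntry i j l (P.ht c h) h k

/-- The parameters are generic: the theta function does not vanish on the heights. -/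
theorem regular_ht {P : SOSModel N} (hω : 0 < P.ω.im) (ht₀ : ∀ k : ℤ, P.t₀ + P.η * k ∉ P.Γ) (c : ℤ)
    (h : Fin N → Fin 2) (k : ℤ) : P.θ (P.ht c h + P.η * k) ≠ 0 := by
  have := P.θ_ne_zero hω (ht₀ ((numDown h : ℤ) - c + k))
  rw [ht, add_assoc, ← mul_add]
  exact_mod_cast this

/-- The condition on the charges says that the height of an intermediate configuration allowed by
spin conservation is the shifted height that appears in `twoRow`. -/
theorem gr_mul_gr {P : SOSModel N} {c c' : ℤ} {i q : Fin 2} (hc : c' + 1 = c + (i : ℕ) + (q : ℕ))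
    (i' q' : Fin 2) (l m : ℂ) (h k : Fin N → Fin 2) :
    (P.gr c i q l * P.gr c' i' q' m) h k = P.twoRow l m (P.ht c h) i i' q q' h k := by
  rw [Matrix.mul_apply, twoRow]
  refine Finset.sum_congr rfl fun g _ => ?_
  by_cases hg : (i : ℕ) + numDown h = (q : ℕ) + numDown g
  · have : P.ht c' g = P.ht c h + P.η * sz q := by
      have h1 : (numDown g : ℤ) - c' = numDown h - c + 1 - 2 * (q : ℕ) := by omega
      rw [ht, ht, h1, sz]
      push_cast
      ring
    rw [gr, gr, this]
  · rw [gr, monoEntry_eq_zero hg, zero_mul, zero_mul]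

/-! ### Exchange and fusion relations for the graded entries -/

section Relations

variable {P : SOSModel N} (hω : 0 < P.ω.im) (ht₀ : ∀ k : ℤ, P.t₀ + P.η * k ∉ P.Γ)
include hω ht₀

theorem gr_CC (c : ℤ) {l m : ℂ} (hlm : P.θ (l - m + P.η) ≠ 0) :
    P.gr c 1 0 l * P.gr c 1 0 m = P.gr c 1 0 m * P.gr c 1 0 l := by
  ext h k
  have := exchange_relation hω (regular_ht hω ht₀ c h) l m 1 1 0 0 h k
  simp only [Fin.sum_univ_two, R_11_00, R_11_01, R_11_10, R_11_11, R_00_00, R_01_00, R_10_00,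
    zero_mul, mul_zero, zero_add, add_zero] at this
  rw [gr_mul_gr (by simp), gr_mul_gr (by simp)]
  rw [mul_comm] at this
  exact mul_right_cancel₀ hlm this

/-- An entry of the exchange relation, solved for the product with `C` on the left. This form and
`gr_CB` propagate vanishing along the bras; `gr_DC` and `gr_BC` do so along the kets. -/
theorem gr_CD (c : ℤ) (l m : ℂ) (h k : Fin N → Fin 2) :
    P.R (l - m) (P.ht c h) (1, 0) (1, 0) * (P.gr c 1 0 m * P.gr c 1 1 l) h k
      = P.θ (l - m + P.η) * (P.gr c 1 1 l * P.gr (c + 1) 1 0 m) h k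
        - P.R (l - m) (P.ht c h) (0, 1) (1, 0) * (P.gr c 1 1 m * P.gr (c + 1) 1 0 l) h k := by
  have := exchange_relation hω (regular_ht hω ht₀ c h) l m 1 1 1 0 h k
  simp only [Fin.sum_univ_two, R_11_00, R_11_01, R_11_10, R_11_11, R_00_10, R_11_10,
    zero_mul, mul_zero, zero_add, add_zero] at this
  rw [gr_mul_gr (by simp), gr_mul_gr (by simp), gr_mul_gr (by simp)]
  linear_combination -this

theorem gr_DC (c : ℤ) (l m : ℂ) (h k : Fin N → Fin 2) :
    P.R (l - m) (P.ht c h) (0, 1) (0, 1) * (P.gr c 1 1 m * P.gr (c + 1) 1 0 l) h k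
      = P.θ (l - m + P.η) * (P.gr c 1 0 l * P.gr c 1 1 m) h k
        - P.R (l - m) (P.ht c h) (1, 0) (0, 1) * (P.gr c 1 0 m * P.gr c 1 1 l) h k := by
  have := exchange_relation hω (regular_ht hω ht₀ c h) l m 1 1 0 1 h k
  simp only [Fin.sum_univ_two, R_11_00, R_11_01, R_11_10, R_11_11, R_00_01, R_11_01,
    zero_mul, mul_zero, zero_add, add_zero] at this
  rw [gr_mul_gr (by simp), gr_mul_gr (by simp), gr_mul_gr (by simp)]
  linear_combination -this

theorem gr_CB (c : ℤ) (l m : ℂ) (h k : Fin N → Fin 2) :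
    P.R (l - m) (P.ht c h) (1, 0) (1, 0) * (P.gr c 1 0 m * P.gr c 0 1 l) h k
      = P.R (l - m) (P.ht c h + P.η * ∑ n, sz (h n)) (0, 1) (0, 1)
          * (P.gr c 0 1 l * P.gr c 1 0 m) h k
        + P.R (l - m) (P.ht c h + P.η * ∑ n, sz (h n)) (0, 1) (1, 0)
          * (P.gr c 1 1 l * P.gr (c + 1) 0 0 m) h k
        - P.R (l - m) (P.ht c h) (0, 1) (1, 0) * (P.gr c 1 1 m * P.gr (c + 1) 0 0 l) h k := by
  have := exchange_relation hω (regular_ht hω ht₀ c h) l m 0 1 1 0 h k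
  simp only [Fin.sum_univ_two, R_01_00, R_01_11, R_00_10, R_11_10,
    zero_mul, mul_zero, zero_add, add_zero] at this
  rw [gr_mul_gr (by simp), gr_mul_gr (by simp), gr_mul_gr (by simp), gr_mul_gr (by simp)]
  linear_combination -this

theorem gr_BC (c : ℤ) (l m : ℂ) (h k : Fin N → Fin 2) :
    P.R (l - m) (P.ht c h) (0, 1) (0, 1) * (P.gr c 0 1 m * P.gr c 1 0 l) h k
      = P.R (l - m) (P.ht c h + P.η * ∑ n, sz (h n)) (1, 0) (1, 0)
          * (P.gr c 1 0 l * P.gr c 0 1 m) h k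
        + P.R (l - m) (P.ht c h + P.η * ∑ n, sz (h n)) (1, 0) (0, 1)
          * (P.gr c 0 0 l * P.gr (c - 1) 1 1 m) h k
        - P.R (l - m) (P.ht c h) (1, 0) (0, 1) * (P.gr c 0 0 m * P.gr (c - 1) 1 1 l) h k := by
  have := exchange_relation hω (regular_ht hω ht₀ c h) l m 1 0 0 1 h k
  simp only [Fin.sum_univ_two, R_10_00, R_10_11, R_00_01, R_11_01,
    zero_mul, mul_zero, zero_add, add_zero] at this
  rw [gr_mul_gr (by simp), gr_mul_gr (by simp), gr_mul_gr (by simp), gr_mul_gr (by simp)]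
  linear_combination -this

theorem gr_mul_gr_same (c : ℤ) (a : Fin N) :
    P.gr c 1 0 (P.ξ a) * P.gr c 1 0 (P.ξ a - P.η) = 0
      ∧ P.gr c 0 1 (P.ξ a) * P.gr c 0 1 (P.ξ a - P.η) = 0 := by
  constructor
  · ext h k
    rw [gr_mul_gr (by simp)]
    exact (twoRow_fusion hω (regular_ht hω ht₀ c h) a 0 0 h k).2.1
  · ext h k
    rw [gr_mul_gr (by simp)]
    exact (twoRow_fusion hω (regular_ht hω ht₀ c h) a 1 1 h k).1

/-- Antisymmetry on the left changes the sum into a product antisymmetrised on the right, which is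
the quantum determinant. -/
theorem gr_BC_add_CB (c : ℤ) (a : Fin N) (h k : Fin N → Fin 2) :
    (P.gr c 0 1 (P.ξ a) * P.gr c 1 0 (P.ξ a - P.η)) h k
      + (P.gr c 1 0 (P.ξ a) * P.gr c 0 1 (P.ξ a - P.η)) h k
      = if h = k then -P.qdet (P.ξ a) (P.ht c h) h else 0 := by
  rw [gr_mul_gr (by simp), gr_mul_gr (by simp),
    (twoRow_fusion hω (regular_ht hω ht₀ c h) a 0 1 h k).2.2]
  have := twoRow_singlet hω (regular_ht hω ht₀ c h) (P.ξ a) 0 1 h k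
  simp only [singlet, Fin.val_one, Fin.val_zero, Nat.cast_one, Nat.cast_zero, sub_zero, one_mul] at this
  rw [← sub_eq_add_neg, ← neg_sub, this]
  split_ifs <;> simp

end Relations

/-! ### The quantum determinant on the space of states -/

theorem θ_add_xy {P : SOSModel N} (z : ℂ) :
    P.θ (z + (P.xc * Real.pi + P.yc * Real.pi * P.ω))
      = (-1) ^ ((P.x : ℕ) + (P.y : ℕ))
        * Complex.exp (-(P.yc * (2 * Complex.I * z + Complex.I * Real.pi * P.ω))) * P.θ z := by
  have hx : ∀ z, P.θ (z + P.xc * Real.pi) = (-1) ^ (P.x : ℕ) * P.θ z := by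
    intro z
    rw [xc]
    generalize P.x = x
    fin_cases x <;> simp [θ_add_pi]
  have hy : ∀ z, P.θ (z + P.yc * Real.pi * P.ω) = (-1) ^ (P.y : ℕ)
      * Complex.exp (-(P.yc * (2 * Complex.I * z + Complex.I * Real.pi * P.ω))) * P.θ z := by
    intro z
    rw [yc]
    generalize P.y = y
    fin_cases y
    · simp
    · simp [θ_add_pi_mul, sub_eq_add_neg, add_comm]
  rw [add_comm (P.xc * _), ← add_assoc, hx, hy, pow_add]
  ring

/-- By the choice of `t₀`, at charge zero the heights before and after the whole chain add up to `xπ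
+ yπω`. Oddness and quasi-periodicity of `θ` then reduce their quotient to the sign of `axy` times
an exponential that cancels the one in `qdet`; the configuration drops out. -/
theorem qdet_eq {P : SOSModel N} (hω : 0 < P.ω.im) (ht₀ : ∀ k : ℤ, P.t₀ + P.η * k ∉ P.Γ) (a : Fin N)
    (h : Fin N → Fin 2) :
    -P.qdet (P.ξ a) (P.ht 0 h) h = P.axy (P.ξ a) * P.dProd (P.ξ a - P.η) := by
  have h0 := regular_add_sum (regular_ht hω ht₀ 0 h) h
  set S : ℂ := ∑ n, sz (h n) with hS
  have hSd : S = N - 2 * numDown h := sum_sz h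
  have h1 : P.ht 0 h = -(P.ht 0 h + P.η * S) + (P.xc * Real.pi + P.yc * Real.pi * P.ω) := by
    rw [hSd, ht, t₀]
    push_cast
    ring
  have h2 : P.θ (P.ht 0 h) = -((-1) ^ ((P.x : ℕ) + (P.y : ℕ) + (P.x : ℕ) * (P.y : ℕ))
      * Complex.exp (Complex.I * P.yc * P.η * S)) * P.θ (P.ht 0 h + P.η * S) := by
    have h3 : Complex.exp (-(P.yc * (2 * Complex.I * -(P.ht 0 h + P.η * S) + Complex.I * Real.pi * P.ω)))
        = (-1) ^ ((P.x : ℕ) * (P.y : ℕ)) * Complex.exp (Complex.I * P.yc * P.η * S) := by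
      have hxy : Complex.exp (Complex.I * P.yc * P.xc * Real.pi) = (-1) ^ ((P.x : ℕ) * (P.y : ℕ)) := by
        rw [← Complex.exp_pi_mul_I, ← Complex.exp_nat_mul, xc, yc]
        push_cast
        congr 1
        ring
      have hyy : P.yc * P.yc = P.yc := by
        rw [yc]
        generalize P.y = y
        fin_cases y <;> simp
      rw [← hxy, ← Complex.exp_add]
      congr 1
      rw [hSd, ht, t₀]
      push_cast
      linear_combination (Complex.I * Real.pi * P.ω) * hyy
    conv_lhs => rw [h1]
    rw [θ_add_xy, h3, θ_neg]
    ring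
  rw [qdet, ← hS, h2, axy, aProd, dProd, aProd]
  simp only [wa]
  rw [Finset.prod_mul_distrib]
  have h4 : ∀ n, P.ξ a - P.η - P.η - P.ξ n + P.η = P.ξ a - P.ξ n - P.η := fun n => by ring
  simp only [h4]
  have h5 : Complex.exp (-(Complex.I * P.yc * P.η * S)) * Complex.exp (Complex.I * P.yc * P.η * S) = 1 := by
    rw [← Complex.exp_add, neg_add_cancel, Complex.exp_zero]
  field_simp
  linear_combination ((∏ n, P.θ (P.ξ a - P.ξ n + P.η)) * (∏ n, P.θ (P.ξ a - P.ξ n - P.η))) * h5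

end SOSModel


/-! ### Ordered products of commuting factors -/

theorem List.prod_ofFn_pow_update {M : Type*} [Monoid M] {N : ℕ} {F : Fin N → M}
    (hF : ∀ a b, Commute (F a) (F b)) (e : Fin N → ℕ) (a : Fin N) :
    (List.ofFn fun n => F n ^ (Function.update e a (e a + 1) n)).prod
      = F a * (List.ofFn fun n => F n ^ e n).prod := by
  induction N with
  | zero => exact a.elim0
  | succ N ih =>
    simp only [List.ofFn_succ, List.prod_cons]
    induction a using Fin.cases with
    | zero =>
      have : ∀ n : Fin N, Function.update e 0 (e 0 + 1) n.succ = e n.succ := fun n =>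
        Function.update_of_ne (Fin.succ_ne_zero n) _ _
      simp only [Function.update_self, this, pow_succ', mul_assoc]
    | succ a =>
      have h1 : ∀ n : Fin N, Function.update e a.succ (e a.succ + 1) n.succ
          = Function.update (fun n => e n.succ) a (e a.succ + 1) n := fun n => by
        by_cases hn : n = a
        · subst hn
          simp
        · simp [hn]
      have h2 := ih (F := fun n => F n.succ) (fun _ _ => hF _ _) (fun n => e n.succ) a
      simp only [h1, h2, Function.update_of_ne (Fin.succ_ne_zero a).symm, ← mul_assoc]
      rw [((hF 0 a.succ).pow_left (e 0)).eq]

theorem List.commute_prod_ofFn_pow {M : Type*} [Monoid M] {N : ℕ} {F : Fin N → M}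
    (hF : ∀ a b, Commute (F a) (F b)) (e : Fin N → ℕ) (a : Fin N) :
    Commute (F a) (List.ofFn fun n => F n ^ e n).prod := by
  refine Commute.list_prod_right _ _ fun x hx => ?_
  obtain ⟨n, rfl⟩ := (List.mem_ofFn' _ _).1 hx
  exact (hF a n).pow_right _

namespace SOSModel

open Matrix

variable {N : ℕ}

/-! ### Spin configurations -/

theorem numDown_update_one {h : Fin N → Fin 2} {a : Fin N} (ha : h a = 0) :
    numDown (Function.update h a 1) = numDown h + 1 := by
  rw [numDown, numDown, ← Finset.add_sum_erase _ _ (Finset.mem_univ a),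
    ← Finset.add_sum_erase _ (fun n => (h n : ℕ)) (Finset.mem_univ a), ha]
  rw [Finset.sum_congr rfl fun n hn => by rw [Function.update_of_ne (Finset.ne_of_mem_erase hn)]]
  simp [add_comm]

theorem config_induction {p : (Fin N → Fin 2) → Prop} (h0 : p fun _ => 0)
    (hs : ∀ h a, h a = 0 → p h → p (Function.update h a 1)) (h : Fin N → Fin 2) : p h := by
  induction hm : numDown h generalizing h with
  | zero =>
    have : h = fun _ => 0 := by
      funext n
      have := (Finset.sum_eq_zero_iff.1 hm) n (Finset.mem_univ n)
      exact Fin.ext this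
    rwa [this]
  | succ m ih =>
    obtain ⟨a, ha⟩ : ∃ a, h a ≠ 0 := by
      by_contra! hc
      simp [numDown, hc] at hm
    have ha1 : h a = 1 := by
      generalize h a = x at ha
      fin_cases x <;> simp_all
    have h2 : Function.update (Function.update h a 0) a 1 = h := by
      rw [Function.update_idem, ← ha1, Function.update_eq_self]
    have h3 : Function.update h a 0 a = 0 := Function.update_self _ _ _
    rw [← h2]
    refine hs _ a h3 (ih _ ?_)
    have := numDown_update_one h3
    rw [h2, hm] at this
    omega

theorem config_induction_down {p : (Fin N → Fin 2) → Prop} (h1 : p fun _ => 1)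
    (hs : ∀ h a, h a = 1 → p h → p (Function.update h a 0)) (h : Fin N → Fin 2) : p h := by
  have := config_induction (p := fun h => p fun n => 1 - h n) (by simpa using h1)
    (fun h a ha hp => by
      have := hs _ a (by simp [ha]) hp
      convert this using 1
      funext n
      by_cases hn : n = a
      · subst hn
        simp
      · simp [hn]) (fun n => 1 - h n)
  simpa using this

theorem eq_const_one_of_numDown {h : Fin N → Fin 2} (hh : numDown h = N) : h = fun _ => 1 := by
  by_contra hc
  obtain ⟨a, ha⟩ := Function.ne_iff.1 hc
  have h1 : numDown h < ∑ _n : Fin N, 1 := by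
    refine Finset.sum_lt_sum (fun n _ => by have := (h n).isLt; omega) ⟨a, Finset.mem_univ a, ?_⟩
    have := (h a).isLt
    have h3 : (h a : ℕ) ≠ 1 := fun e => ha (Fin.ext e)
    omega
  simp [hh] at h1

theorem numDown_one : numDown (fun _ : Fin N => (1 : Fin 2)) = N := by
  simp [numDown]

theorem numDown_zero : numDown (fun _ : Fin N => (0 : Fin 2)) = 0 := by
  simp [numDown]

theorem numDown_le (h : Fin N → Fin 2) : numDown h ≤ N := by
  have : numDown h ≤ ∑ _n : Fin N, 1 := Finset.sum_le_sum fun n _ => by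
    have := (h n).isLt
    omega
  simpa using this

/-! ### The states of separate variables -/

/-- The bra `⟨0, h|`, without the normalization. -/
noncomputable def sb (P : SOSModel N) (h : Fin N → Fin 2) : (Fin N → Fin 2) → ℂ :=
  Pi.single (fun _ => 0) 1 ᵥ* (List.ofFn fun n : Fin N =>
    ((P.dProd (P.ξ n - P.η))⁻¹ • P.gr 0 1 0 (P.ξ n)) ^ (h n : ℕ)).prod

/-- The ket `|h, 0⟩`, without the normalization. -/
noncomputable def sk (P : SOSModel N) (h : Fin N → Fin 2) : (Fin N → Fin 2) → ℂ :=
  (List.ofFn fun n : Fin N =>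
    ((P.dProd (P.ξ n - P.η))⁻¹ • P.gr 0 1 0 (P.ξ n - P.η)) ^ (1 - (h n : ℕ))).prod
      *ᵥ Pi.single (fun _ => 1) 1

theorem sb_zero {P : SOSModel N} : P.sb (fun _ => 0) = Pi.single (fun _ => 0) 1 := by
  simp [sb]

theorem sk_one {P : SOSModel N} : P.sk (fun _ => 1) = Pi.single (fun _ => 1) 1 := by
  rw [sk, List.prod_eq_one, one_mulVec]
  simp

/-- The matrix of the transfer matrix on the space of states. -/
noncomputable def tm (P : SOSModel N) (κ l : ℂ) : Matrix (Fin N → Fin 2) (Fin N → Fin 2) ℂ :=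
  κ⁻¹ • P.gr 0 0 1 l + κ • P.gr 0 1 0 l

section Generic

variable {P : SOSModel N} (hω : 0 < P.ω.im) (hη : P.η ∉ P.Γ) (ht₀ : ∀ k : ℤ, P.t₀ + P.η * k ∉ P.Γ)
  (hξ : ∀ a b : Fin N, a ≠ b →
      P.ξ a - P.ξ b ∉ P.Γ ∧ P.ξ a - P.ξ b + P.η ∉ P.Γ ∧ P.ξ a - P.ξ b - P.η ∉ P.Γ)

include hω hη hξ in
theorem dProd_ne_zero (a : Fin N) : P.dProd (P.ξ a - P.η) ≠ 0 := by
  rw [dProd, aProd]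
  refine Finset.prod_ne_zero_iff.2 fun n _ => P.θ_ne_zero hω ?_
  rw [show P.ξ a - P.η - P.η - P.ξ n + P.η = P.ξ a - P.ξ n - P.η by ring]
  by_cases hn : a = n
  · rw [hn, sub_self, zero_sub]
    exact fun h => hη (neg_mem_Γ_iff.1 h)
  · exact (hξ a n hn).2.2

include hω hη hξ in
theorem axy_ne_zero (a : Fin N) : P.axy (P.ξ a) ≠ 0 := by
  rw [axy, aProd]
  refine mul_ne_zero (pow_ne_zero _ (by norm_num)) (Finset.prod_ne_zero_iff.2 fun n _ => P.θ_ne_zero hω ?_)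
  by_cases hn : a = n
  · rw [hn, sub_self, zero_add]
    exact hη
  · exact (hξ a n hn).2.1

include hω ht₀ in
-- The terms `BB` and `CC` vanish by fusion, and in the mixed terms the twist cancels, which leaves
-- the quantum determinant.
theorem tm_mul_tm {κ : ℂ} (hκ : κ ≠ 0) (a : Fin N) :
    P.tm κ (P.ξ a) * P.tm κ (P.ξ a - P.η) = (P.axy (P.ξ a) * P.dProd (P.ξ a - P.η)) • 1 := by
  obtain ⟨h1, h2⟩ := gr_mul_gr_same hω ht₀ 0 a
  ext h k
  have h3 := gr_BC_add_CB hω ht₀ 0 a h k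
  simp only [tm, add_mul, mul_add, smul_mul_smul_comm, h1, h2, smul_zero, add_zero, zero_add,
    inv_mul_cancel₀ hκ, mul_inv_cancel₀ hκ, one_smul, Matrix.add_apply, Matrix.smul_apply,
    Matrix.one_apply, smul_eq_mul, mul_ite, mul_one, mul_zero]
  rw [add_comm, h3]
  split_ifs
  · exact qdet_eq hω ht₀ a h
  · rfl

section Update

include hω ht₀ hξ

/-- The operators `C` at distinct inhomogeneities commute, so the new factor may be placed last. -/
theorem sb_update {h : Fin N → Fin 2} {a : Fin N} (ha : h a = 0) :
    P.sb (Function.update h a 1)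
      = (P.dProd (P.ξ a - P.η))⁻¹ • (P.sb h ᵥ* P.gr 0 1 0 (P.ξ a)) := by
  set F : Fin N → Matrix (Fin N → Fin 2) (Fin N → Fin 2) ℂ :=
    fun n => (P.dProd (P.ξ n - P.η))⁻¹ • P.gr 0 1 0 (P.ξ n) with hF
  have hc : ∀ a b, Commute (F a) (F b) := by
    intro a b
    by_cases hab : a = b
    · rw [hab]
    · exact (Commute.smul_left (Commute.smul_right
        (gr_CC hω ht₀ 0 (P.θ_ne_zero hω (hξ a b hab).2.1)) _) _)
  have h1 : ∀ n, ((Function.update h a 1 n : Fin 2) : ℕ)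
      = Function.update (fun n => (h n : ℕ)) a ((h a : ℕ) + 1) n := by
    intro n
    by_cases hn : n = a
    · subst hn
      simp [ha]
    · simp [hn]
  have h2 := List.prod_ofFn_pow_update hc (fun n => (h n : ℕ)) a
  rw [(List.commute_prod_ofFn_pow hc (fun n => (h n : ℕ)) a).eq] at h2
  simp only [sb, h1]
  rw [h2, ← Matrix.vecMul_vecMul, hF, Matrix.vecMul_smul]

theorem sk_update {h : Fin N → Fin 2} {a : Fin N} (ha : h a = 1) :
    P.sk (Function.update h a 0)
      = (P.dProd (P.ξ a - P.η))⁻¹ • (P.gr 0 1 0 (P.ξ a - P.η) *ᵥ P.sk h) := by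
  set F : Fin N → Matrix (Fin N → Fin 2) (Fin N → Fin 2) ℂ :=
    fun n => (P.dProd (P.ξ n - P.η))⁻¹ • P.gr 0 1 0 (P.ξ n - P.η) with hF
  have hc : ∀ a b, Commute (F a) (F b) := by
    intro a b
    by_cases hab : a = b
    · rw [hab]
    · refine (Commute.smul_left (Commute.smul_right
        (gr_CC hω ht₀ 0 (P.θ_ne_zero hω ?_)) _) _)
      rw [sub_sub_sub_cancel_right]
      exact (hξ a b hab).2.1
  have h1 : ∀ n, 1 - ((Function.update h a 0 n : Fin 2) : ℕ)
      = Function.update (fun n => 1 - (h n : ℕ)) a (1 - (h a : ℕ) + 1) n := by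
    intro n
    by_cases hn : n = a
    · subst hn
      simp [ha]
    · simp [hn]
  have h2 := List.prod_ofFn_pow_update hc (fun n => 1 - (h n : ℕ)) a
  simp only [sk, h1]
  rw [h2, ← Matrix.mulVec_mulVec, hF, Matrix.smul_mulVec]

theorem numDown_of_sb_ne_zero (h : Fin N → Fin 2) :
    ∀ k, P.sb h k ≠ 0 → numDown k = numDown h := by
  induction h using config_induction with
  | h0 =>
    intro k hk
    rw [sb_zero] at hk
    by_contra hc
    exact hk (Pi.single_eq_of_ne (fun e => hc (by rw [e])) _)
  | hs h a ha ih =>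
    intro k hk
    rw [sb_update hω ht₀ hξ ha] at hk
    obtain ⟨g, -, hg⟩ := Finset.exists_ne_zero_of_sum_ne_zero (right_ne_zero_of_mul hk)
    have h1 := ih g (left_ne_zero_of_mul hg)
    have h2 : (1 : ℕ) + numDown g = 0 + numDown k := by
      by_contra hc
      exact right_ne_zero_of_mul hg (monoEntry_eq_zero hc)
    rw [numDown_update_one ha]
    omega

theorem numDown_of_sk_ne_zero (h : Fin N → Fin 2) :
    ∀ k, P.sk h k ≠ 0 → numDown k = numDown h := by
  induction h using config_induction_down with
  | h1 =>
    intro k hk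
    rw [sk_one] at hk
    by_contra hc
    exact hk (Pi.single_eq_of_ne (fun e => hc (by rw [e])) _)
  | hs h a ha ih =>
    intro k hk
    rw [sk_update hω ht₀ hξ ha] at hk
    obtain ⟨g, -, hg⟩ := Finset.exists_ne_zero_of_sum_ne_zero (right_ne_zero_of_mul hk)
    have h1 := ih g (right_ne_zero_of_mul hg)
    have h2 : (1 : ℕ) + numDown k = 0 + numDown g := by
      by_contra hc
      exact left_ne_zero_of_mul hg (monoEntry_eq_zero hc)
    have h3 := numDown_update_one (h := Function.update h a 0) (a := a) (Function.update_self _ _ _)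
    rw [Function.update_idem, ← ha, Function.update_eq_self] at h3
    omega

/-! ### Vanishing of the diagonal entries on the states of separate variables -/

/-- The diagonal entry is included because moving `B` through `C` creates terms that start with `D`.
When a site `b ≠ a` is flipped, every term of the exchange relations has `D` or `B` at `ξ_a` or
`ξ_b` next to the old bra, where both sites are still unflipped. -/
theorem vecMul_sb_eq_zero (h : Fin N → Fin 2) :
    ∀ a, h a = 0 → P.sb h ᵥ* P.gr 0 1 1 (P.ξ a) = 0 ∧ P.sb h ᵥ* P.gr 0 0 1 (P.ξ a) = 0 := by
  induction h using config_induction with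
  | h0 =>
    intro a _
    rw [sb_zero]
    constructor
    · funext k
      simp [gr, monoEntry_one_one_zero]
    · funext k
      simp only [single_vecMul, Pi.zero_apply]
      refine mul_eq_zero_of_right _ (monoEntry_eq_zero ?_)
      simp [numDown_zero]
      omega
  | hs h b hb ih =>
    intro a ha
    have hab : a ≠ b := by
      rintro rfl
      simp at ha
    rw [Function.update_of_ne hab] at ha
    have hs := numDown_of_sb_ne_zero hω ht₀ hξ h
    have hR : P.R (P.ξ a - P.ξ b) (P.t₀ + P.η * (((numDown h : ℤ) - 0 : ℤ) : ℂ)) (1, 0) (1, 0) ≠ 0 := by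
      have h1 := regular_ht hω ht₀ 0 h 0
      have h2 := regular_ht hω ht₀ 0 h (-1)
      have h3 := P.θ_ne_zero hω (hξ a b hab).1
      simp only [ht, Int.cast_zero, mul_zero, add_zero, Int.cast_neg, Int.cast_one, mul_neg, mul_one,
        ← sub_eq_add_neg] at h1 h2
      rw [R_10_10]
      exact mul_ne_zero (inv_ne_zero (Complex.exp_ne_zero _)) (div_ne_zero (mul_ne_zero h3 h2) h1)
    -- The coefficients of the exchange relations depend on a configuration only through `numDown`,
    -- which is constant on the support of the bra, so they can be taken out of the sum.
    have key : ∀ (X Y : Matrix (Fin N → Fin 2) (Fin N → Fin 2) ℂ) (f : ℂ), f ≠ 0 →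
        P.sb h ᵥ* Y = 0 → (∀ g k, numDown g = numDown h → f * X g k = Y g k) → P.sb h ᵥ* X = 0 := by
      intro X Y f hf hY hXY
      funext k
      have h1 : f * (P.sb h ᵥ* X) k = (P.sb h ᵥ* Y) k := by
        simp only [vecMul, dotProduct, Finset.mul_sum]
        refine Finset.sum_congr rfl fun g _ => ?_
        by_cases hg : P.sb h g = 0
        · simp [hg]
        · rw [← hXY g k (hs g hg)]
          ring
      rw [hY] at h1
      exact (mul_eq_zero.1 h1).resolve_left hf
    rw [sb_update hω ht₀ hξ hb, Matrix.smul_vecMul, Matrix.smul_vecMul, Matrix.vecMul_vecMul,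
      Matrix.vecMul_vecMul]
    constructor
    · rw [key _ (P.θ (P.ξ a - P.ξ b + P.η) • (P.gr 0 1 1 (P.ξ a) * P.gr (0 + 1) 1 0 (P.ξ b))
        - P.R (P.ξ a - P.ξ b) (P.t₀ + P.η * (((numDown h : ℤ) - 0 : ℤ) : ℂ)) (0, 1) (1, 0) •
          (P.gr 0 1 1 (P.ξ b) * P.gr (0 + 1) 1 0 (P.ξ a))) _ hR ?_ ?_, smul_zero]
      · rw [Matrix.vecMul_sub, Matrix.vecMul_smul, Matrix.vecMul_smul, ← Matrix.vecMul_vecMul,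
          ← Matrix.vecMul_vecMul, (ih a ha).1, (ih b hb).1]
        simp
      · intro g k hg
        have := gr_CD hω ht₀ 0 (P.ξ a) (P.ξ b) g k
        simp only [ht, hg] at this
        exact this
    · rw [key _ (P.R (P.ξ a - P.ξ b) (P.t₀ + P.η * (((numDown h : ℤ) - 0 : ℤ) : ℂ)
            + P.η * (N - 2 * numDown h)) (0, 1) (0, 1) • (P.gr 0 0 1 (P.ξ a) * P.gr 0 1 0 (P.ξ b))
        + P.R (P.ξ a - P.ξ b) (P.t₀ + P.η * (((numDown h : ℤ) - 0 : ℤ) : ℂ)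
            + P.η * (N - 2 * numDown h)) (0, 1) (1, 0) •
          (P.gr 0 1 1 (P.ξ a) * P.gr (0 + 1) 0 0 (P.ξ b))
        - P.R (P.ξ a - P.ξ b) (P.t₀ + P.η * (((numDown h : ℤ) - 0 : ℤ) : ℂ)) (0, 1) (1, 0) •
          (P.gr 0 1 1 (P.ξ b) * P.gr (0 + 1) 0 0 (P.ξ a))) _ hR ?_ ?_, smul_zero]
      · rw [Matrix.vecMul_sub, Matrix.vecMul_add, Matrix.vecMul_smul, Matrix.vecMul_smul,
          Matrix.vecMul_smul, ← Matrix.vecMul_vecMul, ← Matrix.vecMul_vecMul, ← Matrix.vecMul_vecMul,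
          (ih a ha).1, (ih b hb).1, (ih a ha).2]
        simp
      · intro g k hg
        have := gr_CB hω ht₀ 0 (P.ξ a) (P.ξ b) g k
        simp only [ht, sum_sz, hg] at this
        exact this

/-- Mirror image of `vecMul_sb_eq_zero`. The charge `-1` of `D` is the one produced by `gr_BC` at
charge `0`. The coefficients depend on the row only, so no support argument is needed. -/
theorem mulVec_sk_eq_zero (h : Fin N → Fin 2) :
    ∀ a, h a = 1 → P.gr (-1) 1 1 (P.ξ a - P.η) *ᵥ P.sk h = 0
      ∧ P.gr 0 0 1 (P.ξ a - P.η) *ᵥ P.sk h = 0 := by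
  induction h using config_induction_down with
  | h1 =>
    intro a _
    rw [sk_one]
    constructor
    · funext k
      simp [gr, monoEntry_one_one_one]
    · funext k
      simp only [mulVec_single, Pi.zero_apply]
      refine mul_eq_zero_of_left (monoEntry_eq_zero ?_) _
      have := numDown_le k
      simp [numDown_one]
      omega
  | hs h b hb ih =>
    intro a ha
    have hab : b ≠ a := by
      rintro rfl
      simp at ha
    rw [Function.update_of_ne hab.symm] at ha
    have hR : ∀ c g, P.R (P.ξ b - P.η - (P.ξ a - P.η)) (P.ht c g) (0, 1) (0, 1) ≠ 0 := by
      intro c g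
      have h1 := regular_ht hω ht₀ c g 0
      have h2 := regular_ht hω ht₀ c g 1
      have h3 := P.θ_ne_zero hω (hξ b a hab).1
      simp only [Int.cast_zero, mul_zero, add_zero, Int.cast_one, mul_one] at h1 h2
      rw [R_01_01, sub_sub_sub_cancel_right]
      exact mul_ne_zero (Complex.exp_ne_zero _) (div_ne_zero (mul_ne_zero h3 h2) h1)
    rw [sk_update hω ht₀ hξ hb, Matrix.mulVec_smul, Matrix.mulVec_smul, Matrix.mulVec_mulVec,
      Matrix.mulVec_mulVec]
    have key : ∀ (X : Matrix (Fin N → Fin 2) (Fin N → Fin 2) ℂ) (g : Fin N → Fin 2) (f : ℂ), f ≠ 0 →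
        ∑ k, f * X g k * P.sk h k = 0 → (X *ᵥ P.sk h) g = 0 := by
      intro X g f hf hX
      have h1 : f * (X *ᵥ P.sk h) g = 0 := by
        rw [← hX]
        simp only [mulVec, dotProduct, Finset.mul_sum, mul_assoc]
      exact (mul_eq_zero.1 h1).resolve_left hf
    have key2 : ∀ (X Y : Matrix (Fin N → Fin 2) (Fin N → Fin 2) ℂ) (g : Fin N → Fin 2) (f : ℂ),
        Y *ᵥ P.sk h = 0 → ∑ k, f * (X * Y) g k * P.sk h k = 0 := by
      intro X Y g f hY
      have h1 : f * ((X * Y) *ᵥ P.sk h) g = 0 := by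
        rw [← Matrix.mulVec_mulVec, hY, mulVec_zero]
        simp
      rw [← h1]
      simp only [mulVec, dotProduct, Finset.mul_sum, mul_assoc]
    constructor
    · have : (P.gr (-1) 1 1 (P.ξ a - P.η) * P.gr 0 1 0 (P.ξ b - P.η)) *ᵥ P.sk h = 0 := by
        funext g
        refine key _ g _ (hR (-1) g) ?_
        have := fun k => gr_DC hω ht₀ (-1) (P.ξ b - P.η) (P.ξ a - P.η) g k
        rw [neg_add_cancel] at this
        simp only [this, sub_mul, Finset.sum_sub_distrib, key2 _ _ _ _ (ih a ha).1,
          key2 _ _ _ _ (ih b hb).1, sub_zero]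
      rw [this, smul_zero]
    · have : (P.gr 0 0 1 (P.ξ a - P.η) * P.gr 0 1 0 (P.ξ b - P.η)) *ᵥ P.sk h = 0 := by
        funext g
        refine key _ g _ (hR 0 g) ?_
        have := fun k => gr_BC hω ht₀ 0 (P.ξ b - P.η) (P.ξ a - P.η) g k
        rw [zero_sub] at this
        simp only [this, sub_mul, add_mul, Finset.sum_sub_distrib, Finset.sum_add_distrib,
          key2 _ _ _ _ (ih a ha).1, key2 _ _ _ _ (ih b hb).1, key2 _ _ _ _ (ih a ha).2, sub_zero,
          add_zero]
      rw [this, smul_zero]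

end Update

end Generic

end SOSModel


/-! ### Orthogonality and pairing of the states of separate variables -/

namespace SOSModel

open Matrix

variable {N : ℕ}

theorem gr_add_pi {P : SOSModel N} (c : ℤ) (l : ℂ) :
    P.gr c 1 0 (l + Real.pi)
      = ((-1) ^ N * Complex.exp (-(Complex.I * P.yc * Real.pi))) • P.gr c 1 0 l := by
  ext h k
  simp [gr, monoEntry_add_pi]

/-- For `C` at charge zero the height terms of the multiplier add up to `-t₀` for every
configuration. Centering at `ξbar` absorbs this constant together with the sum of the `ξ_k`. -/
theorem gr_add_pi_mul {P : SOSModel N} (hN : 1 ≤ N) (l : ℂ) :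
    P.gr 0 1 0 (l + Real.pi * P.ω)
      = ((-1) ^ N * Complex.exp (-(Complex.I * P.yc * Real.pi * P.ω) - 2 * Complex.I * N * (l - P.ξbar)
          - Complex.I * Real.pi * N * P.ω)) • P.gr 0 1 0 l := by
  have hN' : (N : ℂ) ≠ 0 := by exact_mod_cast (by omega : N ≠ 0)
  have hb : (N : ℂ) * P.ξbar = ∑ k, P.ξ k + P.t₀ := by
    rw [ξbar]
    field_simp
  ext h k
  rw [Matrix.smul_apply, smul_eq_mul, gr, gr, monoEntry_add_pi_mul]
  congr 3
  simp only [ht, Fin.val_zero, Fin.val_one]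
  push_cast
  linear_combination -2 * Complex.I * hb

section Generic

variable {P : SOSModel N} (hω : 0 < P.ω.im) (hη : P.η ∉ P.Γ) (ht₀ : ∀ k : ℤ, P.t₀ + P.η * k ∉ P.Γ)
  (hξ : ∀ a b : Fin N, a ≠ b →
      P.ξ a - P.ξ b ∉ P.Γ ∧ P.ξ a - P.ξ b + P.η ∉ P.Γ ∧ P.ξ a - P.ξ b - P.η ∉ P.Γ)

include hω in
theorem differentiable_gr (c : ℤ) (i j : Fin 2) (v w : (Fin N → Fin 2) → ℂ) :
    Differentiable ℂ fun l => v ⬝ᵥ (P.gr c i j l *ᵥ w) := by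
  simp only [dotProduct, mulVec]
  refine Differentiable.fun_sum fun h _ => (Differentiable.fun_sum fun k _ => ?_).const_mul _
  exact (differentiable_monoEntry hω i j _ h k).mul_const _

include hω hη ht₀ hξ

theorem sb_vecMul {h : Fin N → Fin 2} {a : Fin N} (ha : h a = 0) :
    P.sb h ᵥ* P.gr 0 1 0 (P.ξ a) = P.dProd (P.ξ a - P.η) • P.sb (Function.update h a 1) := by
  rw [sb_update hω ht₀ hξ ha, smul_inv_smul₀ (dProd_ne_zero hω hη hξ a)]

theorem mulVec_sk {h : Fin N → Fin 2} {a : Fin N} (ha : h a = 1) :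
    P.gr 0 1 0 (P.ξ a - P.η) *ᵥ P.sk h = P.dProd (P.ξ a - P.η) • P.sk (Function.update h a 0) := by
  rw [sk_update hω ht₀ hξ ha, smul_inv_smul₀ (dProd_ne_zero hω hη hξ a)]

theorem sb_vecMul_tm (κ : ℂ) {h : Fin N → Fin 2} {a : Fin N} (ha : h a = 0) :
    P.sb h ᵥ* P.tm κ (P.ξ a) = (κ * P.dProd (P.ξ a - P.η)) • P.sb (Function.update h a 1) := by
  rw [tm, Matrix.vecMul_add, Matrix.vecMul_smul, Matrix.vecMul_smul,
    (vecMul_sb_eq_zero hω ht₀ hξ h a ha).2, sb_vecMul hω hη ht₀ hξ ha, smul_zero, zero_add, mul_smul]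

theorem tm_mulVec_sk (κ : ℂ) {h : Fin N → Fin 2} {a : Fin N} (ha : h a = 1) :
    P.tm κ (P.ξ a - P.η) *ᵥ P.sk h
      = (κ * P.dProd (P.ξ a - P.η)) • P.sk (Function.update h a 0) := by
  rw [tm, Matrix.add_mulVec, Matrix.smul_mulVec, Matrix.smul_mulVec,
    (mulVec_sk_eq_zero hω ht₀ hξ h a ha).2, mulVec_sk hω hη ht₀ hξ ha, smul_zero, zero_add, mul_smul]

omit hη in
-- The factor `C(ξ_a)` of the bra can be placed last, where it meets `C(ξ_a - η)` and fusion gives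
-- zero.
theorem sb_vecMul_eq_zero {h : Fin N → Fin 2} {a : Fin N} (ha : h a = 1) :
    P.sb h ᵥ* P.gr 0 1 0 (P.ξ a - P.η) = 0 := by
  have h1 : Function.update (Function.update h a 0) a 1 = h := by
    rw [Function.update_idem, ← ha, Function.update_eq_self]
  rw [← h1, sb_update hω ht₀ hξ (Function.update_self _ _ _), Matrix.smul_vecMul,
    Matrix.vecMul_vecMul, (gr_mul_gr_same hω ht₀ 0 a).1, Matrix.vecMul_zero, smul_zero]

omit hη in
theorem mulVec_sk_eq_zero_of_zero {h : Fin N → Fin 2} {a : Fin N} (ha : h a = 0) :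
    P.gr 0 1 0 (P.ξ a) *ᵥ P.sk h = 0 := by
  have h1 : Function.update (Function.update h a 1) a 0 = h := by
    rw [Function.update_idem, ← ha, Function.update_eq_self]
  rw [← h1, sk_update hω ht₀ hξ (Function.update_self _ _ _), Matrix.mulVec_smul,
    Matrix.mulVec_mulVec, (gr_mul_gr_same hω ht₀ 0 a).1, Matrix.zero_mulVec, smul_zero]

omit hη in
/-- The states of separate variables are orthogonal. -/
theorem sb_dotProduct_sk_of_ne {h k : Fin N → Fin 2} (hk : h ≠ k) : P.sb h ⬝ᵥ P.sk k = 0 := by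
  -- If such a site exists, fusion annihilates the pairing. Otherwise `h ≤ k` at every site, so the
  -- numbers of down spins differ and the supports are disjoint.
  by_cases hc : ∃ a, h a = 1 ∧ k a = 0
  · obtain ⟨a, ha, ka⟩ := hc
    have h1 : Function.update (Function.update k a 1) a 0 = k := by
      rw [Function.update_idem, ← ka, Function.update_eq_self]
    rw [← h1, sk_update hω ht₀ hξ (Function.update_self _ _ _), dotProduct_smul,
      dotProduct_mulVec, sb_vecMul_eq_zero hω ht₀ hξ ha, zero_dotProduct, smul_zero]
  · push Not at hc
    refine Finset.sum_eq_zero fun g _ => ?_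
    by_contra hg
    have e1 := numDown_of_sb_ne_zero hω ht₀ hξ h g (left_ne_zero_of_mul hg)
    have e2 := numDown_of_sk_ne_zero hω ht₀ hξ k g (right_ne_zero_of_mul hg)
    have hle : ∀ n, (h n : ℕ) ≤ (k n : ℕ) := by
      intro n
      have := hc n
      generalize h n = x, k n = y at this
      revert x y
      decide
    obtain ⟨a, ha⟩ := Function.ne_iff.1 hk
    have hlt : numDown h < numDown k := Finset.sum_lt_sum (fun n _ => hle n)
      ⟨a, Finset.mem_univ a, lt_of_le_of_ne (hle a) fun e => ha (Fin.ext e)⟩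
    omega

/-- Flipping a site is a transfer matrix at `ξ_a`, which is invertible because its product with the
one at `ξ_a - η` is a nonzero scalar; the twist `1` suffices here. -/
theorem sb_ne_zero (h : Fin N → Fin 2) : P.sb h ≠ 0 := by
  induction h using config_induction with
  | h0 =>
    rw [sb_zero]
    intro hc
    have := congrFun hc fun _ => 0
    simp at this
  | hs h a ha ih =>
    intro hc
    have h1 := sb_vecMul_tm hω hη ht₀ hξ 1 ha
    rw [hc, smul_zero] at h1
    have h2 := congrArg (P.sb h ᵥ* ·) (tm_mul_tm hω ht₀ one_ne_zero a)
    simp only [← Matrix.vecMul_vecMul, h1, Matrix.zero_vecMul, Matrix.vecMul_smul,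
      Matrix.vecMul_one] at h2
    exact smul_ne_zero (mul_ne_zero (axy_ne_zero hω hη hξ a) (dProd_ne_zero hω hη hξ a)) ih h2.symm

omit hω hη ht₀ in
theorem ξh_sub_not_mem_Γ (h : Fin N → Fin 2) (a b : Fin N) (hab : a ≠ b) :
    P.ξh a (h a) - P.ξbar - (P.ξh b (h b) - P.ξbar) ∉ P.Γ := by
  rw [sub_sub_sub_cancel_right, ξh, ξh]
  obtain ⟨h1, h2, h3⟩ := hξ a b hab
  generalize h a = x, h b = y
  fin_cases x <;> fin_cases y
  · simpa using h1
  · simpa [sub_add] using h2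
  · simpa [sub_right_comm] using h3
  · simpa using h1

omit hω hη hξ in
-- The centering makes the sum equal to `-(t₀ + η |h|)`, so the exceptional case of the
-- interpolation is excluded by the genericity of the heights.
theorem sum_ξh_not_mem_Γ (hN : 1 ≤ N) (h : Fin N → Fin 2) :
    ∑ a, (P.ξh a (h a) - P.ξbar) ∉ P.Γ := by
  have hN' : (N : ℂ) ≠ 0 := by exact_mod_cast (by omega : N ≠ 0)
  have hb : (N : ℂ) * P.ξbar = ∑ k, P.ξ k + P.t₀ := by
    rw [ξbar]
    field_simp
  have : ∑ a, (P.ξh a (h a) - P.ξbar) = -(P.t₀ + P.η * (numDown h : ℤ)) := by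
    simp only [ξh, Finset.sum_sub_distrib, ← Finset.mul_sum, Finset.sum_const, Finset.card_univ,
      Fintype.card_fin, nsmul_eq_mul, hb, numDown]
    push_cast
    ring
  rw [this]
  exact fun hc => ht₀ _ (neg_mem_Γ_iff.1 hc)

omit hη in
theorem det_Θ_ne_zero (hN : 1 ≤ N) (h : Fin N → Fin 2) : (P.Θ h).det ≠ 0 :=
  det_vartheta_ne_zero hω (ξh_sub_not_mem_Γ hξ h) (sum_ξh_not_mem_Γ ht₀ hN h)

/-- The matrix element of `C` between the bra of `h` and the ket of the flipped configuration is
evaluated at `ξ_a`, where `C` flips the bra, and at `ξ_a - η`, where it flips the ket back. Theta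
interpolation relates the two values. -/
theorem sb_dotProduct_sk_update (hN : 1 ≤ N) {h : Fin N → Fin 2} {a : Fin N} (ha : h a = 0) :
    Complex.exp (-(Complex.I * P.yc * P.η)) * (P.sb h ⬝ᵥ P.sk h) * (P.Θ h).det
      = P.sb (Function.update h a 1) ⬝ᵥ P.sk (Function.update h a 1)
        * (P.Θ (Function.update h a 1)).det := by
  set k := Function.update h a 1 with hk
  have hka : k a = 1 := Function.update_self _ _ _
  have hkh : Function.update k a 0 = h := by
    rw [hk, Function.update_idem, ← ha, Function.update_eq_self]
  -- The exponential prefactor removes the `y`-dependent multipliers of `C`, so that `g` has exactly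
  -- the quasi-periods of the `ϑ_j`.
  set g : ℂ → ℂ := fun z => Complex.exp (Complex.I * P.yc * (z + P.ξbar))
    * (P.sb h ⬝ᵥ (P.gr 0 1 0 (z + P.ξbar) *ᵥ P.sk k)) with hg
  have key := mul_det_vartheta_eq (P := P) (g := g) (x := fun b => P.ξh b (h b) - P.ξbar) hω
    ?_ ?_ ?_ (ξh_sub_not_mem_Γ hξ h) (sum_ξh_not_mem_Γ ht₀ hN h) a ?_ (P.ξh a 1 - P.ξbar)
  · have h1 : (Matrix.of fun i j => P.vartheta j (Function.update (fun b => P.ξh b (h b) - P.ξbar) a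
        (P.ξh a 1 - P.ξbar) i)) = P.Θ k := by
      ext i j
      simp only [Θ, Matrix.of_apply]
      by_cases hi : i = a
      · subst hi
        simp [hk]
      · simp [hk, hi]
    have h2 : g (P.ξh a 1 - P.ξbar) = Complex.exp (Complex.I * P.yc * (P.ξ a - P.η))
        * (P.dProd (P.ξ a - P.η) * (P.sb h ⬝ᵥ P.sk h)) := by
      have h3 : P.ξh a 1 = P.ξ a - P.η := by simp [ξh]
      simp only [hg, sub_add_cancel, h3]
      rw [mulVec_sk hω hη ht₀ hξ hka, dotProduct_smul, hkh, smul_eq_mul]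
    have h4 : g (P.ξh a (h a) - P.ξbar) = Complex.exp (Complex.I * P.yc * P.ξ a)
        * (P.dProd (P.ξ a - P.η) * (P.sb k ⬝ᵥ P.sk k)) := by
      have h3 : P.ξh a 0 = P.ξ a := by simp [ξh]
      simp only [hg, sub_add_cancel, ha, h3]
      rw [dotProduct_mulVec, sb_vecMul hω hη ht₀ hξ ha, smul_dotProduct, ← hk, smul_eq_mul]
    have h5 := dProd_ne_zero hω hη hξ a
    have h6 := Complex.exp_ne_zero (Complex.I * P.yc * P.ξ a)
    have h7 : Complex.exp (Complex.I * P.yc * (P.ξ a - P.η))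
        = Complex.exp (Complex.I * P.yc * P.ξ a) * Complex.exp (-(Complex.I * P.yc * P.η)) := by
      rw [← Complex.exp_add]
      ring_nf
    rw [h1, h2, h4, h7] at key
    refine mul_left_cancel₀ (mul_ne_zero h6 h5) ?_
    change _ * (P.Θ h).det = _ at key
    linear_combination key
  · exact (by fun_prop : Differentiable ℂ fun z => Complex.exp (Complex.I * P.yc * (z + P.ξbar))).mul
      ((differentiable_gr hω 0 1 0 (P.sb h) (P.sk k)).comp
        (by fun_prop : Differentiable ℂ fun z => z + P.ξbar))
  · intro z
    simp only [hg, add_right_comm z (_ : ℂ) P.ξbar, gr_add_pi, Matrix.smul_mulVec, dotProduct_smul, smul_eq_mul]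
    have h7 : Complex.exp (Complex.I * P.yc * (z + P.ξbar + Real.pi))
        * Complex.exp (-(Complex.I * P.yc * Real.pi)) = Complex.exp (Complex.I * P.yc * (z + P.ξbar)) := by
      rw [← Complex.exp_add]
      ring_nf
    linear_combination (-1) ^ N * (P.sb h ⬝ᵥ (P.gr 0 1 0 (z + P.ξbar) *ᵥ P.sk k)) * h7
  · intro z
    simp only [hg, add_right_comm z (_ : ℂ) P.ξbar, gr_add_pi_mul hN, Matrix.smul_mulVec, dotProduct_smul,
      smul_eq_mul]
    have h7 : Complex.exp (Complex.I * P.yc * (z + P.ξbar + Real.pi * P.ω))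
        * Complex.exp (-(Complex.I * P.yc * Real.pi * P.ω) - 2 * Complex.I * N * (z + P.ξbar - P.ξbar)
          - Complex.I * Real.pi * N * P.ω)
        = Complex.exp (-2 * Complex.I * N * z - Complex.I * Real.pi * N * P.ω)
          * Complex.exp (Complex.I * P.yc * (z + P.ξbar)) := by
      rw [← Complex.exp_add, ← Complex.exp_add]
      ring_nf
    linear_combination (-1) ^ N * (P.sb h ⬝ᵥ (P.gr 0 1 0 (z + P.ξbar) *ᵥ P.sk k)) * h7
  -- Every other site gives one zero: at `ξ_b` the ket is killed if `h b = 0`, and at `ξ_b - η` the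
  -- bra is killed if `h b = 1`.
  · intro b hba
    simp only [hg, sub_add_cancel]
    refine mul_eq_zero_of_right _ ?_
    by_cases hb0 : h b = 0
    · have h3 : P.ξh b 0 = P.ξ b := by simp [ξh]
      rw [hb0, h3, mulVec_sk_eq_zero_of_zero hω ht₀ hξ, dotProduct_zero]
      rw [hk, Function.update_of_ne hba, hb0]
    · have hb1 : h b = 1 := by
        generalize h b = x at hb0
        revert x
        decide
      have h3 : P.ξh b 1 = P.ξ b - P.η := by simp [ξh]
      rw [hb1, h3, dotProduct_mulVec, sb_vecMul_eq_zero hω ht₀ hξ hb1, zero_dotProduct]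

end Generic

end SOSModel


/-! ### Completeness, eigenvectors and transport of heights -/

namespace SOSModel

open Matrix

variable {N : ℕ}

theorem prod_pow_update (f : Fin N → ℂ) {h : Fin N → Fin 2} {a : Fin N} (ha : h a = 0) :
    ∏ b, f b ^ (Function.update h a 1 b : ℕ) = f a * ∏ b, f b ^ (h b : ℕ) := by
  rw [← Finset.mul_prod_erase _ _ (Finset.mem_univ a),
    ← Finset.mul_prod_erase _ (fun b => f b ^ (h b : ℕ)) (Finset.mem_univ a), ha]
  rw [Finset.prod_congr rfl fun n hn => by rw [Function.update_of_ne (Finset.ne_of_mem_erase hn)]]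
  simp

section Generic

variable {P : SOSModel N} (hω : 0 < P.ω.im) (hη : P.η ∉ P.Γ) (ht₀ : ∀ k : ℤ, P.t₀ + P.η * k ∉ P.Γ)
  (hξ : ∀ a b : Fin N, a ≠ b →
      P.ξ a - P.ξ b ∉ P.Γ ∧ P.ξ a - P.ξ b + P.η ∉ P.Γ ∧ P.ξ a - P.ξ b - P.η ∉ P.Γ)
  (hN : 1 ≤ N)

include hω hη ht₀ hξ hN

theorem sb_dotProduct_sk (h : Fin N → Fin 2) :
    P.sb h ⬝ᵥ P.sk h * (P.Θ h).det = Complex.exp (-(Complex.I * P.yc * P.η)) ^ numDown h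
      * (P.sb (fun _ => 0) ⬝ᵥ P.sk (fun _ => 0) * (P.Θ fun _ => 0).det) := by
  induction h using config_induction with
  | h0 => rw [numDown_zero, pow_zero, one_mul]
  | hs h a ha ih =>
    rw [← sb_dotProduct_sk_update hω hη ht₀ hξ hN ha, mul_assoc, ih, numDown_update_one ha]
    ring

/-- Otherwise the pairing at the configuration with all spins down would vanish as well. Its ket is
a basis vector and its bra is supported on that configuration alone, so the bra would be zero. -/
theorem sb_zero_dotProduct_sk_zero_ne_zero :
    P.sb (fun _ => 0) ⬝ᵥ P.sk (fun _ => 0) ≠ 0 := by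
  intro hc
  have h1 := sb_dotProduct_sk hω hη ht₀ hξ hN fun _ => 1
  rw [hc, zero_mul, mul_zero, sk_one] at h1
  have h2 := (mul_eq_zero.1 h1).resolve_right (det_Θ_ne_zero hω ht₀ hξ hN _)
  refine sb_ne_zero hω hη ht₀ hξ (fun _ => 1) (funext fun k => ?_)
  by_contra hk
  have h3 := numDown_of_sb_ne_zero hω ht₀ hξ _ k hk
  rw [numDown_one] at h3
  rw [eq_const_one_of_numDown h3] at hk
  simp at h2
  exact hk h2

theorem sb_dotProduct_sk_ne_zero (h : Fin N → Fin 2) : P.sb h ⬝ᵥ P.sk h ≠ 0 := by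
  have h1 := sb_dotProduct_sk hω hη ht₀ hξ hN h
  intro hc
  rw [hc, zero_mul] at h1
  exact mul_ne_zero (pow_ne_zero _ (Complex.exp_ne_zero _))
    (mul_ne_zero (sb_zero_dotProduct_sk_zero_ne_zero hω hη ht₀ hξ hN) (det_Θ_ne_zero hω ht₀ hξ hN _))
    h1.symm

/-- Biorthogonality as an identity of square matrices: the one-sided inverse is two-sided, which
yields completeness of both families. -/
theorem sb_mul_sk :
    (Matrix.of fun h k => (P.sb h ⬝ᵥ P.sk h)⁻¹ * P.sb h k) * (Matrix.of fun k h => P.sk h k) = 1 := by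
  ext h k
  have h1 : ((Matrix.of fun h k => (P.sb h ⬝ᵥ P.sk h)⁻¹ * P.sb h k)
      * (Matrix.of fun k h => P.sk h k)) h k = (P.sb h ⬝ᵥ P.sk h)⁻¹ * (P.sb h ⬝ᵥ P.sk k) := by
    simp [Matrix.mul_apply, dotProduct, Finset.mul_sum, mul_assoc]
  rw [h1]
  by_cases hk : h = k
  · subst hk
    rw [inv_mul_cancel₀ (sb_dotProduct_sk_ne_zero hω hη ht₀ hξ hN h), Matrix.one_apply_eq]
  · rw [sb_dotProduct_sk_of_ne hω ht₀ hξ hk, mul_zero, Matrix.one_apply_ne hk]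

/-- Completeness of the kets of separate variables. -/
theorem eq_zero_of_dotProduct_sk {φ : (Fin N → Fin 2) → ℂ} (hφ : ∀ h, φ ⬝ᵥ P.sk h = 0) : φ = 0 := by
  have h1 : φ ᵥ* (Matrix.of fun k h => P.sk h k) = 0 := funext fun h => hφ h
  rw [← Matrix.vecMul_one φ, ← mul_eq_one_comm.1 (sb_mul_sk hω hη ht₀ hξ hN),
    ← Matrix.vecMul_vecMul, h1, Matrix.zero_vecMul]

/-- Completeness of the bras of separate variables. -/
theorem eq_zero_of_sb_dotProduct {ψ : (Fin N → Fin 2) → ℂ} (hψ : ∀ h, P.sb h ⬝ᵥ ψ = 0) : ψ = 0 := by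
  have h1 : (Matrix.of fun h k => (P.sb h ⬝ᵥ P.sk h)⁻¹ * P.sb h k) *ᵥ ψ = 0 := by
    funext h
    have := congrArg ((P.sb h ⬝ᵥ P.sk h)⁻¹ * ·) (hψ h)
    simpa [mulVec, dotProduct, Finset.mul_sum, mul_assoc] using this
  rw [← Matrix.one_mulVec ψ, ← mul_eq_one_comm.1 (sb_mul_sk hω hη ht₀ hξ hN),
    ← Matrix.mulVec_mulVec, h1, Matrix.mulVec_zero]

/-! ### Eigenvectors of the transfer matrix -/

section Eigen

variable {κ : ℂ} (hκ : κ ≠ 0) {t : ℂ → ℂ}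
include hκ

omit hη hξ hN in
-- The fusion identity applied to an eigenvector. It makes the two quotients in `IsCoeff` agree.
theorem eigenvalue_mul_of_left {φ : (Fin N → Fin 2) → ℂ} (hφ0 : φ ≠ 0)
    (hφ : ∀ l, φ ᵥ* P.tm κ l = t l • φ) (a : Fin N) :
    t (P.ξ a) * t (P.ξ a - P.η) = P.axy (P.ξ a) * P.dProd (P.ξ a - P.η) := by
  have h1 := congrArg (φ ᵥ* ·) (tm_mul_tm hω ht₀ hκ a)
  simp only [← Matrix.vecMul_vecMul, hφ, Matrix.smul_vecMul, smul_smul, Matrix.vecMul_smul,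
    Matrix.vecMul_one] at h1
  exact smul_left_injective ℂ hφ0 h1

omit hη hξ hN in
theorem eigenvalue_mul_of_right {ψ : (Fin N → Fin 2) → ℂ} (hψ0 : ψ ≠ 0)
    (hψ : ∀ l, P.tm κ l *ᵥ ψ = t l • ψ) (a : Fin N) :
    t (P.ξ a) * t (P.ξ a - P.η) = P.axy (P.ξ a) * P.dProd (P.ξ a - P.η) := by
  have h1 := congrArg (· *ᵥ ψ) (tm_mul_tm hω ht₀ hκ a)
  simp only [← Matrix.mulVec_mulVec, hψ, Matrix.mulVec_smul, smul_smul, Matrix.smul_mulVec,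
    Matrix.one_mulVec] at h1
  rw [mul_comm]
  exact smul_left_injective ℂ hψ0 h1

omit hN in
-- The transfer matrix at `ξ_a - η` lowers `h_a` on the kets, so each flip costs `κ 𝖽(ξ_a - η) /
-- t(ξ_a - η)`; `ht` rewrites this quotient with `t(ξ_a)`.
theorem left_eigenvector_dotProduct_sk {φ : (Fin N → Fin 2) → ℂ}
    (hφ : ∀ l, φ ᵥ* P.tm κ l = t l • φ)
    (ht : ∀ a, t (P.ξ a) * t (P.ξ a - P.η) = P.axy (P.ξ a) * P.dProd (P.ξ a - P.η))
    (h : Fin N → Fin 2) :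
    φ ⬝ᵥ P.sk h = (∏ a, (κ * (t (P.ξ a) / P.axy (P.ξ a))) ^ (h a : ℕ)) * (φ ⬝ᵥ P.sk fun _ => 0) := by
  induction h using config_induction with
  | h0 => simp
  | hs h a ha ih =>
    rw [prod_pow_update _ ha, mul_assoc, ← ih]
    have h1 := tm_mulVec_sk hω hη ht₀ hξ κ (h := Function.update h a 1) (a := a)
      (Function.update_self _ _ _)
    rw [Function.update_idem, ← ha, Function.update_eq_self] at h1
    have h2 := congrArg (φ ⬝ᵥ ·) h1
    simp only [dotProduct_mulVec, hφ, smul_dotProduct, dotProduct_smul, smul_eq_mul] at h2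
    have h3 := axy_ne_zero hω hη hξ a
    have h4 := dProd_ne_zero hω hη hξ a
    have h5 : t (P.ξ a - P.η) ≠ 0 := fun hc => mul_ne_zero h3 h4 (by rw [← ht a, hc, mul_zero])
    refine mul_left_cancel₀ h5 ?_
    rw [h2, mul_assoc, mul_assoc]
    field_simp
    linear_combination -(φ ⬝ᵥ P.sk h) * ht a

omit hN in
theorem sb_dotProduct_right_eigenvector {ψ : (Fin N → Fin 2) → ℂ}
    (hψ : ∀ l, P.tm κ l *ᵥ ψ = t l • ψ) (h : Fin N → Fin 2) :
    P.sb h ⬝ᵥ ψ = (∏ a, (κ⁻¹ * (t (P.ξ a) / P.dProd (P.ξ a - P.η))) ^ (h a : ℕ))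
      * (P.sb (fun _ => 0) ⬝ᵥ ψ) := by
  induction h using config_induction with
  | h0 => simp
  | hs h a ha ih =>
    rw [prod_pow_update _ ha, mul_assoc, ← ih]
    have h2 := congrArg (· ⬝ᵥ ψ) (sb_vecMul_tm hω hη ht₀ hξ κ ha)
    simp only [← dotProduct_mulVec, hψ, smul_dotProduct, dotProduct_smul, smul_eq_mul] at h2
    have h4 := dProd_ne_zero hω hη hξ a
    field_simp
    linear_combination -h2

end Eigen

end Generic

/-! ### Heights -/

/-- The height at a site, in units of `η` and relative to `t₀`. -/
def siteHeight (n : ℕ) (h : Fin N → Fin 2) : ℤ :=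
  numDown h + n - 2 * ((∑ k ∈ Finset.univ.filter fun k : Fin N => (k : ℕ) < n, (h k : ℕ) : ℕ) : ℤ)

theorem siteHeight_zero (h : Fin N → Fin 2) : siteHeight 0 h = numDown h := by
  simp [siteHeight]

theorem filter_lt_succ {n : ℕ} (hn : n < N) :
    (Finset.univ.filter fun k : Fin N => (k : ℕ) < n + 1)
      = insert ⟨n, hn⟩ (Finset.univ.filter fun k : Fin N => (k : ℕ) < n) := by
  ext k
  simp [Fin.ext_iff]
  omega

/-- At the inhomogeneity parameter of a site, the transfer matrix transports the heights. -/
theorem siteHeight_of_tm_ne_zero {P : SOSModel N} (hω : 0 < P.ω.im) (hη : P.η ∉ P.Γ)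
    (ht₀ : ∀ k : ℤ, P.t₀ + P.η * k ∉ P.Γ) {κ : ℂ} {n : ℕ} (hn : n < N) {h k : Fin N → Fin 2}
    (hne : P.tm κ (P.ξ ⟨n, hn⟩) h k ≠ 0) : siteHeight (n + 1) h = siteHeight n k := by
  have key : ∀ i j : Fin 2, (i : ℕ) + (j : ℕ) = 1 → P.gr 0 i j (P.ξ ⟨n, hn⟩) h k ≠ 0 →
      siteHeight (n + 1) h = siteHeight n k := by
    intro i j hij hg
    have h1 : (i : ℕ) + numDown h = (j : ℕ) + numDown k := by
      by_contra hc
      exact hg (monoEntry_eq_zero hc)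
    have h2 := heights_of_monoEntry_ne_zero (P.θ_ne_zero hω hη) (regular_ht hω ht₀ 0 h) hg
    simp only [Fin.lt_def] at h2
    rw [siteHeight, siteHeight, filter_lt_succ hn, Finset.sum_insert (by simp)]
    -- Since `i + j = 1`, the global change of the number of down spins compensates the local change
    -- at site `n`.
    omega
  by_cases h1 : P.gr 0 0 1 (P.ξ ⟨n, hn⟩) h k = 0
  · by_cases h2 : P.gr 0 1 0 (P.ξ ⟨n, hn⟩) h k = 0
    · exact absurd (by simp [tm, h1, h2]) hne
    · exact key 1 0 rfl h2
  · exact key 0 1 rfl h1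

/-- Let `P_n` project on a value of the height at site `n`, and let `T` be the transfer matrix at
`ξ_n`. Then `P_{n+1} T = T P_n`, so `t'(ξ_n) ⟨φ|P_{n+1}|ψ⟩ = ⟨φ|T P_n|ψ⟩ = t(ξ_n) ⟨φ|P_n|ψ⟩`. -/
theorem dotProduct_siteHeight {P : SOSModel N} (hω : 0 < P.ω.im) (hη : P.η ∉ P.Γ)
    (ht₀ : ∀ k : ℤ, P.t₀ + P.η * k ∉ P.Γ) {κ : ℂ} {t t' : ℂ → ℂ} {φ ψ : (Fin N → Fin 2) → ℂ}
    (hφ : ∀ l, φ ᵥ* P.tm κ l = t l • φ) (hψ : ∀ l, P.tm κ l *ᵥ ψ = t' l • ψ)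
    (ht' : ∀ a, t' (P.ξ a) ≠ 0) (m : ℤ) {n : ℕ} (hn : n ≤ N) :
    ∑ h, φ h * (if siteHeight n h = m then ψ h else 0)
      = (∏ b ∈ Finset.univ.filter fun b : Fin N => (b : ℕ) < n, t (P.ξ b) / t' (P.ξ b))
        * ∑ h, φ h * (if siteHeight 0 h = m then ψ h else 0) := by
  induction n with
  | zero => simp
  | succ n ih =>
    have ih := ih (by omega)
    have hn' : n < N := by omega
    rw [filter_lt_succ hn', Finset.prod_insert (by simp), mul_assoc, ← ih, div_mul_eq_mul_div,
      eq_div_iff (ht' _)]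
    set x := P.ξ ⟨n, hn'⟩ with hx
    have h1 : ∀ h, ψ h * t' x = ∑ k, P.tm κ x h k * ψ k := fun h => by
      have := congrFun (hψ x) h
      simp only [Pi.smul_apply, smul_eq_mul] at this
      rw [mul_comm, ← this]
      rfl
    have h2 : ∀ k, t x * φ k = ∑ h, φ h * P.tm κ x h k := fun k => by
      have := congrFun (hφ x) k
      simp only [Pi.smul_apply, smul_eq_mul] at this
      rw [← this]
      rfl
    calc (∑ h, φ h * (if siteHeight (n + 1) h = m then ψ h else 0)) * t' x
        = ∑ h, ∑ k, φ h * P.tm κ x h k * (if siteHeight n k = m then ψ k else 0) := by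
          rw [Finset.sum_mul]
          refine Finset.sum_congr rfl fun h _ => ?_
          have h3 : (if siteHeight (n + 1) h = m then ψ h else 0) * t' x
              = ∑ k, P.tm κ x h k * (if siteHeight n k = m then ψ k else 0) := by
            have h4 : ∀ k, P.tm κ x h k * (if siteHeight n k = m then ψ k else 0)
                = if siteHeight (n + 1) h = m then P.tm κ x h k * ψ k else 0 := by
              intro k
              by_cases hk : P.tm κ x h k = 0
              · simp [hk]
              · rw [siteHeight_of_tm_ne_zero hω hη ht₀ hn' hk, mul_ite, mul_zero]
            rw [ite_mul, zero_mul, h1]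
            simp only [h4]
            split_ifs
            · rfl
            · rw [Finset.sum_const_zero]
          simp only [mul_assoc, h3, Finset.mul_sum]
      _ = t x * ∑ k, φ k * (if siteHeight n k = m then ψ k else 0) := by
          rw [Finset.sum_comm, Finset.mul_sum]
          refine Finset.sum_congr rfl fun k _ => ?_
          rw [← mul_assoc, h2, Finset.sum_mul]

end SOSModel


/-! ### Multilinear expansion and roots of unity -/

theorem Matrix.det_of_sum_smul {R ι κ : Type*} [CommRing R] [Fintype ι] [DecidableEq ι] [Fintype κ]
    (c : ι → κ → R) (v : ι → κ → ι → R) :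
    (Matrix.of fun i j => ∑ k, c i k * v i k j).det
      = ∑ r : ι → κ, (∏ i, c i (r i)) * (Matrix.of fun i j => v i (r i) j).det := by
  classical
  have h1 : (Matrix.of fun i j => ∑ k, c i k * v i k j) = fun i => ∑ k, c i k • v i k := by
    ext i j
    simp [Finset.sum_apply]
  have h2 := (Matrix.detRowAlternating (n := ι) (R := R)).toMultilinearMap.map_sum
    fun i k => c i k • v i k
  rw [h1]
  refine h2.trans (Finset.sum_congr rfl fun r _ => ?_)
  exact (Matrix.detRowAlternating (n := ι) (R := R)).toMultilinearMap.map_smul_univ _ _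

/-- Orthogonality of the roots of unity. -/
theorem Complex.sum_exp_eq_ite {N k m : ℕ} (hk : k ≤ N) (hm : m ≤ N) :
    1 / ((N : ℂ) + 1) * ∑ j ∈ Finset.range (N + 1),
      Complex.exp (2 * Real.pi * Complex.I * ((k : ℂ) - m) / (N + 1)) ^ j = if k = m then 1 else 0 := by
  have hN : (N : ℂ) + 1 ≠ 0 := Nat.cast_add_one_ne_zero N
  split_ifs with h
  · simp [h, hN]
  · have h1 : Complex.exp (2 * Real.pi * Complex.I * ((k : ℂ) - m) / (N + 1)) ≠ 1 := by
      intro hc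
      obtain ⟨n, hn⟩ := Complex.exp_eq_one_iff.1 hc
      have h2 : (k : ℂ) - m = n * (N + 1) := by
        have := Complex.two_pi_I_ne_zero
        field_simp at hn
        linear_combination hn
      have h3 : (k : ℤ) - m = n * (N + 1) := by exact_mod_cast h2
      have h4 : n = 0 := by
        by_contra hn0
        rcases lt_or_gt_of_ne hn0 with h5 | h5 <;> nlinarith
      rw [h4] at h3
      omega
    rw [geom_sum_eq h1, ← Complex.exp_nat_mul]
    have h2 : Complex.exp ((N + 1 : ℕ) * (2 * Real.pi * Complex.I * ((k : ℂ) - m) / (N + 1))) = 1 := by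
      rw [Complex.exp_eq_one_iff]
      refine ⟨(k : ℤ) - m, ?_⟩
      push_cast
      field_simp
    rw [h2]
    simp

/-! ### Separate states and their matrix elements -/

namespace SOSModel

open Matrix

variable {N : ℕ}

theorem prod_const_pow (x : ℂ) (h : Fin N → Fin 2) : ∏ a, x ^ (h a : ℕ) = x ^ numDown h :=
  Finset.prod_pow_eq_pow_sum _ _ _

/-- The left separate state, on the space of states. -/
noncomputable def sepL (P : SOSModel N) (nrm κ : ℂ) (q : Fin N → Fin 2 → ℂ) : (Fin N → Fin 2) → ℂ :=
  ∑ h : Fin N → Fin 2,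
    ((∏ a, ((κ * Complex.exp (Complex.I * P.yc * P.η)) ^ (h a : ℕ) * q a (h a)))
      * (P.Θ h).det) • nrm⁻¹ • P.sb h

/-- The right separate state, on the space of states. -/
noncomputable def sepR (P : SOSModel N) (nrm κ : ℂ) (q : Fin N → Fin 2 → ℂ) : (Fin N → Fin 2) → ℂ :=
  ∑ h : Fin N → Fin 2,
    ((∏ a, ((κ⁻¹ * Complex.exp (Complex.I * P.yc * P.η)
        * (P.axy (P.ξ a) / P.dProd (P.ξ a - P.η))) ^ (h a : ℕ) * q a (h a)))
      * (P.Θ h).det) • nrm⁻¹ • P.sk h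

section Generic

variable {P : SOSModel N} (hω : 0 < P.ω.im) (hη : P.η ∉ P.Γ) (ht₀ : ∀ k : ℤ, P.t₀ + P.η * k ∉ P.Γ)
  (hξ : ∀ a b : Fin N, a ≠ b →
      P.ξ a - P.ξ b ∉ P.Γ ∧ P.ξ a - P.ξ b + P.η ∉ P.Γ ∧ P.ξ a - P.ξ b - P.η ∉ P.Γ)
  (hN : 1 ≤ N)

include hω hη ht₀ hξ hN

theorem exists_normalization : ∃ nrm : ℂ, nrm ≠ 0 ∧
    nrm⁻¹ * (nrm⁻¹ * (P.sb (fun _ => 0) ⬝ᵥ P.sk (fun _ => 0))) = 1 / (P.Θ fun _ => 0).det := by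
  have h1 := sb_zero_dotProduct_sk_zero_ne_zero hω hη ht₀ hξ hN
  have h2 := det_Θ_ne_zero hω ht₀ hξ hN fun _ => 0
  -- The constant enters both reference states, so its square is prescribed.
  obtain ⟨x, hx⟩ := IsAlgClosed.exists_pow_nat_eq
    (P.sb (fun _ => 0) ⬝ᵥ P.sk (fun _ => 0) * (P.Θ fun _ => 0).det) two_pos
  have hx0 : x ≠ 0 := by
    rintro rfl
    exact mul_ne_zero h1 h2 (by rw [← hx]; ring)
  refine ⟨x, hx0, ?_⟩
  field_simp
  rw [hx]

section Normalized

variable {nrm κ : ℂ}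
  (hnrm : nrm⁻¹ * (nrm⁻¹ * (P.sb (fun _ => 0) ⬝ᵥ P.sk (fun _ => 0))) = 1 / (P.Θ fun _ => 0).det)
include hnrm

theorem normalized_pairing (h : Fin N → Fin 2) :
    nrm⁻¹ * (nrm⁻¹ * (P.sb h ⬝ᵥ P.sk h)) * (P.Θ h).det
      = Complex.exp (-(Complex.I * P.yc * P.η)) ^ numDown h := by
  have h1 := sb_dotProduct_sk hω hη ht₀ hξ hN h
  have h2 := det_Θ_ne_zero hω ht₀ hξ hN fun _ => 0
  rw [eq_div_iff h2] at hnrm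
  linear_combination nrm⁻¹ * nrm⁻¹ * h1
    + Complex.exp (-(Complex.I * P.yc * P.η)) ^ numDown h * hnrm

theorem exp_pow_mul (h : Fin N → Fin 2) : Complex.exp (Complex.I * P.yc * P.η) ^ numDown h
    * (nrm⁻¹ * (nrm⁻¹ * (P.sb h ⬝ᵥ P.sk h)) * (P.Θ h).det) = 1 := by
  rw [normalized_pairing hω hη ht₀ hξ hN hnrm, ← mul_pow, ← Complex.exp_add, add_neg_cancel,
    Complex.exp_zero, one_pow]

/-- The factors `det Θ` and `exp(iyη)^{|h|}` in the separate state invert the pairing, so only a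
product over the sites remains. -/
theorem sepL_dotProduct_sk (q : Fin N → Fin 2 → ℂ) (h : Fin N → Fin 2) :
    P.sepL nrm κ q ⬝ᵥ (nrm⁻¹ • P.sk h) = ∏ a, (κ ^ (h a : ℕ) * q a (h a)) := by
  rw [sepL, sum_dotProduct, Finset.sum_eq_single h]
  · have h1 := exp_pow_mul hω hη ht₀ hξ hN hnrm h
    simp only [smul_dotProduct, dotProduct_smul, smul_eq_mul, mul_pow, Finset.prod_mul_distrib,
      prod_const_pow]
    linear_combination κ ^ numDown h * (∏ a, q a (h a)) * h1
  · intro k _ hk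
    simp [sb_dotProduct_sk_of_ne hω ht₀ hξ hk]
  · simp

theorem sb_dotProduct_sepR (q : Fin N → Fin 2 → ℂ) (h : Fin N → Fin 2) :
    (nrm⁻¹ • P.sb h) ⬝ᵥ P.sepR nrm κ q
      = ∏ a, ((κ⁻¹ * (P.axy (P.ξ a) / P.dProd (P.ξ a - P.η))) ^ (h a : ℕ) * q a (h a)) := by
  rw [sepR, dotProduct_sum, Finset.sum_eq_single h]
  · have h1 := exp_pow_mul hω hη ht₀ hξ hN hnrm h
    simp only [smul_dotProduct, dotProduct_smul, smul_eq_mul, mul_pow, Finset.prod_mul_distrib,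
      prod_const_pow]
    linear_combination κ⁻¹ ^ numDown h * (∏ a, q a (h a))
      * (∏ a, (P.axy (P.ξ a) / P.dProd (P.ξ a - P.η)) ^ (h a : ℕ)) * h1
  · intro k _ hk
    simp [sb_dotProduct_sk_of_ne hω ht₀ hξ hk.symm]
  · simp

omit hω hη ht₀ hξ hnrm in
/-- Coefficients with a prescribed product. -/
theorem exists_coeff {t : ℂ → ℂ} (hta : ∀ a, P.axy (P.ξ a) ≠ 0) (hd : ∀ a, P.dProd (P.ξ a - P.η) ≠ 0)
    (ht : ∀ a, t (P.ξ a) * t (P.ξ a - P.η) = P.axy (P.ξ a) * P.dProd (P.ξ a - P.η))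
    {c : ℂ} (hc : c ≠ 0) : ∃ q, P.IsCoeff t q ∧ ∏ a, q a 0 = c := by
  -- The coefficients are free up to one scale per site; the whole constant is put at the first
  -- site.
  refine ⟨fun a h => (if a = ⟨0, hN⟩ then c else 1) * (t (P.ξ a) / P.axy (P.ξ a)) ^ (h : ℕ), fun a => ?_, ?_⟩
  · have h1 : (if a = ⟨0, hN⟩ then c else 1) ≠ 0 := by
      split_ifs
      · exact hc
      · exact one_ne_zero
    have h2 : t (P.ξ a - P.η) ≠ 0 := fun e => mul_ne_zero (hta a) (hd a) (by rw [← ht a, e, mul_zero])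
    have h3 := hta a
    refine ⟨by simpa using h1, ?_, ?_⟩
    · simp only [Fin.val_one, Fin.val_zero, pow_one, pow_zero, mul_one]
      rw [mul_div_cancel_left₀ _ h1, div_eq_div_iff h3 h2, ht a, mul_comm]
    · simp only [Fin.val_one, Fin.val_zero, pow_one, pow_zero, mul_one]
      rw [mul_div_cancel_left₀ _ h1]
  · simp

omit hω hη ht₀ hξ hnrm hN in
theorem IsCoeff.eq_mul {t : ℂ → ℂ} {q : Fin N → Fin 2 → ℂ} (hq : P.IsCoeff t q) (a : Fin N) (h : Fin 2) :
    q a h = (t (P.ξ a) / P.axy (P.ξ a)) ^ (h : ℕ) * q a 0 := by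
  obtain ⟨h0, -, h1⟩ := hq a
  revert h
  simp [Fin.forall_fin_two, ← h1, h0]

/-- A left eigenvector is a separate state. -/
theorem exists_eq_sepL (hn0 : nrm ≠ 0) (hκ : κ ≠ 0) {t : ℂ → ℂ} {φ : (Fin N → Fin 2) → ℂ} (hφ0 : φ ≠ 0)
    (hφ : ∀ l, φ ᵥ* P.tm κ l = t l • φ) : ∃ q, P.IsCoeff t q ∧ φ = P.sepL nrm κ q := by
  have ht := eigenvalue_mul_of_left hω ht₀ hκ hφ0 hφ
  have hf := left_eigenvector_dotProduct_sk hω hη ht₀ hξ hκ hφ ht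
  have hc : nrm⁻¹ * (φ ⬝ᵥ P.sk fun _ => 0) ≠ 0 := by
    refine mul_ne_zero (inv_ne_zero hn0) fun hc => hφ0 (eq_zero_of_dotProduct_sk hω hη ht₀ hξ hN fun h => ?_)
    rw [hf, hc, mul_zero]
  obtain ⟨q, hq, hqc⟩ := exists_coeff hN (axy_ne_zero hω hη hξ) (dProd_ne_zero hω hη hξ) ht hc
  refine ⟨q, hq, ?_⟩
  rw [← sub_eq_zero]
  refine eq_zero_of_dotProduct_sk hω hη ht₀ hξ hN fun h => ?_
  have h1 := sepL_dotProduct_sk hω hη ht₀ hξ hN hnrm (κ := κ) q h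
  have h2 : ∏ a, (κ ^ (h a : ℕ) * q a (h a)) = nrm⁻¹ * (φ ⬝ᵥ P.sk h) := by
    rw [hf, mul_left_comm, ← hqc, ← Finset.prod_mul_distrib]
    refine Finset.prod_congr rfl fun a _ => ?_
    rw [hq.eq_mul, mul_pow, mul_assoc]
  rw [h2, dotProduct_smul, smul_eq_mul] at h1
  rw [sub_dotProduct, mul_left_cancel₀ (inv_ne_zero hn0) h1, sub_self]

/-- A right eigenvector is a separate state. -/
theorem exists_eq_sepR (hn0 : nrm ≠ 0) (hκ : κ ≠ 0) {t : ℂ → ℂ} {ψ : (Fin N → Fin 2) → ℂ} (hψ0 : ψ ≠ 0)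
    (hψ : ∀ l, P.tm κ l *ᵥ ψ = t l • ψ) : ∃ q, P.IsCoeff t q ∧ ψ = P.sepR nrm κ q := by
  have ht := eigenvalue_mul_of_right hω ht₀ hκ hψ0 hψ
  have hf := sb_dotProduct_right_eigenvector hω hη ht₀ hξ hκ hψ
  have hc : nrm⁻¹ * (P.sb (fun _ => 0) ⬝ᵥ ψ) ≠ 0 := by
    refine mul_ne_zero (inv_ne_zero hn0) fun hc => hψ0 (eq_zero_of_sb_dotProduct hω hη ht₀ hξ hN fun h => ?_)
    rw [hf, hc, mul_zero]
  obtain ⟨q, hq, hqc⟩ := exists_coeff hN (axy_ne_zero hω hη hξ) (dProd_ne_zero hω hη hξ) ht hc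
  refine ⟨q, hq, ?_⟩
  rw [← sub_eq_zero]
  refine eq_zero_of_sb_dotProduct hω hη ht₀ hξ hN fun h => ?_
  have h1 := sb_dotProduct_sepR hω hη ht₀ hξ hN hnrm (κ := κ) q h
  have h2 : ∏ a, ((κ⁻¹ * (P.axy (P.ξ a) / P.dProd (P.ξ a - P.η))) ^ (h a : ℕ) * q a (h a))
      = nrm⁻¹ * (P.sb h ⬝ᵥ ψ) := by
    rw [hf, mul_left_comm, ← hqc, ← Finset.prod_mul_distrib]
    refine Finset.prod_congr rfl fun a _ => ?_
    rw [hq.eq_mul, ← mul_assoc, ← mul_pow]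
    have := axy_ne_zero hω hη hξ a
    congr 2
    field_simp
  rw [h2, smul_dotProduct, smul_eq_mul] at h1
  rw [dotProduct_sub, mul_left_cancel₀ (inv_ne_zero hn0) h1, sub_self]

omit hω hη ht₀ hξ hnrm hN in
-- Each row is a sum over `h_a`, so multilinearity gives a sum over configurations, in which the
-- phases combine to a function of `numDown h`.
theorem det_Ftilde (q q' : Fin N → Fin 2 → ℂ) (j : ℕ) :
    (P.Ftilde q q' j).det = ∑ h : Fin N → Fin 2,
      Complex.exp (2 * Real.pi * Complex.I * numDown h / (N + 1)) ^ j
      * ((∏ a, ((Complex.exp (Complex.I * P.yc * P.η)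
          * (P.axy (P.ξ a) / P.dProd (P.ξ a - P.η))) ^ (h a : ℕ) * q a (h a) * q' a (h a)))
        * (P.Θ h).det) := by
  rw [Ftilde, Matrix.det_of_sum_smul]
  refine Finset.sum_congr rfl fun h _ => ?_
  rw [← mul_assoc]
  congr 1
  have : ∀ a, Complex.exp (2 * Real.pi * Complex.I * j * ((h a : ℕ) : ℂ) / (N + 1))
      = (Complex.exp (2 * Real.pi * Complex.I / (N + 1)) ^ j) ^ (h a : ℕ) := by
    intro a
    rw [← pow_mul, ← Complex.exp_nat_mul]
    push_cast
    ring_nf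
  simp only [this, mul_assoc _ (q _ _), mul_assoc ((Complex.exp (2 * Real.pi * Complex.I / (N + 1)) ^ j) ^ _)]
  rw [Finset.prod_mul_distrib, prod_const_pow, ← pow_mul, mul_comm j, pow_mul, ← Complex.exp_nat_mul]
  congr 3
  ring

/-- The matrix elements of the projectors on a number of down spins, between separate states. -/
theorem sepL_dotProduct_sepR (hκ : κ ≠ 0) (q q' : Fin N → Fin 2 → ℂ) {m : ℕ} (hm : m ≤ N) :
    ∑ h, P.sepL nrm κ q h * (if siteHeight 0 h = m then P.sepR nrm κ q' h else 0)
      = 1 / ((N : ℂ) + 1) * ∑ j ∈ Finset.range (N + 1),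
          Complex.exp (-(2 * Real.pi * Complex.I * m / (N + 1))) ^ j * (P.Ftilde q q' j).det := by
  -- The height at the first site counts down spins, and every ket `sk k` is supported on one value
  -- of this number. The projector is therefore diagonal in the basis of separate variables.
  have h1 : ∀ h, (if siteHeight 0 h = m then P.sepR nrm κ q' h else 0)
      = ∑ k : Fin N → Fin 2, (if numDown k = m then
          ((∏ a, ((κ⁻¹ * Complex.exp (Complex.I * P.yc * P.η)
          * (P.axy (P.ξ a) / P.dProd (P.ξ a - P.η))) ^ (k a : ℕ) * q' a (k a)))
            * (P.Θ k).det) else 0) * (nrm⁻¹ • P.sk k) h := by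
    intro h
    simp only [siteHeight_zero, Nat.cast_inj]
    rw [sepR, Finset.sum_apply]
    have h2 : ∀ k, P.sk k h = 0 ∨ numDown h = numDown k := fun k =>
      or_iff_not_imp_left.2 (numDown_of_sk_ne_zero hω ht₀ hξ k h)
    by_cases hh : numDown h = m
    · rw [if_pos hh]
      refine Finset.sum_congr rfl fun k _ => ?_
      rcases h2 k with h3 | h3
      · simp [h3]
      · rw [if_pos (h3 ▸ hh)]
        rfl
    · rw [if_neg hh]
      refine (Finset.sum_eq_zero fun k _ => ?_).symm
      rcases h2 k with h3 | h3
      · simp [h3]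
      · rw [if_neg (h3 ▸ hh), zero_mul]
  simp only [h1, Finset.mul_sum]
  rw [Finset.sum_comm]
  have h3 : ∀ k : Fin N → Fin 2, ∀ c : ℂ, ∑ h, P.sepL nrm κ q h * (c * (nrm⁻¹ • P.sk k) h)
      = c * ∏ a, (κ ^ (k a : ℕ) * q a (k a)) := by
    intro k c
    rw [← sepL_dotProduct_sk hω hη ht₀ hξ hN hnrm, dotProduct, Finset.mul_sum]
    exact Finset.sum_congr rfl fun h _ => mul_left_comm _ _ _
  simp only [h3, det_Ftilde, Finset.mul_sum]
  rw [Finset.sum_comm]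
  refine Finset.sum_congr rfl fun k _ => ?_
  have h4 := Complex.sum_exp_eq_ite (numDown_le k) hm
  set W := (∏ a, ((Complex.exp (Complex.I * P.yc * P.η)
          * (P.axy (P.ξ a) / P.dProd (P.ξ a - P.η))) ^ (k a : ℕ) * q a (k a) * q' a (k a)))
        * (P.Θ k).det with hW
  have h5 : ∀ j : ℕ, 1 / ((N : ℂ) + 1) * (Complex.exp (-(2 * Real.pi * Complex.I * m / (N + 1))) ^ j
      * (Complex.exp (2 * Real.pi * Complex.I * numDown k / (N + 1)) ^ j * W))
      = W * (1 / ((N : ℂ) + 1) * Complex.exp (2 * Real.pi * Complex.I * ((numDown k : ℂ) - m) / (N + 1)) ^ j) := by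
    intro j
    have : Complex.exp (2 * Real.pi * Complex.I * ((numDown k : ℂ) - m) / (N + 1))
        = Complex.exp (-(2 * Real.pi * Complex.I * m / (N + 1)))
          * Complex.exp (2 * Real.pi * Complex.I * numDown k / (N + 1)) := by
      rw [← Complex.exp_add]
      ring_nf
    rw [this, mul_pow]
    ring
  simp only [h5]
  rw [← Finset.mul_sum, ← Finset.mul_sum, h4]
  split_ifs
  · rw [hW, mul_one, mul_right_comm, ← Finset.prod_mul_distrib]
    congr 1
    refine Finset.prod_congr rfl fun a _ => ?_
    have : κ⁻¹ ^ (k a : ℕ) * κ ^ (k a : ℕ) = 1 := by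
      rw [← mul_pow, inv_mul_cancel₀ hκ, one_pow]
    simp only [mul_pow]
    linear_combination (Complex.exp (Complex.I * P.yc * P.η) ^ (k a : ℕ)
      * (P.axy (P.ξ a) / P.dProd (P.ξ a - P.η)) ^ (k a : ℕ) * q a (k a) * q' a (k a)) * this
  · rw [zero_mul, mul_zero]

end Normalized

end Generic

end SOSModel


namespace SOSModel

open Matrix

variable {N : ℕ}

/-! ### The spaces of states -/

/-- The ket of charge zero with the given coefficients. -/
noncomputable def toKet : ((Fin N → Fin 2) → ℂ) →ₗ[ℂ] Ket N where
  toFun v := ∑ h, v h • basisKet h (-(numDown h : ℤ))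
  map_add' v w := by simp [add_smul, Finset.sum_add_distrib]
  map_smul' c v := by simp [mul_smul, Finset.smul_sum]

/-- The bra of charge zero with the given coefficients. -/
noncomputable def toBra : ((Fin N → Fin 2) → ℂ) →ₗ[ℂ] Bra N where
  toFun v := ∑ h, v h • basisBra h (-(numDown h : ℤ))
  map_add' v w := by simp [add_smul, Finset.sum_add_distrib]
  map_smul' c v := by simp [mul_smul, Finset.smul_sum]

theorem toKet_apply (v : (Fin N → Fin 2) → ℂ) (h : Fin N → Fin 2) (a : ℤ) :
    toKet v (h, a) = if a = -(numDown h : ℤ) then v h else 0 := by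
  simp only [toKet, basisKet, LinearMap.coe_mk, AddHom.coe_mk, Finsupp.finsetSum_apply,
    Finsupp.smul_apply, Finsupp.single_apply, Prod.mk.injEq, smul_eq_mul]
  rw [Finset.sum_eq_single h]
  · simp [eq_comm]
  · intro k _ hk
    simp [hk]
  · simp

theorem toBra_apply (v : (Fin N → Fin 2) → ℂ) (w : Ket N) :
    toBra v w = ∑ h, v h * w (h, -(numDown h : ℤ)) := by
  simp [toBra, basisBra, LinearMap.sum_apply]

theorem toBra_toKet (v w : (Fin N → Fin 2) → ℂ) : toBra v (toKet w) = v ⬝ᵥ w := by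
  simp [toBra_apply, toKet_apply, dotProduct]

theorem toBra_basisKet (v : (Fin N → Fin 2) → ℂ) (h : Fin N → Fin 2) (a : ℤ) :
    toBra v (basisKet h a) = if a = -(numDown h : ℤ) then v h else 0 := by
  simp only [toBra_apply, basisKet, Finsupp.single_apply, Prod.mk.injEq]
  rw [Finset.sum_eq_single h]
  · simp
  · intro k _ hk
    simp [hk.symm]
  · simp

theorem toKet_single (h : Fin N → Fin 2) :
    toKet (Pi.single h 1) = basisKet h (-(numDown h : ℤ)) := by
  simp [toKet, Pi.single_apply]

theorem toBra_single (h : Fin N → Fin 2) :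
    toBra (Pi.single h 1) = basisBra h (-(numDown h : ℤ)) := by
  simp [toBra, Pi.single_apply]

theorem ket_ext {X Y : Ket N →ₗ[ℂ] ℂ} (hXY : ∀ h a, X (basisKet h a) = Y (basisKet h a)) : X = Y :=
  Finsupp.lhom_ext' fun p => LinearMap.ext_ring (hXY p.1 p.2)

theorem diagOp_basisKet (f : (Fin N → Fin 2) → ℤ → ℂ) (h : Fin N → Fin 2) (a : ℤ) :
    diagOp f (basisKet h a) = f h a • basisKet h a := by
  simp [diagOp, basisKet]

theorem diagOp_apply (f : (Fin N → Fin 2) → ℤ → ℂ) (v : Ket N) (p : (Fin N → Fin 2) × ℤ) :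
    diagOp f v p = f p.1 p.2 * v p := by
  have : Finsupp.lapply p ∘ₗ diagOp f = f p.1 p.2 • (Finsupp.lapply p : Ket N →ₗ[ℂ] ℂ) := by
    refine ket_ext fun h a => ?_
    simp only [LinearMap.comp_apply, diagOp_basisKet, LinearMap.smul_apply, map_smul, smul_eq_mul]
    by_cases hp : (h, a) = p
    · rw [← hp]
    · simp [basisKet, hp]
  exact LinearMap.congr_fun this v

theorem atTau_shift_basisKet (P : SOSModel N) (i j : Fin 2) (s : ℤ) (l : ℂ) (h : Fin N → Fin 2) (a : ℤ) :
    (P.atTau (P.monoEntry i j l) ∘ₗ shift s) (basisKet h a)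
      = ∑ k, P.monoEntry i j l (P.tval (a + s)) k h • basisKet k (a + s) := by
  simp [atTau, shift, basisKet]

theorem tval_neg_numDown (P : SOSModel N) (h : Fin N → Fin 2) : P.tval (-(numDown h : ℤ)) = P.ht 0 h := by
  rw [tval, ht]
  push_cast
  ring

/-- The condition `hs` says that the shift of the height label compensates the change of the number
of down spins, so charge zero is preserved. -/
theorem atTau_shift_toKet (P : SOSModel N) {i j : Fin 2} {s : ℤ} (hs : s + (j : ℕ) = (i : ℕ)) (l : ℂ)
    (v : (Fin N → Fin 2) → ℂ) :
    (P.atTau (P.monoEntry i j l) ∘ₗ shift s) (toKet v) = toKet (P.gr 0 i j l *ᵥ v) := by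
  have h1 : ∀ v : (Fin N → Fin 2) → ℂ, toKet v = ∑ h, v h • basisKet h (-(numDown h : ℤ)) := fun _ => rfl
  rw [h1, h1, map_sum]
  simp only [map_smul, atTau_shift_basisKet, mulVec, dotProduct, Finset.sum_smul, Finset.smul_sum,
    smul_smul]
  rw [Finset.sum_comm]
  refine Finset.sum_congr rfl fun k _ => Finset.sum_congr rfl fun h _ => ?_
  by_cases hc : (i : ℕ) + numDown k = (j : ℕ) + numDown h
  · have : -(numDown h : ℤ) + s = -(numDown k : ℤ) := by omega
    rw [this, tval_neg_numDown, mul_comm]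
    rfl
  · rw [gr, monoEntry_eq_zero hc, monoEntry_eq_zero hc]
    simp

theorem toBra_comp_atTau_shift (P : SOSModel N) {i j : Fin 2} {s : ℤ} (hs : s + (j : ℕ) = (i : ℕ)) (l : ℂ)
    (v : (Fin N → Fin 2) → ℂ) :
    toBra v ∘ₗ (P.atTau (P.monoEntry i j l) ∘ₗ shift s) = toBra (v ᵥ* P.gr 0 i j l) := by
  refine ket_ext fun h a => ?_
  rw [LinearMap.comp_apply, atTau_shift_basisKet]
  simp only [map_sum, map_smul, toBra_basisKet, vecMul, dotProduct, smul_eq_mul]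
  have h1 : ∀ k, P.monoEntry i j l (P.tval (a + s)) k h * (if a + s = -(numDown k : ℤ) then v k else 0)
      = if a = -(numDown h : ℤ) then v k * P.gr 0 i j l k h else 0 := by
    intro k
    by_cases hc : (i : ℕ) + numDown k = (j : ℕ) + numDown h
    · have : a + s = -(numDown k : ℤ) ↔ a = -(numDown h : ℤ) := by omega
      simp only [this]
      split_ifs with ha
      · rw [this.2 ha, tval_neg_numDown, mul_comm]
        rfl
      · rw [mul_zero]
    · rw [gr, monoEntry_eq_zero hc, monoEntry_eq_zero hc]
      simp
  simp only [h1]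
  split_ifs
  · rfl
  · simp

theorem opB_toKet (P : SOSModel N) (l : ℂ) (v : (Fin N → Fin 2) → ℂ) :
    P.opB l (toKet v) = toKet (P.gr 0 0 1 l *ᵥ v) :=
  P.atTau_shift_toKet (by simp) l v

theorem opC_toKet (P : SOSModel N) (l : ℂ) (v : (Fin N → Fin 2) → ℂ) :
    P.opC l (toKet v) = toKet (P.gr 0 1 0 l *ᵥ v) :=
  P.atTau_shift_toKet (by simp) l v

theorem toBra_comp_opB (P : SOSModel N) (l : ℂ) (v : (Fin N → Fin 2) → ℂ) :
    toBra v ∘ₗ P.opB l = toBra (v ᵥ* P.gr 0 0 1 l) :=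
  P.toBra_comp_atTau_shift (by simp) l v

theorem toBra_comp_opC (P : SOSModel N) (l : ℂ) (v : (Fin N → Fin 2) → ℂ) :
    toBra v ∘ₗ P.opC l = toBra (v ᵥ* P.gr 0 1 0 l) :=
  P.toBra_comp_atTau_shift (by simp) l v

theorem transfer_toKet (P : SOSModel N) (κ l : ℂ) (v : (Fin N → Fin 2) → ℂ) :
    P.transfer κ l (toKet v) = toKet (P.tm κ l *ᵥ v) := by
  simp [transfer, tm, opB_toKet, opC_toKet, Matrix.add_mulVec, Matrix.smul_mulVec]

theorem toBra_comp_transfer (P : SOSModel N) (κ l : ℂ) (v : (Fin N → Fin 2) → ℂ) :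
    toBra v ∘ₗ P.transfer κ l = toBra (v ᵥ* P.tm κ l) := by
  simp [transfer, tm, LinearMap.comp_add, LinearMap.comp_smul, toBra_comp_opB, toBra_comp_opC,
    Matrix.vecMul_add, Matrix.vecMul_smul]

theorem prod_ofFn_pow_toKet {M : ℕ} {F : Fin M → Module.End ℂ (Ket N)}
    {G : Fin M → Matrix (Fin N → Fin 2) (Fin N → Fin 2) ℂ}
    (hFG : ∀ n v, F n (toKet v) = toKet (G n *ᵥ v)) (e : Fin M → ℕ) (v : (Fin N → Fin 2) → ℂ) :
    (List.ofFn fun n => F n ^ e n).prod (toKet v)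
      = toKet ((List.ofFn fun n => G n ^ e n).prod *ᵥ v) := by
  have hpow : ∀ n k v, (F n ^ k) (toKet v) = toKet ((G n ^ k) *ᵥ v) := by
    intro n k
    induction k with
    | zero => simp
    | succ k ih =>
      intro v
      rw [pow_succ, pow_succ, Module.End.mul_apply, hFG, ih, Matrix.mulVec_mulVec]
  induction M with
  | zero => simp
  | succ M ih =>
    rw [List.ofFn_succ, List.ofFn_succ, List.prod_cons, List.prod_cons, Module.End.mul_apply,
      ih (fun n => hFG n.succ) _ (fun n => hpow n.succ), hpow, Matrix.mulVec_mulVec]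

theorem toBra_comp_prod_ofFn_pow {M : ℕ} {F : Fin M → Module.End ℂ (Ket N)}
    {G : Fin M → Matrix (Fin N → Fin 2) (Fin N → Fin 2) ℂ}
    (hFG : ∀ n v, toBra v ∘ₗ F n = toBra (v ᵥ* G n)) (e : Fin M → ℕ) (v : (Fin N → Fin 2) → ℂ) :
    toBra v ∘ₗ (List.ofFn fun n => F n ^ e n).prod
      = toBra (v ᵥ* (List.ofFn fun n => G n ^ e n).prod) := by
  have hpow : ∀ n k v, toBra v ∘ₗ (F n ^ k) = toBra (v ᵥ* (G n ^ k)) := by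
    intro n k
    induction k with
    | zero =>
      intro v
      simp [Module.End.one_eq_id]
    | succ k ih =>
      intro v
      rw [pow_succ', pow_succ', Module.End.mul_eq_comp, ← LinearMap.comp_assoc, hFG, ih,
        Matrix.vecMul_vecMul]
  induction M generalizing v with
  | zero => simp [Module.End.one_eq_id]
  | succ M ih =>
    rw [List.ofFn_succ, List.ofFn_succ, List.prod_cons, List.prod_cons, Module.End.mul_eq_comp,
      ← LinearMap.comp_assoc, hpow, ih (fun n => hFG n.succ) _ _ (fun n => hpow n.succ),
      Matrix.vecMul_vecMul]

theorem sovBra_eq (P : SOSModel N) (nrm : ℂ) (h : Fin N → Fin 2) :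
    P.sovBra nrm h = toBra (nrm⁻¹ • P.sb h) := by
  have h1 : nrm⁻¹ • basisBra (fun _ => 0) 0 = toBra (nrm⁻¹ • Pi.single (fun _ : Fin N => (0 : Fin 2)) 1) := by
    rw [map_smul, toBra_single, numDown_zero]
    rfl
  rw [sovBra, h1, toBra_comp_prod_ofFn_pow (fun n v => ?_), Matrix.smul_vecMul]
  · rfl
  · rw [LinearMap.comp_smul, toBra_comp_opC, Matrix.vecMul_smul, map_smul]

theorem sovKet_eq (P : SOSModel N) (nrm : ℂ) (h : Fin N → Fin 2) :
    P.sovKet nrm h = toKet (nrm⁻¹ • P.sk h) := by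
  have h1 : nrm⁻¹ • basisKet (fun _ => 1) (-(N : ℤ))
      = toKet (nrm⁻¹ • Pi.single (fun _ : Fin N => (1 : Fin 2)) 1) := by
    rw [map_smul, toKet_single, numDown_one]
  rw [sovKet, h1, prod_ofFn_pow_toKet (fun n v => ?_), Matrix.mulVec_smul]
  · rfl
  · rw [LinearMap.smul_apply, opC_toKet, Matrix.smul_mulVec, map_smul]

theorem sepBra_eq (P : SOSModel N) (nrm κ : ℂ) (q : Fin N → Fin 2 → ℂ) :
    P.sepBra nrm κ q = toBra (P.sepL nrm κ q) := by
  simp only [sepBra, sepL, sovBra_eq, map_sum, map_smul]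

theorem sepKet_eq (P : SOSModel N) (nrm κ : ℂ) (q : Fin N → Fin 2 → ℂ) :
    P.sepKet nrm κ q = toKet (P.sepR nrm κ q) := by
  simp only [sepKet, sepR, sovKet_eq, map_sum, map_smul]

theorem toKet_injective : Function.Injective (toKet : ((Fin N → Fin 2) → ℂ) →ₗ[ℂ] Ket N) := by
  intro v w hvw
  funext h
  have := DFunLike.congr_fun hvw (h, -(numDown h : ℤ))
  simpa [toKet_apply] using this

theorem toBra_injective : Function.Injective (toBra : ((Fin N → Fin 2) → ℂ) →ₗ[ℂ] Bra N) := by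
  intro v w hvw
  funext h
  have := LinearMap.congr_fun hvw (basisKet h (-(numDown h : ℤ)))
  simpa [toBra_basisKet] using this

/-- By the choice of `t₀`, the eigenvalue of `S_τ` differs from the prescribed one by `-2η(a +
|h|)`, and `η ≠ 0`. -/
theorem charge_eq_zero {P : SOSModel N} (hη : P.η ∉ P.Γ) {h : Fin N → Fin 2} {a : ℤ}
    (ha : P.η * ∑ n, sz (h n) + 2 * P.tval a = P.xc * Real.pi + P.yc * Real.pi * P.ω) :
    a = -(numDown h : ℤ) := by
  have hη0 : P.η ≠ 0 := fun e => hη (e ▸ zero_mem_Γ)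
  rw [sum_sz, tval, t₀] at ha
  have h1 : P.η * ((a + numDown h : ℤ) : ℂ) = 0 := by
    push_cast
    linear_combination -(1 / 2) * ha
  have h2 := (mul_eq_zero.1 h1).resolve_left hη0
  have h3 : a + numDown h = 0 := by exact_mod_cast h2
  omega

theorem exists_toKet_of_mem_spaceR {P : SOSModel N} (hη : P.η ∉ P.Γ) {Ψ : Ket N} (hΨ : Ψ ∈ P.spaceR) :
    ∃ v, Ψ = toKet v := by
  refine ⟨fun h => Ψ (h, -(numDown h : ℤ)), Finsupp.ext fun p => ?_⟩
  obtain ⟨h, a⟩ := p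
  rw [toKet_apply]
  split_ifs with ha
  · rw [ha]
  · by_contra hne
    refine ha (charge_eq_zero hη ?_)
    have h1 := DFunLike.congr_fun (Module.End.mem_eigenspace_iff.1 hΨ) (h, a)
    rw [opStau, diagOp_apply, Finsupp.smul_apply, smul_eq_mul] at h1
    exact mul_right_cancel₀ hne h1

theorem exists_toBra_of_mem_spaceL {P : SOSModel N} (hη : P.η ∉ P.Γ) {Φ : Bra N} (hΦ : Φ ∈ P.spaceL) :
    ∃ v, Φ = toBra v := by
  refine ⟨fun h => Φ (basisKet h (-(numDown h : ℤ))), ket_ext fun h a => ?_⟩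
  rw [toBra_basisKet]
  split_ifs with ha
  · rw [ha]
  · by_contra hne
    refine ha (charge_eq_zero hη ?_)
    have h1 := LinearMap.congr_fun (Module.End.mem_eigenspace_iff.1 hΦ.2) (basisKet h a)
    rw [LinearMap.dualMap_apply, opStau, diagOp_basisKet, map_smul, LinearMap.smul_apply, smul_eq_mul,
      smul_eq_mul] at h1
    exact mul_right_cancel₀ hne h1

theorem localHeight_toKet {P : SOSModel N} (hη : P.η ∉ P.Γ) (n : Fin N) (m : ℕ)
    (v : (Fin N → Fin 2) → ℂ) :
    P.localHeight n (P.t₀ + P.η * m) (toKet v)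
      = toKet fun h => if siteHeight n h = m then v h else 0 := by
  have hη0 : P.η ≠ 0 := fun e => hη (e ▸ zero_mem_Γ)
  ext ⟨h, a⟩
  rw [localHeight, diagOp_apply, toKet_apply, toKet_apply]
  by_cases ha : a = -(numDown h : ℤ)
  · have h1 : ∑ k ∈ Finset.univ.filter (· < n), sz (h k)
        = (((n : ℕ) - 2 * ((∑ k ∈ Finset.univ.filter fun k : Fin N => (k : ℕ) < n, (h k : ℕ) : ℕ) : ℤ) : ℤ) : ℂ) := by
      simp only [sz, Finset.sum_sub_distrib, ← Finset.mul_sum, Finset.sum_const, nsmul_eq_mul, mul_one,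
        ← Fin.lt_def]
      rw [Finset.filter_gt_eq_Iio, Fin.card_Iio]
      push_cast
      rfl
    have h2 : P.tval a + P.η * ∑ k ∈ Finset.univ.filter (· < n), sz (h k)
        = P.t₀ + P.η * (siteHeight n h : ℤ) := by
      rw [h1, ha, tval, siteHeight]
      push_cast
      ring
    have h3 : P.t₀ + P.η * ((siteHeight n h : ℤ) : ℂ) = P.t₀ + P.η * m ↔ siteHeight n h = m := by
      rw [add_right_inj, mul_right_inj' hη0]
      exact_mod_cast Iff.rfl
    simp only [h2, h3, if_pos ha, ite_mul, one_mul, zero_mul]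
  · rw [if_neg ha, if_neg ha, mul_zero]

end SOSModel


/-! ### The theorem -/

open SOSModel Matrix in
theorem mainTheorem5 {N : ℕ} (hN : 1 ≤ N) (P : SOSModel N)
    -- the theta functions are defined
    (hω : 0 < P.ω.im)
    -- genericity of the crossing parameter: the R-matrix has no pole on the heights
    (hη : P.η ∉ P.Γ) (ht₀ : ∀ k : ℤ, P.t₀ + P.η * k ∉ P.Γ)
    -- genericity of the inhomogeneity parameters
    (hξ : ∀ a b : Fin N, a ≠ b →
      P.ξ a - P.ξ b ∉ P.Γ ∧ P.ξ a - P.ξ b + P.η ∉ P.Γ ∧ P.ξ a - P.ξ b - P.η ∉ P.Γ)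
    (κ : ℂ) (hκ : κ ≠ 0) :
    -- the normalization of the reference states can be fixed
    (∃ nrm : ℂ, P.IsNormalization nrm) ∧
    ∀ nrm : ℂ, P.IsNormalization nrm →
    -- for all left and right eigenstates of the transfer matrix
    ∀ (t t' : ℂ → ℂ) (Φ : SOSModel.Bra N) (Ψ : SOSModel.Ket N),
      P.IsLeftEigenstate κ t Φ → P.IsRightEigenstate κ t' Ψ →
      -- they are separate states
      (∃ q, P.IsCoeff t q ∧ Φ = P.sepBra nrm κ q) ∧
      (∃ q', P.IsCoeff t' q' ∧ Ψ = P.sepKet nrm κ q') ∧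
      -- and in terms of their coefficients the matrix elements are sums of determinants
      ∀ q q' : Fin N → Fin 2 → ℂ,
        P.IsCoeff t q → Φ = P.sepBra nrm κ q →
        P.IsCoeff t' q' → Ψ = P.sepKet nrm κ q' →
        ∀ (n : Fin N) (s : ℂ), (∃ m : ℕ, m ≤ N ∧ s = P.t₀ + P.η * m) →
          Φ (P.localHeight n s Ψ) =
            (∏ b ∈ Finset.univ.filter (· < n), t (P.ξ b) / t' (P.ξ b))
              * (1 / ((N : ℂ) + 1) * ∑ j ∈ Finset.range (N + 1),
                  Complex.exp (-(2 * Real.pi * Complex.I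
                      * (j * (s - P.t₀) / (P.η * (N + 1)))))
                    * (P.Ftilde q q' j).det) := by
  have key := fun (nrm : ℂ) => show P.sovBra nrm (fun _ => 0) (P.sovKet nrm (fun _ => 0))
      = nrm⁻¹ * (nrm⁻¹ * (P.sb (fun _ => 0) ⬝ᵥ P.sk (fun _ => 0))) by
    rw [sovBra_eq, sovKet_eq, toBra_toKet, smul_dotProduct, dotProduct_smul, smul_eq_mul, smul_eq_mul]
  constructor
  · obtain ⟨nrm, h1, h2⟩ := exists_normalization hω hη ht₀ hξ hN
    exact ⟨nrm, h1, by rw [key, h2]⟩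
  rintro nrm ⟨hn0, hnrm⟩ t t' Φ Ψ ⟨hΦ, hΦ0, hΦt⟩ ⟨hΨ, hΨ0, hΨt⟩
  rw [key] at hnrm
  obtain ⟨φ, rfl⟩ := exists_toBra_of_mem_spaceL hη hΦ
  obtain ⟨ψ, rfl⟩ := exists_toKet_of_mem_spaceR hη hΨ
  have hφ0 : φ ≠ 0 := by
    rintro rfl
    exact hΦ0 (map_zero _)
  have hψ0 : ψ ≠ 0 := by
    rintro rfl
    exact hΨ0 (map_zero _)
  have hφ : ∀ l, φ ᵥ* P.tm κ l = t l • φ := fun l =>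
    toBra_injective (by rw [← toBra_comp_transfer, hΦt, map_smul])
  have hψ : ∀ l, P.tm κ l *ᵥ ψ = t' l • ψ := fun l =>
    toKet_injective (by rw [← transfer_toKet, hΨt, map_smul])
  refine ⟨?_, ?_, ?_⟩
  · obtain ⟨q, hq, hqφ⟩ := exists_eq_sepL hω hη ht₀ hξ hN hnrm hn0 hκ hφ0 hφ
    exact ⟨q, hq, by rw [sepBra_eq, ← hqφ]⟩
  · obtain ⟨q, hq, hqψ⟩ := exists_eq_sepR hω hη ht₀ hξ hN hnrm hn0 hκ hψ0 hψ
    exact ⟨q, hq, by rw [sepKet_eq, ← hqψ]⟩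
  · rintro q q' - hqφ - hqψ n s ⟨m, hm, rfl⟩
    have hη0 : P.η ≠ 0 := fun e => hη (e ▸ zero_mem_Γ)
    rw [sepBra_eq] at hqφ
    rw [sepKet_eq] at hqψ
    have ht' : ∀ a, t' (P.ξ a) ≠ 0 := fun a hc =>
      mul_ne_zero (axy_ne_zero hω hη hξ a) (dProd_ne_zero hω hη hξ a)
        (by rw [← eigenvalue_mul_of_right hω ht₀ hκ hψ0 hψ a, hc, zero_mul])
    rw [localHeight_toKet hη, toBra_toKet]
    -- The projector is moved from site `n` to the first site, where it fixes the number of down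
    -- spins.
    have h1 := dotProduct_siteHeight hω hη ht₀ hφ hψ ht' m n.isLt.le
    refine h1.trans ?_
    rw [toBra_injective hqφ, toKet_injective hqψ,
      sepL_dotProduct_sepR hω hη ht₀ hξ hN hnrm hκ q q' hm]
    congr 2
    refine Finset.sum_congr rfl fun j _ => ?_
    rw [← Complex.exp_nat_mul]
    congr 2
    -- Since `s - t₀ = η m`, the parameter `η` cancels in the exponent.
    have : (N : ℂ) + 1 ≠ 0 := Nat.cast_add_one_ne_zero N
    field_simp
    ring
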